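/- Let $G$ and $M$ be complex Lie groups with Lie algebras $\mathfrak g,\mathfrak m$, let $H\le G$ be a closed complex Lie subgroup with Lie algebra $\mathfrak h$, and let $\tau:H\to M$ be a holomorphic homomorphism. (In particular $G,M$ may be complex algebraic groups with $G$ and $H$ connected.) Let $X=G/H$ and let $P=G_H(M)=G\times^\tau M$ be the holomorphic principal $M$-bundle over $X$ obtained from the principal $H$-bundle $G\to G/H$ by extension of the structure group along $\tau$; that is, $P=(G\times M)/H$ with $(a,b)\cdot h=(ah,\tau(h)^{-1}b)$ and $[a,b]\,m=[a,bm]$. Let $\pi:P\to X$ be the projection, $\operatorname{At}P=TP/M$ the Atiyah bundle, $\overline{d\pi}:\operatorname{At}P\to TX$ its anchor, and for $\lambda\in\mathbb C$ let $$C_\lambda(P)=\{\nu\in\operatorname{Hom}(T_xX,\operatorname{At}P_x)\;:\;x\in X,\ \overline{d\pi}\circ\nu=\lambda\cdot\mathrm{Id}_{T_xX}\}\subset\operatorname{Tot}(\operatorname{At}P\otimes\Omega_X)$$ be the universal $\lambda$-connection space of $P$. Embed $\mathfrak h$ in $\mathfrak g\oplus\mathfrak m$ by $\xi\mapsto(\xi,-d\tau(\xi))$.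 This image is preserved by $H$ acting through $\mathrm{Ad}_G(h)\oplus\mathrm{Ad}_M(\tau(h))$. Let $\sigma:(\mathfrak g\oplus\mathfrak m)/\mathfrak h\to\mathfrak g/\mathfrak h$ be the projection, let $V=\operatorname{Hom}(\mathfrak g/\mathfrak h,(\mathfrak g\oplus\mathfrak m)/\mathfrak h)$ with its induced $H$-action $h\cdot\nu=h\circ\nu\circ h^{-1}$, and for $\lambda\in\mathbb C$ let $$\mathfrak a_\lambda=\{\nu\in V\;:\;\sigma\circ\nu=\lambda\cdot\mathrm{Id}_{\mathfrak g/\mathfrak h}\}.$$ Then for every $\lambda$ the set $\mathfrak a_\lambda$ is non-empty and $H$-invariant, and it is an affine $H$-space modelled on the $H$-module $\operatorname{Hom}(\mathfrak g/\mathfrak h,\mathfrak m)$, which acts through the inclusion $\mathfrak m\to(\mathfrak g\oplus\mathfrak m)/\mathfrak h$, $\eta\mapsto\overline{(0,\eta)}$. Moreover $$C_\lambda(P)\;\cong\;G\times^H\mathfrak a_\lambda .$$ More precisely, there is a biholomorphism $$\Phi:\ G\times^H V\ \longrightarrow\ \operatorname{Tot}(\operatorname{At}P\otimes\Omega_X)=\operatorname{Tot}(\operatorname{Hom}(TX,\operatorname{At}P))$$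 over $X$, linear and bijective on fibres, which is given by $\Phi[g,\nu]=\nu$ under the identifications $\mathfrak g/\mathfrak h\cong T_{gH}X$, $\bar\xi\mapsto d(G\to X)(dL_g\xi)$, and $(\mathfrak g\oplus\mathfrak m)/\mathfrak h\cong T_{[g,1]}P\cong(\operatorname{At}P)_{gH}$, $\overline{(\xi,\eta)}\mapsto d\rho_{(g,1)}(dL_g\xi,\eta)$, where $\rho:G\times M\to P$ is the quotient map; and for every $\lambda\in\mathbb C$ it restricts to a homeomorphism, $[g,\nu]\mapsto\Phi[g,\nu]$, from the associated bundle $G\times^H\mathfrak a_\lambda$ onto $C_\lambda(P)$. -/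

import Mathlib

open Set Bundle
open scoped Manifold ContDiff Topology
set_option linter.unusedSectionVars false

noncomputable section

namespace LambdaConn

/-- The holomorphic inverse function theorem: a map whose differential at `x` is invertible is a
local biholomorphism at `x`. -/
theorem isLocalDiffeomorphAt_of_mfderiv {EM EN HM HN M N : Type*}
    [NormedAddCommGroup EM] [NormedSpace ℂ EM] [CompleteSpace EM]
    [NormedAddCommGroup EN] [NormedSpace ℂ EN] [TopologicalSpace HM] [TopologicalSpace HN]
    {I : ModelWithCorners ℂ EM HM} {J : ModelWithCorners ℂ EN HN} [I.Boundaryless] [J.Boundaryless]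
    [TopologicalSpace M] [ChartedSpace HM M] [IsManifold I ω M]
    [TopologicalSpace N] [ChartedSpace HN N] [IsManifold J ω N]
    {f : M → N} {D : Set M} (hD : IsOpen D) (hf : ContMDiffOn I J ω f D) {x : M} (hx : x ∈ D)
    (e : EM ≃L[ℂ] EN)
    (he : ∀ v : EM, (mfderiv I J f x : EM →L[ℂ] EN) v = e v) :
    IsLocalDiffeomorphAt I J ω f x := by
  set cx := extChartAt I x with hcx
  set cy := extChartAt J (f x) with hcy
  set g : EM → EN := cy ∘ f ∘ cx.symm with hg
  have hxs : x ∈ cx.source := mem_extChartAt_source x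
  have hys : f x ∈ cy.source := mem_extChartAt_source (f x)
  have hcxt : IsOpen cx.target := isOpen_extChartAt_target x
  have hcys : IsOpen cy.source := isOpen_extChartAt_source (f x)
  have hcxs : ContMDiffOn 𝓘(ℂ, EM) I ω cx.symm cx.target := contMDiffOn_extChartAt_symm x
  have hcyc : ContMDiffOn J 𝓘(ℂ, EN) ω cy cy.source := by
    rw [hcy, extChartAt_source]; exact contMDiffOn_extChartAt
  set O : Set EM := cx.target ∩ cx.symm ⁻¹' (D ∩ f ⁻¹' cy.source) with hO
  have hOo : IsOpen O :=
    hcxs.continuousOn.isOpen_inter_preimage hcxt (hf.continuousOn.isOpen_inter_preimage hD hcys)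
  have hgO : ContDiffOn ℂ ω g O := by
    rw [← contMDiffOn_iff_contDiffOn]
    refine hcyc.comp (hf.comp (hcxs.mono inter_subset_left) fun z hz => hz.2.1) ?_
    intro z hz; exact hz.2.2
  have hxO : cx x ∈ O := ⟨cx.map_source hxs, by
    change cx.symm (cx x) ∈ D ∩ f ⁻¹' cy.source
    rw [cx.left_inv hxs]; exact ⟨hx, hys⟩⟩
  have hgx : ContDiffAt ℂ ω g (cx x) := hgO.contDiffAt (hOo.mem_nhds hxO)
  have hd : HasFDerivAt g (e : EM →L[ℂ] EN) (cx x) := by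
    have h1 : MDifferentiableAt I J f x := (hf.contMDiffAt (hD.mem_nhds hx)).mdifferentiableAt (by simp)
    have h2 : mfderiv I J f x = fderivWithin ℂ (writtenInExtChartAt I J x f) (range I)
      ((extChartAt I x) x) := h1.mfderiv
    rw [I.range_eq_univ, fderivWithin_univ] at h2
    have h3 : HasFDerivAt g (fderiv ℂ g (cx x)) (cx x) :=
      (hgx.differentiableAt (by simp)).hasFDerivAt
    have h4 : fderiv ℂ g (cx x) = (e : EM →L[ℂ] EN) := ContinuousLinearMap.ext fun v => by
      have h5 := he v
      rw [h2] at h5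
      exact h5
    rwa [h4] at h3
  set φ := hgx.toOpenPartialHomeomorph g hd (by simp) with hφ
  have hφx : cx x ∈ φ.source := hgx.mem_toOpenPartialHomeomorph_source hd (by simp)
  have hφg : (φ : EM → EN) = g := rfl
  set R : Set EM := O ∩ fderiv ℂ g ⁻¹' range ((↑) : (EM ≃L[ℂ] EN) → EM →L[ℂ] EN) with hR
  have hRo : IsOpen R := by
    refine ContinuousOn.isOpen_inter_preimage ?_ hOo (ContinuousLinearEquiv.isOpen)
    exact hgO.continuousOn_fderiv_of_isOpen hOo (by simp)
  have hxR : cx x ∈ R := ⟨hxO, ⟨e, hd.fderiv.symm⟩⟩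
  set ψ := φ.restr R with hψ
  have hψs : ψ.source = φ.source ∩ R := by rw [hψ, φ.restr_source, hRo.interior_eq]
  have hψg : ∀ z, ψ z = g z := fun z => rfl
  have hψsymm : ContDiffOn ℂ ω ψ.symm ψ.target := by
    intro z hz
    have hz' : ψ.symm z ∈ ψ.source := ψ.map_target hz
    rw [hψs] at hz'
    obtain ⟨e', he'⟩ := hz'.2.2
    have hc : ContDiffAt ℂ ω g (ψ.symm z) := hgO.contDiffAt (hOo.mem_nhds hz'.2.1)
    refine (ψ.contDiffAt_symm (f₀' := e') hz ?_ hc).contDiffWithinAt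
    rw [he']
    exact (hc.differentiableAt (by simp)).hasFDerivAt
  let Φ : PartialEquiv M N := (cx.trans ψ.toPartialEquiv).trans cy.symm
  have hS : Φ.source = cx.source ∩ cx ⁻¹' ψ.source := by
    ext z
    simp only [Φ, PartialEquiv.trans_source, mem_inter_iff, mem_preimage,
      PartialEquiv.symm_source, PartialEquiv.coe_trans, Function.comp]
    constructor
    · exact fun h => h.1
    · intro h
      refine ⟨h, ?_⟩
      have h2 := h.2
      change cx z ∈ ψ.source at h2
      rw [hψs] at h2
      exact cy.map_source h2.2.1.2.2
  have hT : Φ.target = cy.source ∩ cy ⁻¹' ψ.target := by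
    ext z
    simp only [Φ, PartialEquiv.trans_target, mem_inter_iff, mem_preimage,
      PartialEquiv.symm_target, PartialEquiv.symm_symm]
    constructor
    · exact fun h => ⟨h.1, h.2.1⟩
    · intro h
      refine ⟨h.1, h.2, ?_⟩
      have h2 := ψ.map_target h.2
      rw [hψs] at h2
      exact h2.2.1.1
  have hEq : EqOn f Φ Φ.source := by
    intro z hz
    rw [hS] at hz
    have h2 : cx z ∈ ψ.source := hz.2
    rw [hψs] at h2
    have h3 : f (cx.symm (cx z)) ∈ cy.source := h2.2.1.2.2
    have h4 : Φ z = cy.symm (cy (f (cx.symm (cx z)))) := rfl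
    rw [h4, cy.left_inv h3, cx.left_inv hz.1]
  refine ⟨⟨Φ, ?_, ?_, ?_, ?_⟩, ?_, hEq⟩
  · rw [hS]
    exact (continuousOn_extChartAt x).isOpen_inter_preimage (isOpen_extChartAt_source x)
      ψ.open_source
  · rw [hT]
    exact (continuousOn_extChartAt (f x)).isOpen_inter_preimage hcys ψ.open_target
  · refine (hf.mono fun z hz => ?_).congr fun z hz => (hEq hz).symm
    rw [show _ = _ from hS] at hz
    have h2 : cx z ∈ ψ.source := hz.2
    rw [hψs] at h2
    have h3 : cx.symm (cx z) ∈ D := h2.2.1.2.1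
    rwa [cx.left_inv hz.1] at h3
  · have h5 : ContMDiffOn J I ω (cx.symm ∘ ψ.symm ∘ cy) Φ.target := by
      rw [hT]
      refine hcxs.comp ((contMDiffOn_iff_contDiffOn.2 hψsymm).comp (hcyc.mono inter_subset_left)
        fun z hz => hz.2) ?_
      intro z hz
      have h2 := ψ.map_target hz.2
      rw [hψs] at h2
      exact h2.2.1.1
    exact h5
  · rw [show _ = _ from hS]
    refine ⟨hxs, ?_⟩
    change cx x ∈ ψ.source
    rw [hψs]
    exact ⟨hφx, hxR⟩

section Slice
variable {EG EH G : Type*}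
  [NormedAddCommGroup EG] [NormedSpace ℂ EG] [FiniteDimensional ℂ EG]
  [NormedAddCommGroup EH] [NormedSpace ℂ EH] [FiniteDimensional ℂ EH]
variable [TopologicalSpace G] [ChartedSpace EG G] [Group G] [LieGroup 𝓘(ℂ, EG) ω G]

/-- `H`, which carries the subspace topology and the structure of a complex Lie group, is a closed
complex Lie subgroup of `G`: it is closed and its inclusion is a holomorphic immersion. -/
class IsClosedLieSubgroup (EG EH : Type*) {G : Type*}
    [NormedAddCommGroup EG] [NormedSpace ℂ EG] [NormedAddCommGroup EH] [NormedSpace ℂ EH]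
    [TopologicalSpace G] [ChartedSpace EG G] [Group G] (H : Subgroup G) [ChartedSpace EH H] :
    Prop where
  isClosed : IsClosed (H : Set G)
  contMDiff_val : ContMDiff 𝓘(ℂ, EH) 𝓘(ℂ, EG) ω (Subtype.val : H → G)
  injective_mfderiv : ∀ h : H, Function.Injective
    (mfderiv 𝓘(ℂ, EH) 𝓘(ℂ, EG) (Subtype.val : H → G) h)

variable (EG EH)
variable (H : Subgroup G) [ChartedSpace EH H]

/-- The differential at `1` of the inclusion `H → G`, as a map `𝔥 → 𝔤`. -/
def dIncl : EH →L[ℂ] EG := mfderiv 𝓘(ℂ, EH) 𝓘(ℂ, EG) (Subtype.val : H → G) 1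

/-- The Lie algebra `𝔥` of `H`, as a subspace of the Lie algebra `𝔤 = T_1 G`. -/
def lieSub : Submodule ℂ EG := LinearMap.range (dIncl EG EH H : EH →ₗ[ℂ] EG)

/-- A complement of `𝔥` in `𝔤`, the model space for `G ⧸ H`. -/
def sliceModel : Submodule ℂ EG := Classical.choose (lieSub EG EH H).exists_isCompl

variable [LieGroup 𝓘(ℂ, EH) ω H] [IsClosedLieSubgroup EG EH H]

/-- A holomorphic slice for the right action of `H` on `G`: on the open right `H`-invariant
neighbourhood `W` of `1`, the map `U × H → W`, `(u, h) ↦ s u * h` is biholomorphic, with inverse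
`w ↦ (σ w, η w)`. -/
structure SliceData where
  U : Set (sliceModel EG EH H)
  W : Set G
  s : sliceModel EG EH H → G
  σ : G → sliceModel EG EH H
  η : G → H
  isOpen_U : IsOpen U
  isOpen_W : IsOpen W
  one_mem : 1 ∈ W
  contMDiffOn_s : ContMDiffOn 𝓘(ℂ, sliceModel EG EH H) 𝓘(ℂ, EG) ω s U
  contMDiffOn_σ : ContMDiffOn 𝓘(ℂ, EG) 𝓘(ℂ, sliceModel EG EH H) ω σ W
  contMDiffOn_η : ContMDiffOn 𝓘(ℂ, EG) 𝓘(ℂ, EH) ω η W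
  s_spec : ∀ u ∈ U, s u ∈ W ∧ σ (s u) = u ∧ η (s u) = 1
  σ_spec : ∀ w ∈ W, σ w ∈ U ∧ s (σ w) * η w = w
  mul_spec : ∀ w ∈ W, ∀ h : H, w * h ∈ W ∧ σ (w * h) = σ w ∧ η (w * h) = η w * h

theorem nonempty_sliceData : Nonempty (SliceData EG EH H) := by
  have : IsTopologicalGroup G := topologicalGroup_of_lieGroup 𝓘(ℂ, EG) ω
  have : IsTopologicalGroup H := topologicalGroup_of_lieGroup 𝓘(ℂ, EH) ω
  have : CompleteSpace (sliceModel EG EH H) := FiniteDimensional.complete ℂ _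
  have : CompleteSpace EH := FiniteDimensional.complete ℂ _
  set c := extChartAt 𝓘(ℂ, EG) (1 : G) with hc
  let S := sliceModel EG EH H
  have hval : ContMDiff 𝓘(ℂ, EH) 𝓘(ℂ, EG) ω (Subtype.val : H → G) :=
    IsClosedLieSubgroup.contMDiff_val
  -- the transversal through the identity
  set k : S → EG := fun u => c 1 + (u : EG) with hk
  set t : S → G := fun u => c.symm (k u) with ht
  have hkd : ContDiff ℂ ω k := contDiff_const.add S.subtypeL.contDiff
  set U₁ : Set S := k ⁻¹' c.target with hU₁
  have hU₁o : IsOpen U₁ := (isOpen_extChartAt_target (1 : G)).preimage hkd.continuous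
  have hk0 : k 0 = c 1 := by simp [hk]
  have h0U₁ : (0 : S) ∈ U₁ := by
    change k 0 ∈ c.target
    rw [hk0]; exact mem_extChartAt_target 1
  have htd : ContMDiffOn 𝓘(ℂ, S) 𝓘(ℂ, EG) ω t U₁ :=
    (contMDiffOn_extChartAt_symm (1 : G)).comp hkd.contMDiff.contMDiffOn fun u hu => hu
  have ht0 : t 0 = 1 := by
    change c.symm (k 0) = 1
    rw [hk0]; exact extChartAt_to_inv (I := 𝓘(ℂ, EG)) (1 : G)
  have htm : HasMFDerivAt 𝓘(ℂ, S) 𝓘(ℂ, EG) t 0 (S.subtypeL : S →L[ℂ] EG) := by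
    have h1 : HasMFDerivAt 𝓘(ℂ, S) 𝓘(ℂ, EG) k 0 (S.subtypeL : S →L[ℂ] EG) :=
      HasFDerivAt.hasMFDerivAt (S.subtypeL.hasFDerivAt.const_add (c 1))
    have h2 : HasMFDerivAt 𝓘(ℂ, EG) 𝓘(ℂ, EG) c.symm (k 0)
        (ContinuousLinearMap.id ℂ EG : EG →L[ℂ] EG) := by
      rw [hk0]
      have h3 : MDifferentiableWithinAt 𝓘(ℂ, EG) 𝓘(ℂ, EG) c.symm (range 𝓘(ℂ, EG)) (c 1) :=
        mdifferentiableWithinAt_extChartAt_symm (mem_extChartAt_target 1)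
      have h4 := h3.hasMFDerivWithinAt
      rw [show mfderivWithin 𝓘(ℂ, EG) 𝓘(ℂ, EG) c.symm (range 𝓘(ℂ, EG)) (c 1) = _ from
        mfderivWithin_range_extChartAt_symm (I := 𝓘(ℂ, EG)) (x := (1 : G)),
        𝓘(ℂ, EG).range_eq_univ] at h4
      exact hasMFDerivWithinAt_univ.1 h4
    exact h2.comp 0 h1
  -- the multiplication map
  set Fm : S × H → G := fun p => t p.1 * p.2 with hFm
  have hFd : ContMDiffOn (𝓘(ℂ, S).prod 𝓘(ℂ, EH)) 𝓘(ℂ, EG) ω Fm (U₁ ×ˢ univ) :=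
    (htd.comp contMDiff_fst.contMDiffOn fun p hp => hp.1).mul
      (hval.comp contMDiff_snd).contMDiffOn
  have hDo : IsOpen (U₁ ×ˢ (univ : Set H)) := hU₁o.prod isOpen_univ
  have hder : ∀ v : S × EH, (mfderiv (𝓘(ℂ, S).prod 𝓘(ℂ, EH)) 𝓘(ℂ, EG) Fm (0, 1) :
      S × EH →L[ℂ] EG) v = (v.1 : EG) + dIncl EG EH H v.2 := by
    intro v
    have hmd : MDifferentiableAt (𝓘(ℂ, S).prod 𝓘(ℂ, EH)) 𝓘(ℂ, EG) Fm (0, 1) :=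
      (hFd.contMDiffAt (hDo.mem_nhds ⟨h0U₁, mem_univ _⟩)).mdifferentiableAt (by simp)
    have h1 := mfderiv_prod_eq_add_apply (v := v) hmd
    refine h1.trans ?_
    have h2 : (mfderiv 𝓘(ℂ, S) 𝓘(ℂ, EG) (fun z : S => Fm (z, 1)) 0 : S →L[ℂ] EG) = S.subtypeL := by
      have h3 : (fun z : S => Fm (z, 1)) = t := by funext z; simp [hFm]
      refine (congrArg (fun f : S → G => (show S →L[ℂ] EG from mfderiv 𝓘(ℂ, S) 𝓘(ℂ, EG) f 0))
        h3).trans htm.mfderiv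
    have h4 : (mfderiv 𝓘(ℂ, EH) 𝓘(ℂ, EG) (fun z : H => Fm (0, z)) 1 : EH →L[ℂ] EG) =
        dIncl EG EH H := by
      have h3 : (fun z : H => Fm (0, z)) = Subtype.val := by funext z; simp [hFm, ht0]
      exact (congrArg (fun f : H → G => (show EH →L[ℂ] EG from mfderiv 𝓘(ℂ, EH) 𝓘(ℂ, EG) f 1)) h3)
    exact congrArg₂ (· + ·) (DFunLike.congr_fun h2 v.1) (DFunLike.congr_fun h4 v.2)
  have hcompl : IsCompl (lieSub EG EH H) S := Classical.choose_spec (lieSub EG EH H).exists_isCompl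
  let L : S × EH →ₗ[ℂ] EG := S.subtype.coprod (dIncl EG EH H : EH →ₗ[ℂ] EG)
  have hLi : Function.Injective L := by
    rw [← LinearMap.ker_eq_bot, LinearMap.ker_coprod_of_disjoint_range, S.ker_subtype,
      LinearMap.ker_eq_bot.2 (show Function.Injective (dIncl EG EH H : EH →ₗ[ℂ] EG) from
        IsClosedLieSubgroup.injective_mfderiv (1 : H)), Submodule.prod_bot]
    rw [S.range_subtype]
    exact hcompl.disjoint.symm
  have hLs : Function.Surjective L := by
    rw [← LinearMap.range_eq_top, LinearMap.range_coprod, S.range_subtype]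
    exact hcompl.symm.sup_eq_top
  let e : (S × EH) ≃L[ℂ] EG := (LinearEquiv.ofBijective L ⟨hLi, hLs⟩).toContinuousLinearEquiv
  have hloc0 : IsLocalDiffeomorphAt (𝓘(ℂ, S).prod 𝓘(ℂ, EH)) 𝓘(ℂ, EG) ω Fm (0, 1) :=
    isLocalDiffeomorphAt_of_mfderiv hDo hFd (x := ((0 : S), (1 : H))) ⟨h0U₁, mem_univ _⟩ e hder
  obtain ⟨Φ, hΦ0, hΦ⟩ := hloc0
  obtain ⟨U₂, V₂, hU₂o, h0U₂, hV₂o, h1V₂, hUV⟩ : ∃ (U₂ : Set S) (V₂ : Set H), IsOpen U₂ ∧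
      (0 : S) ∈ U₂ ∧ IsOpen V₂ ∧ (1 : H) ∈ V₂ ∧ U₂ ×ˢ V₂ ⊆ Φ.source := by
    obtain ⟨a, b, ha, hb, h0, h1, hab⟩ := isOpen_prod_iff.1 Φ.open_source 0 1 hΦ0
    exact ⟨a, b, ha, h0, hb, h1, hab⟩
  have hinj : ∀ p ∈ U₂ ×ˢ V₂, ∀ q ∈ U₂ ×ˢ V₂, Fm p = Fm q → p = q := by
    intro p hp q hq h
    rw [hΦ (hUV hp), hΦ (hUV hq)] at h
    exact Φ.toPartialEquiv.injOn (hUV hp) (hUV hq) h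
  -- shrink the transversal
  obtain ⟨O, hOo, hOV⟩ := isOpen_induced_iff.1 hV₂o
  have h1O : (1 : G) ∈ O := by
    have : (1 : H) ∈ Subtype.val ⁻¹' O := by rw [hOV]; exact h1V₂
    exact this
  obtain ⟨N, hNo, h1N, hN⟩ : ∃ N : Set G, IsOpen N ∧ (1 : G) ∈ N ∧
      ∀ a ∈ N, ∀ b ∈ N, a⁻¹ * b ∈ O := by
    have hcont : Continuous fun p : G × G => p.1⁻¹ * p.2 := by fun_prop
    obtain ⟨a, b, ha, hb, h0, h1, hab⟩ := isOpen_prod_iff.1 (hOo.preimage hcont) 1 1 (by simpa)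
    exact ⟨a ∩ b, ha.inter hb, ⟨h0, h1⟩, fun x hx y hy => @hab (x, y) ⟨hx.1, hy.2⟩⟩
  set U : Set S := (U₁ ∩ t ⁻¹' N) ∩ U₂ with hU
  have hUo : IsOpen U := (htd.continuousOn.isOpen_inter_preimage hU₁o hNo).inter hU₂o
  have h0U : (0 : S) ∈ U := ⟨⟨h0U₁, by change t 0 ∈ N; rw [ht0]; exact h1N⟩, h0U₂⟩
  have hFinj : InjOn Fm (U ×ˢ univ) := by
    rintro ⟨u, h⟩ hp ⟨u', h'⟩ hq heq
    have h1 : t u * h = t u' * h' := heq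
    have h2 : ((h * h'⁻¹ : H) : G) = (t u)⁻¹ * t u' := by
      rw [eq_inv_mul_iff_mul_eq, Subgroup.coe_mul, ← mul_assoc, h1, Subgroup.coe_inv,
        mul_inv_cancel_right]
    have h3 : h * h'⁻¹ ∈ V₂ := by
      rw [← hOV]
      change ((h * h'⁻¹ : H) : G) ∈ O
      rw [h2]; exact hN _ hp.1.1.2 _ hq.1.1.2
    have h4 := hinj (u, h * h'⁻¹) ⟨hp.1.2, h3⟩ (u', 1) ⟨hq.1.2, h1V₂⟩
      (by change t u * ((h * h'⁻¹ : H) : G) = t u' * ((1 : H) : G)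
          rw [h2]; simp)
    rw [Prod.mk.injEq, mul_inv_eq_one] at h4
    exact Prod.ext h4.1 h4.2
  have hFloc : ∀ p ∈ U ×ˢ (univ : Set H),
      IsLocalDiffeomorphAt (𝓘(ℂ, S).prod 𝓘(ℂ, EH)) 𝓘(ℂ, EG) ω Fm p := by
    rintro ⟨u, h⟩ hp
    have h1 : IsLocalDiffeomorphAt (𝓘(ℂ, S).prod 𝓘(ℂ, EH)) 𝓘(ℂ, EG) ω Fm (u, 1) :=
      ⟨Φ, hUV ⟨hp.1.2, h1V₂⟩, hΦ⟩
    let R : (S × H) ≃ₘ^ω⟮𝓘(ℂ, S).prod 𝓘(ℂ, EH), 𝓘(ℂ, S).prod 𝓘(ℂ, EH)⟯ (S × H) :=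
      { toFun := fun p => (p.1, p.2 * h⁻¹)
        invFun := fun p => (p.1, p.2 * h)
        left_inv := fun p => by simp
        right_inv := fun p => by simp
        contMDiff_toFun := contMDiff_fst.prodMk (contMDiff_snd.mul contMDiff_const)
        contMDiff_invFun := contMDiff_fst.prodMk (contMDiff_snd.mul contMDiff_const) }
    let T : G ≃ₘ^ω⟮𝓘(ℂ, EG), 𝓘(ℂ, EG)⟯ G :=
      { toFun := fun g => g * h
        invFun := fun g => g * (h : G)⁻¹
        left_inv := fun p => by simp
        right_inv := fun p => by simp
        contMDiff_toFun := contMDiff_id.mul contMDiff_const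
        contMDiff_invFun := contMDiff_id.mul contMDiff_const }
    have h2 : Fm = T ∘ (Fm ∘ R) := by
      funext p
      change t p.1 * p.2 = t p.1 * ((p.2 * h⁻¹ : H) : G) * h
      simp [mul_assoc]
    have hR : R (u, h) = (u, 1) := Prod.ext rfl (mul_inv_cancel h)
    rw [h2]
    refine IsLocalDiffeomorphAt.comp _ _ (IsLocalDiffeomorphAt.comp _ _
      (R.isLocalDiffeomorph (u, h)) ?_) (T.isLocalDiffeomorph _)
    rw [hR]; exact h1
  set W : Set G := Fm '' (U ×ˢ univ) with hW
  let inv : G → S × H := Function.invFunOn Fm (U ×ˢ univ)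
  have hinvF : ∀ p ∈ U ×ˢ (univ : Set H), inv (Fm p) = p := fun p hp =>
    hFinj.leftInvOn_invFunOn hp
  have hUVo : IsOpen (U ×ˢ (univ : Set H)) := hUo.prod isOpen_univ
  have hkey : ∀ p ∈ U ×ˢ (univ : Set H), W ∈ 𝓝 (Fm p) ∧
      ContMDiffAt 𝓘(ℂ, EG) (𝓘(ℂ, S).prod 𝓘(ℂ, EH)) ω inv (Fm p) := by
    intro p hp
    obtain ⟨Ψ, hpΨ, hΨ⟩ := hFloc p hp
    have hpt : Fm p ∈ Ψ.target := by rw [hΨ hpΨ]; exact Ψ.map_source' hpΨ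
    have hsm : ContMDiffAt 𝓘(ℂ, EG) (𝓘(ℂ, S).prod 𝓘(ℂ, EH)) ω Ψ.invFun (Fm p) :=
      Ψ.contMDiffOn_invFun.contMDiffAt (Ψ.open_target.mem_nhds hpt)
    have hval' : Ψ.invFun (Fm p) = p := by
      rw [hΨ hpΨ]; exact Ψ.left_inv' hpΨ
    have hev : ∀ᶠ g in 𝓝 (Fm p), g ∈ Ψ.target ∧ Ψ.invFun g ∈ U ×ˢ (univ : Set H) := by
      filter_upwards [Ψ.open_target.mem_nhds hpt, hsm.continuousAt.preimage_mem_nhds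
        (by rw [hval']; exact hUVo.mem_nhds hp)] with g h1 h2 using ⟨h1, h2⟩
    have hFg : ∀ g ∈ Ψ.target, Fm (Ψ.invFun g) = g := fun g hg => by
      rw [hΨ (Ψ.map_target' hg)]; exact Ψ.right_inv' hg
    refine ⟨Filter.mem_of_superset hev fun g hg => ⟨_, hg.2, hFg g hg.1⟩, hsm.congr_of_eventuallyEq ?_⟩
    filter_upwards [hev] with g hg
    rw [← hinvF _ hg.2, hFg g hg.1]
  have hinvW : ContMDiffOn 𝓘(ℂ, EG) (𝓘(ℂ, S).prod 𝓘(ℂ, EH)) ω inv W := by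
    rintro g ⟨p, hp, rfl⟩
    exact (hkey p hp).2.contMDiffWithinAt
  have hone : ∀ u, Fm (u, 1) = t u := fun u => by simp [hFm]
  refine ⟨⟨U, W, t, fun g => (inv g).1, fun g => (inv g).2, hUo, ?_, ?_,
    htd.mono fun u hu => hu.1.1, contMDiff_fst.comp_contMDiffOn hinvW,
    contMDiff_snd.comp_contMDiffOn hinvW, ?_, ?_, ?_⟩⟩
  · rw [isOpen_iff_mem_nhds]
    rintro g ⟨p, hp, rfl⟩
    exact (hkey p hp).1
  · exact ⟨(0, 1), ⟨h0U, mem_univ _⟩, by rw [hone, ht0]⟩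
  · intro u hu
    have h1 := hinvF (u, 1) ⟨hu, mem_univ _⟩
    rw [hone] at h1
    exact ⟨⟨(u, 1), ⟨hu, mem_univ _⟩, hone u⟩, by simp only [h1], by simp only [h1]⟩
  · rintro w ⟨p, hp, rfl⟩
    simp only [hinvF p hp]
    exact ⟨hp.1, rfl⟩
  · rintro w ⟨p, hp, rfl⟩ h
    have h1 : Fm p * h = Fm (p.1, p.2 * h) := by simp [hFm, mul_assoc]
    have h2 : (p.1, p.2 * h) ∈ U ×ˢ (univ : Set H) := ⟨hp.1, mem_univ _⟩
    rw [h1]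
    simp only [hinvF p hp, hinvF _ h2]
    exact ⟨⟨_, h2, rfl⟩, trivial, trivial⟩

/-- A chosen slice. -/
def slice : SliceData EG EH H := Classical.choice (nonempty_sliceData EG EH H)

end Slice

section Homog
variable {G : Type*} (EG EH : Type*)
  [NormedAddCommGroup EG] [NormedSpace ℂ EG] [FiniteDimensional ℂ EG]
  [NormedAddCommGroup EH] [NormedSpace ℂ EH] [FiniteDimensional ℂ EH]
  [TopologicalSpace G] [ChartedSpace EG G] [Group G] [LieGroup 𝓘(ℂ, EG) ω G]
  (H : Subgroup G) [ChartedSpace EH H] [LieGroup 𝓘(ℂ, EH) ω H] [IsClosedLieSubgroup EG EH H]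


/-- The slice coordinate of a coset `x` near `g H`. -/
def cosetCoord (g : G) (x : G ⧸ H) : (sliceModel EG EH H) := (slice EG EH H).σ (g⁻¹ * Quotient.out x)

/-- The open set of cosets that meet `g W`. -/
def cosetSource (g : G) : Set (G ⧸ H) := (QuotientGroup.mk : G → G ⧸ H) '' {y | g⁻¹ * y ∈ (slice EG EH H).W}

theorem mem_cosetSource (g y : G) :
    (y : G ⧸ H) ∈ cosetSource EG EH H g ↔ g⁻¹ * y ∈ (slice EG EH H).W := by
  constructor
  · rintro ⟨z, hz, hzy⟩
    have h1 : z⁻¹ * y ∈ H := QuotientGroup.eq.1 hzy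
    have h2 := ((slice EG EH H).mul_spec _ hz ⟨_, h1⟩).1
    simpa [mul_assoc] using h2
  · exact fun h => ⟨y, h, rfl⟩

theorem cosetCoord_mk (g y : G) (hy : g⁻¹ * y ∈ (slice EG EH H).W) :
    cosetCoord EG EH H g (y : G ⧸ H) = (slice EG EH H).σ (g⁻¹ * y) := by
  obtain ⟨h, hh⟩ := QuotientGroup.mk_out_eq_mul H y
  rw [cosetCoord, show Quotient.out (y : G ⧸ H) = y * h from hh, ← mul_assoc]
  exact ((slice EG EH H).mul_spec _ hy h).2.1

/-- The chart of `G ⧸ H` around `g H` given by the translated slice `u ↦ g * s u`. -/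
def cosetChart (g : G) : OpenPartialHomeomorph (G ⧸ H) (sliceModel EG EH H) where
  toFun := cosetCoord EG EH H g
  invFun u := ((g * (slice EG EH H).s u : G) : G ⧸ H)
  source := cosetSource EG EH H g
  target := (slice EG EH H).U
  map_source' := by
    rintro _ ⟨y, hy, rfl⟩
    rw [cosetCoord_mk EG EH H g y hy]
    exact ((slice EG EH H).σ_spec _ hy).1
  map_target' u hu := by
    rw [mem_cosetSource, inv_mul_cancel_left]
    exact ((slice EG EH H).s_spec u hu).1
  left_inv' := by
    rintro _ ⟨y, hy, rfl⟩
    rw [cosetCoord_mk EG EH H g y hy, QuotientGroup.eq]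
    have h1 := ((slice EG EH H).σ_spec _ hy).2
    have h2 : (g * (slice EG EH H).s ((slice EG EH H).σ (g⁻¹ * y)))⁻¹ * y = (slice EG EH H).η (g⁻¹ * y) := by
      rw [inv_mul_eq_iff_eq_mul, mul_assoc, h1, mul_inv_cancel_left]
    rw [h2]; exact Subtype.property _
  right_inv' u hu := by
    have h1 := (slice EG EH H).s_spec u hu
    rw [cosetCoord_mk _ _ _ _ _ (by rw [inv_mul_cancel_left]; exact h1.1), inv_mul_cancel_left]
    exact h1.2.1
  open_source := by
    have : IsTopologicalGroup G := topologicalGroup_of_lieGroup 𝓘(ℂ, EG) ω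
    exact QuotientGroup.isOpenMap_coe _ ((slice EG EH H).isOpen_W.preimage (continuous_const_mul g⁻¹))
  open_target := (slice EG EH H).isOpen_U
  continuousOn_toFun := by
    have : IsTopologicalGroup G := topologicalGroup_of_lieGroup 𝓘(ℂ, EG) ω
    rintro _ ⟨y, hy, rfl⟩
    refine ContinuousAt.continuousWithinAt ?_
    rw [← QuotientGroup.isOpenQuotientMap_mk.continuousAt_comp_iff]
    have h1 : ContinuousAt (fun z => (slice EG EH H).σ (g⁻¹ * z)) y :=
      ContinuousAt.comp (f := fun z => g⁻¹ * z) (((slice EG EH H).contMDiffOn_σ.continuousOn.continuousAt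
        ((slice EG EH H).isOpen_W.mem_nhds hy))) (continuous_const_mul g⁻¹).continuousAt
    refine h1.congr ?_
    filter_upwards [((slice EG EH H).isOpen_W.preimage (continuous_const_mul g⁻¹)).mem_nhds hy] with z hz
    exact (cosetCoord_mk EG EH H g z hz).symm
  continuousOn_invFun := by
    have : IsTopologicalGroup G := topologicalGroup_of_lieGroup 𝓘(ℂ, EG) ω
    exact QuotientGroup.continuous_mk.comp_continuousOn
      (continuousOn_const.mul (slice EG EH H).contMDiffOn_s.continuousOn)

/-- The complex structure of the homogeneous space `G ⧸ H`. -/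
instance cosetChartedSpace : ChartedSpace (sliceModel EG EH H) (G ⧸ H) where
  atlas := range (cosetChart EG EH H)
  chartAt x := cosetChart EG EH H (Quotient.out x)
  mem_chart_source x := by
    have h : ((Quotient.out x : G) : G ⧸ H) ∈ cosetSource EG EH H (Quotient.out x) := by
      rw [mem_cosetSource, inv_mul_cancel]; exact (slice EG EH H).one_mem
    rwa [QuotientGroup.out_eq'] at h
  chart_mem_atlas x := mem_range_self _

instance coset_isManifold : IsManifold 𝓘(ℂ, (sliceModel EG EH H)) ω (G ⧸ H) := by
  refine isManifold_of_contDiffOn _ _ _ ?_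
  rintro _ _ ⟨g, rfl⟩ ⟨g', rfl⟩
  simp only [modelWithCornersSelf_coe, modelWithCornersSelf_coe_symm, Function.comp_id,
    Function.id_comp, preimage_id, range_id, inter_univ]
  have h0 : ∀ u ∈ ((cosetChart EG EH H g).symm ≫ₕ cosetChart EG EH H g').source,
      u ∈ (slice EG EH H).U ∧ g'⁻¹ * (g * (slice EG EH H).s u) ∈ (slice EG EH H).W := by
    intro u hu
    rw [OpenPartialHomeomorph.trans_source] at hu
    exact ⟨hu.1, (mem_cosetSource EG EH H _ _).1 hu.2⟩
  rw [← contMDiffOn_iff_contDiffOn]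
  have h1 : ContMDiffOn 𝓘(ℂ, (sliceModel EG EH H)) 𝓘(ℂ, (sliceModel EG EH H)) ω (fun u => (slice EG EH H).σ (g'⁻¹ * (g * (slice EG EH H).s u)))
      ((cosetChart EG EH H g).symm ≫ₕ cosetChart EG EH H g').source := by
    refine (slice EG EH H).contMDiffOn_σ.comp (contMDiffOn_const.mul (contMDiffOn_const.mul
      ((slice EG EH H).contMDiffOn_s.mono fun u hu => (h0 u hu).1))) fun u hu => (h0 u hu).2
  refine h1.congr fun u hu => ?_
  exact cosetCoord_mk EG EH H g' _ (h0 u hu).2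

theorem contMDiff_cosetMk :
    ContMDiff 𝓘(ℂ, EG) 𝓘(ℂ, (sliceModel EG EH H)) ω (QuotientGroup.mk : G → G ⧸ H) := by
  have : IsTopologicalGroup G := topologicalGroup_of_lieGroup 𝓘(ℂ, EG) ω
  intro g
  have hO : IsOpen {y | g⁻¹ * y ∈ (slice EG EH H).W} := (slice EG EH H).isOpen_W.preimage (continuous_const_mul g⁻¹)
  have hg : g ∈ {y | g⁻¹ * y ∈ (slice EG EH H).W} := by
    change g⁻¹ * g ∈ (slice EG EH H).W
    rw [inv_mul_cancel]; exact (slice EG EH H).one_mem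
  refine ContMDiffOn.contMDiffAt (s := {y | g⁻¹ * y ∈ (slice EG EH H).W}) ?_ (hO.mem_nhds hg)
  have h1 : ContMDiffOn 𝓘(ℂ, (sliceModel EG EH H)) 𝓘(ℂ, (sliceModel EG EH H)) ω (cosetChart EG EH H g).symm (slice EG EH H).U :=
    contMDiffOn_symm_of_mem_maximalAtlas
      (IsManifold.subset_maximalAtlas (mem_range_self g))
  have h2 : ContMDiffOn 𝓘(ℂ, EG) 𝓘(ℂ, (sliceModel EG EH H)) ω (fun y => (slice EG EH H).σ (g⁻¹ * y)) {y | g⁻¹ * y ∈ (slice EG EH H).W} :=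
    (slice EG EH H).contMDiffOn_σ.comp (contMDiff_const.mul contMDiff_id).contMDiffOn fun y hy => hy
  refine (h1.comp h2 fun y hy => ((slice EG EH H).σ_spec _ hy).1).congr fun y hy => ?_
  have h3 := (cosetChart EG EH H g).left_inv ((mem_cosetSource EG EH H g y).2 hy)
  refine h3.symm.trans ?_
  exact congrArg _ (cosetCoord_mk EG EH H g y hy)

end Homog

section Principal

/-- A holomorphic local trivialization of `proj : Q → X` over the open set `base`, given by a
section `sec` and the map `coord` with `q = sec (proj q) * coord q`. -/
structure LocalTriv (EQ EX EM : Type*) {Q X M : Type*}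
    [NormedAddCommGroup EQ] [NormedSpace ℂ EQ] [NormedAddCommGroup EX] [NormedSpace ℂ EX]
    [NormedAddCommGroup EM] [NormedSpace ℂ EM]
    [TopologicalSpace Q] [ChartedSpace EQ Q] [TopologicalSpace X] [ChartedSpace EX X]
    [TopologicalSpace M] [ChartedSpace EM M] [Group M] (proj : Q → X) (act : Q → M → Q) where
  base : Set X
  sec : X → Q
  coord : Q → M
  isOpen_base : IsOpen base
  contMDiffOn_sec : ContMDiffOn 𝓘(ℂ, EX) 𝓘(ℂ, EQ) ω sec base
  contMDiffOn_coord : ContMDiffOn 𝓘(ℂ, EQ) 𝓘(ℂ, EM) ω coord (proj ⁻¹' base)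
  proj_sec : ∀ x ∈ base, proj (sec x) = x
  coord_sec : ∀ x ∈ base, coord (sec x) = 1
  coord_act : ∀ q m, proj q ∈ base → coord (act q m) = coord q * m
  act_coord : ∀ q, proj q ∈ base → act (sec (proj q)) (coord q) = q

/-- A holomorphic principal `M`-bundle over `X`, with `M` acting on the right. The existence of
local trivializations makes the action free and transitive on the fibres. -/
structure PrincipalBundle (EQ EX EM Q X M : Type*)
    [NormedAddCommGroup EQ] [NormedSpace ℂ EQ] [NormedAddCommGroup EX] [NormedSpace ℂ EX]
    [NormedAddCommGroup EM] [NormedSpace ℂ EM]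
    [TopologicalSpace Q] [ChartedSpace EQ Q] [TopologicalSpace X] [ChartedSpace EX X]
    [TopologicalSpace M] [ChartedSpace EM M] [Group M] where
  proj : Q → X
  act : Q → M → Q
  act_one : ∀ q, act q 1 = q
  act_mul : ∀ q m m', act q (m * m') = act (act q m) m'
  proj_act : ∀ q m, proj (act q m) = proj q
  contMDiff_proj : ContMDiff 𝓘(ℂ, EQ) 𝓘(ℂ, EX) ω proj
  contMDiff_act : ContMDiff (𝓘(ℂ, EQ).prod 𝓘(ℂ, EM)) 𝓘(ℂ, EQ) ω fun p : Q × M => act p.1 p.2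
  exists_localTriv : ∀ x, ∃ t : LocalTriv EQ EX EM proj act, x ∈ t.base

end Principal

section HomogBundle
variable {G : Type*} (EG EH : Type*)
  [NormedAddCommGroup EG] [NormedSpace ℂ EG] [FiniteDimensional ℂ EG]
  [NormedAddCommGroup EH] [NormedSpace ℂ EH] [FiniteDimensional ℂ EH]
  [TopologicalSpace G] [ChartedSpace EG G] [Group G] [LieGroup 𝓘(ℂ, EG) ω G]
  (H : Subgroup G) [ChartedSpace EH H] [LieGroup 𝓘(ℂ, EH) ω H] [IsClosedLieSubgroup EG EH H]


/-- The principal `H`-bundle `G_H`, i.e. `G → G ⧸ H` with `H` acting by right multiplication. -/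
def homogBundle : PrincipalBundle EG (sliceModel EG EH H) EH G (G ⧸ H) H where
  proj := QuotientGroup.mk
  act g h := g * h
  act_one g := by simp
  act_mul g h h' := by simp [mul_assoc]
  proj_act g h := by simp
  contMDiff_proj := contMDiff_cosetMk EG EH H
  contMDiff_act := contMDiff_fst.mul
    ((IsClosedLieSubgroup.contMDiff_val (EG := EG) (EH := EH) (H := H)).comp contMDiff_snd)
  exists_localTriv x := by
    let g : G := Quotient.out x
    have hm : ∀ y : G, (y : G ⧸ H) ∈ cosetSource EG EH H g ↔ g⁻¹ * y ∈ (slice EG EH H).W :=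
      mem_cosetSource EG EH H g
    refine ⟨{
      base := (cosetChart EG EH H g).source
      sec := fun x => g * (slice EG EH H).s (cosetCoord EG EH H g x)
      coord := fun y => (slice EG EH H).η (g⁻¹ * y)
      isOpen_base := (cosetChart EG EH H g).open_source
      contMDiffOn_sec := ?_
      contMDiffOn_coord := ?_
      proj_sec := fun x hx => (cosetChart EG EH H g).left_inv hx
      coord_sec := ?_
      coord_act := ?_
      act_coord := ?_ }, ?_⟩
    · have h1 : ContMDiffOn 𝓘(ℂ, (sliceModel EG EH H)) 𝓘(ℂ, (sliceModel EG EH H)) ω (cosetChart EG EH H g)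
          (cosetChart EG EH H g).source :=
        contMDiffOn_of_mem_maximalAtlas (IsManifold.subset_maximalAtlas (mem_range_self g))
      exact contMDiffOn_const.mul ((slice EG EH H).contMDiffOn_s.comp h1
        fun x hx => (cosetChart EG EH H g).map_source hx)
    · exact (slice EG EH H).contMDiffOn_η.comp (contMDiff_const.mul contMDiff_id).contMDiffOn
        fun y hy => (hm y).1 hy
    · intro x hx
      rw [inv_mul_cancel_left]
      exact ((slice EG EH H).s_spec _ ((cosetChart EG EH H g).map_source hx)).2.2
    · intro y h hy
      rw [← mul_assoc]
      exact ((slice EG EH H).mul_spec _ ((hm y).1 hy) h).2.2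
    · intro y hy
      have hy' := (hm y).1 hy
      rw [cosetCoord_mk EG EH H g y hy', mul_assoc, ((slice EG EH H).σ_spec _ hy').2, mul_inv_cancel_left]
    · exact mem_chart_source (sliceModel EG EH H) x

end HomogBundle

section Assoc
variable {EQ EX EH EF Q X H F : Type*}
  [NormedAddCommGroup EQ] [NormedSpace ℂ EQ] [NormedAddCommGroup EX] [NormedSpace ℂ EX]
  [NormedAddCommGroup EH] [NormedSpace ℂ EH] [NormedAddCommGroup EF] [NormedSpace ℂ EF]
  [TopologicalSpace Q] [ChartedSpace EQ Q] [TopologicalSpace X] [ChartedSpace EX X]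
  [TopologicalSpace H] [ChartedSpace EH H] [Group H]
  [TopologicalSpace F] [ChartedSpace EF F]

/-- A left action of a complex Lie group on a complex manifold is holomorphic. -/
class HolAction (EH EF : Type*) {H F : Type*}
    [NormedAddCommGroup EH] [NormedSpace ℂ EH] [NormedAddCommGroup EF] [NormedSpace ℂ EF]
    [TopologicalSpace H] [ChartedSpace EH H] [Group H] [TopologicalSpace F] [ChartedSpace EF F]
    (ρ : H →* Equiv.Perm F) : Prop where
  contMDiff : ContMDiff (𝓘(ℂ, EH).prod 𝓘(ℂ, EF)) 𝓘(ℂ, EF) ω fun p : H × F => ρ p.1 p.2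

variable (B : PrincipalBundle EQ EX EH Q X H) (ρ : H →* Equiv.Perm F)

/-- `(q, f) ∼ (q h, h⁻¹ f)`. -/
def assocSetoid : Setoid (Q × F) where
  r p p' := ∃ h : H, p' = (B.act p.1 h, ρ h⁻¹ p.2)
  iseqv :=
    { refl := fun p => ⟨1, by simp [B.act_one]⟩
      symm := by
        rintro p _ ⟨h, rfl⟩
        refine ⟨h⁻¹, ?_⟩
        simp [← B.act_mul, B.act_one]
      trans := by
        rintro p _ _ ⟨h, rfl⟩ ⟨h', rfl⟩
        refine ⟨h * h', ?_⟩
        simp [B.act_mul] }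

/-- The associated bundle `Q ×^H F`. -/
def Assoc : Type _ := Quotient (assocSetoid B ρ)

instance : TopologicalSpace (Assoc B ρ) :=
  inferInstanceAs (TopologicalSpace (Quotient (assocSetoid B ρ)))

namespace Assoc

/-- The class `[q, f]`. -/
def mk (q : Q) (f : F) : Assoc B ρ := Quotient.mk (assocSetoid B ρ) (q, f)

theorem mk_surjective (z : Assoc B ρ) : ∃ q f, mk B ρ q f = z := by
  induction z using Quotient.inductionOn with
  | h p => exact ⟨p.1, p.2, rfl⟩

theorem mk_eq_mk (q q' : Q) (f f' : F) :
    mk B ρ q f = mk B ρ q' f' ↔ ∃ h : H, q' = B.act q h ∧ f' = ρ h⁻¹ f := by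
  refine Quotient.eq.trans ?_
  change (∃ h : H, (q', f') = (B.act q h, ρ h⁻¹ f)) ↔ _
  simp only [Prod.mk.injEq]

theorem mk_act (q : Q) (h : H) (f : F) : mk B ρ (B.act q h) f = mk B ρ q (ρ h f) :=
  ((mk_eq_mk B ρ _ _ _ _).2 ⟨h, rfl, by simp⟩).symm

/-- The bundle projection `[q, f] ↦ π(q)`. -/
def proj : Assoc B ρ → X :=
  Quotient.lift (fun p => B.proj p.1) (by
    rintro p _ ⟨h, rfl⟩
    exact (B.proj_act _ _).symm)

@[simp] theorem proj_mk (q : Q) (f : F) : proj B ρ (mk B ρ q f) = B.proj q := rfl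

/-- The fibre coordinate in a local trivialization of the principal bundle,
`[q, f] ↦ coord(q) • f`. -/
def fibreCoord (t : LocalTriv EQ EX EH B.proj B.act) (z : Assoc B ρ) : F :=
  ρ (t.coord (Quotient.out z).1) (Quotient.out z).2

theorem fibreCoord_mk (t : LocalTriv EQ EX EH B.proj B.act) (q : Q) (f : F)
    (hq : B.proj q ∈ t.base) : fibreCoord B ρ t (mk B ρ q f) = ρ (t.coord q) f := by
  have h0 : mk B ρ q f = mk B ρ (Quotient.out (mk B ρ q f)).1 (Quotient.out (mk B ρ q f)).2 :=
    (Quotient.out_eq (mk B ρ q f)).symm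
  obtain ⟨h, h1, h2⟩ := (mk_eq_mk B ρ _ _ _ _).1 h0
  rw [fibreCoord, h1, h2, t.coord_act q h hq]
  simp

theorem mk_sec (t : LocalTriv EQ EX EH B.proj B.act) (q : Q) (f : F)
    (hq : B.proj q ∈ t.base) : mk B ρ (t.sec (B.proj q)) (ρ (t.coord q) f) = mk B ρ q f := by
  rw [← mk_act, t.act_coord q hq]

theorem isOpenQuotientMap_mk [HolAction EH EF ρ] : IsOpenQuotientMap fun p : Q × F => mk B ρ p.1 p.2 where
  surjective z := by
    obtain ⟨q, f, h⟩ := mk_surjective B ρ z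
    exact ⟨(q, f), h⟩
  continuous := continuous_quotient_mk'
  isOpenMap := by
    intro O hO
    have h1 : ∀ h : H, Continuous fun p : Q × F => (B.act p.1 h, ρ h⁻¹ p.2) := by
      intro h
      have ha : Continuous fun p : Q × H => B.act p.1 p.2 := B.contMDiff_act.continuous
      have hb : Continuous fun p : H × F => ρ p.1 p.2 :=
        (HolAction.contMDiff (EH := EH) (EF := EF) (ρ := ρ)).continuous
      exact (ha.comp (continuous_fst.prodMk continuous_const)).prodMk
        (hb.comp (continuous_const.prodMk continuous_snd))
    have h2 : (fun p : Q × F => mk B ρ p.1 p.2) ⁻¹' ((fun p : Q × F => mk B ρ p.1 p.2) '' O) =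
        ⋃ h : H, (fun p : Q × F => (B.act p.1 h, ρ h⁻¹ p.2)) ⁻¹' O := by
      ext p
      simp only [mem_preimage, mem_image, mem_iUnion]
      constructor
      · rintro ⟨p', hp', he⟩
        obtain ⟨h, h3, h4⟩ := (mk_eq_mk B ρ _ _ _ _).1 he.symm
        exact ⟨h, by rw [← h3, ← h4]; exact hp'⟩
      · rintro ⟨h, hh⟩
        exact ⟨_, hh, ((mk_eq_mk B ρ _ _ _ _).2 ⟨h, rfl, rfl⟩).symm⟩
    refine isOpen_coinduced.2 ?_
    refine h2 ▸ isOpen_iUnion fun h => hO.preimage (h1 h)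

variable [HolAction EH EF ρ]

/-- The local trivialization of `Q ×^H F` induced by one of `Q`. -/
def triv (t : LocalTriv EQ EX EH B.proj B.act) : OpenPartialHomeomorph (Assoc B ρ) (X × F) where
  toFun z := (proj B ρ z, fibreCoord B ρ t z)
  invFun p := mk B ρ (t.sec p.1) p.2
  source := proj B ρ ⁻¹' t.base
  target := t.base ×ˢ univ
  map_source' z hz := ⟨hz, mem_univ _⟩
  map_target' p hp := by
    change B.proj (t.sec p.1) ∈ t.base
    rw [t.proj_sec _ hp.1]; exact hp.1
  left_inv' z hz := by
    obtain ⟨q, f, rfl⟩ := mk_surjective B ρ z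
    simp only [proj_mk, fibreCoord_mk B ρ t q f hz]
    exact mk_sec B ρ t q f hz
  right_inv' p hp := by
    have h1 := t.proj_sec _ hp.1
    simp only [proj_mk, h1]
    rw [fibreCoord_mk B ρ t _ _ (by rw [h1]; exact hp.1), t.coord_sec _ hp.1]
    simp
  open_source := by
    rw [← (isOpenQuotientMap_mk (EF := EF) B ρ).isQuotientMap.isOpen_preimage]
    exact (t.isOpen_base.preimage B.contMDiff_proj.continuous).preimage continuous_fst
  open_target := t.isOpen_base.prod isOpen_univ
  continuousOn_toFun := by
    intro z hz
    obtain ⟨q, f, rfl⟩ := mk_surjective B ρ z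
    refine ContinuousAt.continuousWithinAt ?_
    refine (isOpenQuotientMap_mk (EF := EF) B ρ).continuousAt_comp_iff (x := (q, f)).1 ?_
    have ho : IsOpen (B.proj ⁻¹' t.base) := t.isOpen_base.preimage B.contMDiff_proj.continuous
    have h1 : ContinuousAt (fun p : Q × F => (B.proj p.1, ρ (t.coord p.1) p.2)) (q, f) := by
      have hb : Continuous fun p : H × F => ρ p.1 p.2 :=
        (HolAction.contMDiff (EH := EH) (EF := EF) (ρ := ρ)).continuous
      have hc : ContinuousAt t.coord q := t.contMDiffOn_coord.continuousOn.continuousAt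
        (ho.mem_nhds hz)
      exact ((B.contMDiff_proj.continuous.comp continuous_fst).continuousAt).prodMk
        (hb.continuousAt.comp (f := fun p : Q × F => (t.coord p.1, p.2))
          ((hc.comp (f := Prod.fst) continuous_fst.continuousAt).prodMk
          continuous_snd.continuousAt))
    refine h1.congr ?_
    filter_upwards [(ho.preimage continuous_fst).mem_nhds
      (show (q, f) ∈ Prod.fst ⁻¹' (B.proj ⁻¹' t.base) from hz)] with p hp
    exact Prod.ext rfl (fibreCoord_mk B ρ t p.1 p.2 hp).symm
  continuousOn_invFun := by
    refine (isOpenQuotientMap_mk (EF := EF) B ρ).continuous.comp_continuousOn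
      (f := fun p : X × F => (t.sec p.1, p.2)) ?_
    exact (t.contMDiffOn_sec.continuousOn.comp continuous_fst.continuousOn
      fun p hp => hp.1).prodMk continuous_snd.continuousOn

theorem triv_symm_trans (t t' : LocalTriv EQ EX EH B.proj B.act) :
    ContMDiffOn (𝓘(ℂ, EX).prod 𝓘(ℂ, EF)) (𝓘(ℂ, EX).prod 𝓘(ℂ, EF)) ω
      (triv (EF := EF) B ρ t' ∘ (triv (EF := EF) B ρ t).symm) ((t.base ∩ t'.base) ×ˢ univ) := by
  have h1 : ContMDiffOn (𝓘(ℂ, EX).prod 𝓘(ℂ, EF)) (𝓘(ℂ, EX).prod 𝓘(ℂ, EF)) ω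
      (fun p : X × F => (p.1, ρ (t'.coord (t.sec p.1)) p.2)) ((t.base ∩ t'.base) ×ˢ univ) := by
    refine contMDiffOn_fst.prodMk ?_
    refine (HolAction.contMDiff (EH := EH) (EF := EF) (ρ := ρ)).comp_contMDiffOn
      (f := fun p : X × F => (t'.coord (t.sec p.1), p.2)) ?_
    refine ContMDiffOn.prodMk ?_ contMDiffOn_snd
    refine t'.contMDiffOn_coord.comp (t.contMDiffOn_sec.comp contMDiffOn_fst
      fun p hp => hp.1.1) ?_
    intro p hp
    change B.proj (t.sec p.1) ∈ t'.base
    rw [t.proj_sec _ hp.1.1]; exact hp.1.2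
  refine h1.congr ?_
  rintro p ⟨hp, -⟩
  have h2 := t.proj_sec _ hp.1
  exact Prod.ext h2 (fibreCoord_mk B ρ t' _ _ (by rw [h2]; exact hp.2))

/-- A local trivialization of the principal bundle around `x`. -/
def trivAt (x : X) : LocalTriv EQ EX EH B.proj B.act := Classical.choose (B.exists_localTriv x)

theorem mem_trivAt (x : X) : x ∈ (trivAt B x).base := Classical.choose_spec (B.exists_localTriv x)

/-- The complex structure of `Q ×^H F`: charts are the local trivializations followed by charts
of the base and of the fibre. -/
instance chartedSpace : ChartedSpace (EX × EF) (Assoc B ρ) where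
  atlas := {e | ∃ (t : LocalTriv EQ EX EH B.proj B.act) (p : X × F),
    e = (triv (EF := EF) B ρ t).trans ((chartAt EX p.1).prod (chartAt EF p.2))}
  chartAt z := (triv (EF := EF) B ρ (trivAt B (proj B ρ z))).trans
    ((chartAt EX (proj B ρ z)).prod (chartAt EF (fibreCoord B ρ (trivAt B (proj B ρ z)) z)))
  mem_chart_source z := by
    rw [OpenPartialHomeomorph.trans_source]
    exact ⟨mem_trivAt B _, mem_chart_source _ _, mem_chart_source _ _⟩
  chart_mem_atlas z := ⟨_, (_, _), rfl⟩

variable [IsManifold 𝓘(ℂ, EX) ω X] [IsManifold 𝓘(ℂ, EF) ω F]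

theorem contMDiffOn_prodChart (p : X × F) :
    ContMDiffOn (𝓘(ℂ, EX).prod 𝓘(ℂ, EF)) 𝓘(ℂ, EX × EF) ω
      ((chartAt EX p.1).prod (chartAt EF p.2)) ((chartAt EX p.1).prod (chartAt EF p.2)).source := by
  rw [modelWithCornersSelf_prod, ← chartedSpaceSelf_prod]
  exact (contMDiffOn_chart.comp contMDiffOn_fst fun q hq => hq.1).prodMk
    (contMDiffOn_chart.comp contMDiffOn_snd fun q hq => hq.2)

theorem contMDiffOn_prodChart_symm (p : X × F) :
    ContMDiffOn 𝓘(ℂ, EX × EF) (𝓘(ℂ, EX).prod 𝓘(ℂ, EF)) ω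
      ((chartAt EX p.1).prod (chartAt EF p.2)).symm
      ((chartAt EX p.1).prod (chartAt EF p.2)).target := by
  rw [modelWithCornersSelf_prod, ← chartedSpaceSelf_prod]
  exact (contMDiffOn_chart_symm.comp contMDiffOn_fst fun q hq => hq.1).prodMk
    (contMDiffOn_chart_symm.comp contMDiffOn_snd fun q hq => hq.2)

instance isManifold : IsManifold 𝓘(ℂ, EX × EF) ω (Assoc B ρ) := by
  refine isManifold_of_contDiffOn _ _ _ ?_
  rintro _ _ ⟨t, p, rfl⟩ ⟨t', p', rfl⟩
  simp only [modelWithCornersSelf_coe, modelWithCornersSelf_coe_symm, Function.comp_id,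
    Function.id_comp, preimage_id, range_id, inter_univ]
  rw [← contMDiffOn_iff_contDiffOn]
  set c := (chartAt EX p.1).prod (chartAt EF p.2)
  set c' := (chartAt EX p'.1).prod (chartAt EF p'.2)
  have hs : ∀ u ∈ (((triv (EF := EF) B ρ t).trans c).symm ≫ₕ
      ((triv (EF := EF) B ρ t').trans c')).source, u ∈ c.target ∧
      c.symm u ∈ (t.base ∩ t'.base) ×ˢ (univ : Set F) ∧
      triv (EF := EF) B ρ t' ((triv (EF := EF) B ρ t).symm (c.symm u)) ∈ c'.source := by
    intro u hu
    simp only [OpenPartialHomeomorph.trans_source, OpenPartialHomeomorph.symm_source,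
      OpenPartialHomeomorph.trans_target, mem_inter_iff, mem_preimage] at hu
    obtain ⟨⟨h1, h2⟩, h3, h4⟩ := hu
    refine ⟨h1, ⟨⟨h2.1, ?_⟩, mem_univ _⟩, h4⟩
    have h5 : B.proj (t.sec (c.symm u).1) ∈ t'.base := h3
    rwa [t.proj_sec _ h2.1] at h5
  exact (contMDiffOn_prodChart p').comp ((triv_symm_trans B ρ t t').comp
    ((contMDiffOn_prodChart_symm p).mono fun u hu => (hs u hu).1) fun u hu => (hs u hu).2.1)
    fun u hu => (hs u hu).2.2

theorem contMDiffOn_triv (t : LocalTriv EQ EX EH B.proj B.act) :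
    ContMDiffOn 𝓘(ℂ, EX × EF) (𝓘(ℂ, EX).prod 𝓘(ℂ, EF)) ω (triv (EF := EF) B ρ t)
      (proj B ρ ⁻¹' t.base) := by
  intro z hz
  set t' := trivAt B (proj B ρ z)
  set p : X × F := (proj B ρ z, fibreCoord B ρ t' z)
  set c := (chartAt EX p.1).prod (chartAt EF p.2)
  set e := (triv (EF := EF) B ρ t').trans c
  have he : e ∈ atlas (EX × EF) (Assoc B ρ) := ⟨t', p, rfl⟩
  have hze : z ∈ e.source := mem_chart_source (EX × EF) z
  have h1 : ContMDiffOn 𝓘(ℂ, EX × EF) 𝓘(ℂ, EX × EF) ω e e.source :=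
    contMDiffOn_of_mem_maximalAtlas (IsManifold.subset_maximalAtlas he)
  have hes : ∀ w ∈ e.source, w ∈ proj B ρ ⁻¹' t'.base ∧ c (triv (EF := EF) B ρ t' w) ∈ c.target ∧
      c.symm (c (triv (EF := EF) B ρ t' w)) = triv (EF := EF) B ρ t' w := by
    intro w hw
    rw [OpenPartialHomeomorph.trans_source] at hw
    exact ⟨hw.1, c.map_source hw.2, c.left_inv hw.2⟩
  have h2 : ContMDiffOn 𝓘(ℂ, EX × EF) (𝓘(ℂ, EX).prod 𝓘(ℂ, EF)) ω
      ((triv (EF := EF) B ρ t ∘ (triv (EF := EF) B ρ t').symm) ∘ c.symm ∘ e)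
      (e.source ∩ proj B ρ ⁻¹' t.base) := by
    refine (triv_symm_trans B ρ t' t).comp ((contMDiffOn_prodChart_symm p).comp
      (h1.mono inter_subset_left) fun w hw => (hes w hw.1).2.1) ?_
    intro w hw
    change c.symm (c (triv (EF := EF) B ρ t' w)) ∈ (t'.base ∩ t.base) ×ˢ (univ : Set F)
    rw [(hes w hw.1).2.2]
    exact ⟨⟨(hes w hw.1).1, hw.2⟩, mem_univ _⟩
  have ho : IsOpen (e.source ∩ proj B ρ ⁻¹' t.base) :=
    e.open_source.inter (triv (EF := EF) B ρ t).open_source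
  refine ContMDiffAt.contMDiffWithinAt ((h2.congr ?_).contMDiffAt (ho.mem_nhds ⟨hze, hz⟩))
  intro w hw
  change _ = triv (EF := EF) B ρ t ((triv (EF := EF) B ρ t').symm
    (c.symm (c (triv (EF := EF) B ρ t' w))))
  rw [(hes w hw.1).2.2, (triv (EF := EF) B ρ t').left_inv (hes w hw.1).1]

theorem contMDiffOn_triv_symm (t : LocalTriv EQ EX EH B.proj B.act) :
    ContMDiffOn (𝓘(ℂ, EX).prod 𝓘(ℂ, EF)) 𝓘(ℂ, EX × EF) ω (triv (EF := EF) B ρ t).symm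
      (t.base ×ˢ univ) := by
  intro q hq
  set c := (chartAt EX q.1).prod (chartAt EF q.2)
  set e := (triv (EF := EF) B ρ t).trans c
  have he : e ∈ atlas (EX × EF) (Assoc B ρ) := ⟨t, q, rfl⟩
  have h1 : ContMDiffOn 𝓘(ℂ, EX × EF) 𝓘(ℂ, EX × EF) ω e.symm e.target :=
    contMDiffOn_symm_of_mem_maximalAtlas (IsManifold.subset_maximalAtlas he)
  have ho : IsOpen (c.source ∩ t.base ×ˢ univ) :=
    c.open_source.inter (triv (EF := EF) B ρ t).open_target
  have hqc : q ∈ c.source := ⟨mem_chart_source _ _, mem_chart_source _ _⟩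
  have h2 : ContMDiffOn (𝓘(ℂ, EX).prod 𝓘(ℂ, EF)) 𝓘(ℂ, EX × EF) ω (e.symm ∘ c)
      (c.source ∩ t.base ×ˢ univ) := by
    refine h1.comp ((contMDiffOn_prodChart q).mono inter_subset_left) fun w hw => ?_
    change c w ∈ e.target
    rw [OpenPartialHomeomorph.trans_target]
    refine ⟨c.map_source hw.1, ?_⟩
    change c.symm (c w) ∈ t.base ×ˢ (univ : Set F)
    rw [c.left_inv hw.1]; exact hw.2
  refine ContMDiffAt.contMDiffWithinAt ((h2.congr ?_).contMDiffAt (ho.mem_nhds ⟨hqc, hq⟩))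
  intro w hw
  change _ = (triv (EF := EF) B ρ t).symm (c.symm (c w))
  rw [c.left_inv hw.1]

theorem contMDiff_proj : ContMDiff 𝓘(ℂ, EX × EF) 𝓘(ℂ, EX) ω (proj B ρ) := by
  intro z
  exact (contMDiff_fst.comp_contMDiffOn (contMDiffOn_triv (EF := EF) B ρ
    (trivAt B (proj B ρ z)))).contMDiffAt
    ((triv (EF := EF) B ρ _).open_source.mem_nhds (mem_trivAt B _))

theorem contMDiff_mk : ContMDiff (𝓘(ℂ, EQ).prod 𝓘(ℂ, EF)) 𝓘(ℂ, EX × EF) ω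
    (fun p : Q × F => mk B ρ p.1 p.2) := by
  intro p
  set t := trivAt B (B.proj p.1)
  have ho : IsOpen (B.proj ⁻¹' t.base) := t.isOpen_base.preimage B.contMDiff_proj.continuous
  have h1 : ContMDiffOn (𝓘(ℂ, EQ).prod 𝓘(ℂ, EF)) 𝓘(ℂ, EX × EF) ω
      ((triv (EF := EF) B ρ t).symm ∘ fun p : Q × F => (B.proj p.1, ρ (t.coord p.1) p.2))
      ((B.proj ⁻¹' t.base) ×ˢ univ) := by
    refine (contMDiffOn_triv_symm (EF := EF) B ρ t).comp
      (((B.contMDiff_proj.comp contMDiff_fst).contMDiffOn).prodMk ?_)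
      fun q hq => ⟨hq.1, mem_univ _⟩
    exact (HolAction.contMDiff (EH := EH) (EF := EF) (ρ := ρ)).comp_contMDiffOn
      (f := fun p : Q × F => (t.coord p.1, p.2))
      ((t.contMDiffOn_coord.comp contMDiffOn_fst fun q hq => hq.1).prodMk contMDiffOn_snd)
  refine (h1.congr fun q hq => ?_).contMDiffAt
    ((ho.prod isOpen_univ).mem_nhds ⟨mem_trivAt B _, mem_univ _⟩)
  exact (mk_sec B ρ t q.1 q.2 hq.1).symm

end Assoc
end Assoc

section Extend
variable {EQ EX EH EM Q X H M : Type*}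
  [NormedAddCommGroup EQ] [NormedSpace ℂ EQ] [NormedAddCommGroup EX] [NormedSpace ℂ EX]
  [NormedAddCommGroup EH] [NormedSpace ℂ EH] [NormedAddCommGroup EM] [NormedSpace ℂ EM]
  [TopologicalSpace Q] [ChartedSpace EQ Q]
  [TopologicalSpace X] [ChartedSpace EX X] [IsManifold 𝓘(ℂ, EX) ω X]
  [TopologicalSpace H] [ChartedSpace EH H] [Group H]
  [TopologicalSpace M] [ChartedSpace EM M] [Group M] [LieGroup 𝓘(ℂ, EM) ω M]

/-- `H` acting on `M` by left multiplication through `τ`. -/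
def leftMulHom (τ : ContMDiffMonoidMorphism 𝓘(ℂ, EH) 𝓘(ℂ, EM) ω H M) : H →* Equiv.Perm M :=
  (MulAction.toPermHom M M).comp τ.toMonoidHom

@[simp] theorem leftMulHom_apply (τ : ContMDiffMonoidMorphism 𝓘(ℂ, EH) 𝓘(ℂ, EM) ω H M) (h : H)
    (m : M) : leftMulHom τ h m = τ.toMonoidHom h * m := rfl

instance (τ : ContMDiffMonoidMorphism 𝓘(ℂ, EH) 𝓘(ℂ, EM) ω H M) :
    HolAction EH EM (leftMulHom τ) where
  contMDiff := (τ.contMDiff_toFun.comp contMDiff_fst).mul contMDiff_snd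

variable (B : PrincipalBundle EQ EX EH Q X H)
  (τ : ContMDiffMonoidMorphism 𝓘(ℂ, EH) 𝓘(ℂ, EM) ω H M)

/-- The right action `[q, b] m = [q, b m]` of `M` on `Q ×^τ M`. -/
def extendAct (z : Assoc B (leftMulHom τ)) (m : M) : Assoc B (leftMulHom τ) :=
  Quotient.map' (s₁ := assocSetoid B (leftMulHom τ)) (s₂ := assocSetoid B (leftMulHom τ))
    (fun p => (p.1, p.2 * m)) (by
    rintro p _ ⟨h, rfl⟩
    refine ⟨h, Prod.ext rfl ?_⟩
    exact mul_assoc (τ.toMonoidHom h⁻¹) p.2 m) z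

@[simp] theorem extendAct_mk (q : Q) (b m : M) :
    extendAct B τ (Assoc.mk B (leftMulHom τ) q b) m = Assoc.mk B (leftMulHom τ) q (b * m) := rfl

theorem extend_proj_act (z : Assoc B (leftMulHom τ)) (m : M) :
    Assoc.proj B (leftMulHom τ) (extendAct B τ z m) = Assoc.proj B (leftMulHom τ) z := by
  obtain ⟨q, b, rfl⟩ := Assoc.mk_surjective B _ z
  rfl

theorem extend_coord_act (t : LocalTriv EQ EX EH B.proj B.act) (z : Assoc B (leftMulHom τ)) (m : M)
    (hz : Assoc.proj B (leftMulHom τ) z ∈ t.base) :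
    Assoc.fibreCoord B (leftMulHom τ) t (extendAct B τ z m) =
      Assoc.fibreCoord B (leftMulHom τ) t z * m := by
  obtain ⟨q, b, rfl⟩ := Assoc.mk_surjective B _ z
  rw [extendAct_mk, Assoc.fibreCoord_mk _ _ _ _ _ hz, Assoc.fibreCoord_mk _ _ _ _ _ hz]
  simp [mul_assoc]

/-- The principal `M`-bundle `Q ×^τ M` obtained by extension of the structure group along `τ`. -/
def PrincipalBundle.extend :
    PrincipalBundle (EX × EM) EX EM (Assoc B (leftMulHom τ)) X M where
  proj := Assoc.proj B (leftMulHom τ)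
  act := extendAct B τ
  act_one z := by
    obtain ⟨q, b, rfl⟩ := Assoc.mk_surjective B _ z
    simp
  act_mul z m m' := by
    obtain ⟨q, b, rfl⟩ := Assoc.mk_surjective B _ z
    simp [mul_assoc]
  proj_act := extend_proj_act B τ
  contMDiff_proj := Assoc.contMDiff_proj B (leftMulHom τ)
  contMDiff_act := by
    intro p
    set t := Assoc.trivAt B (Assoc.proj B (leftMulHom τ) p.1)
    have ho : IsOpen (Assoc.proj B (leftMulHom τ) ⁻¹' t.base) :=
      (Assoc.triv (EF := EM) B (leftMulHom τ) t).open_source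
    have h2 := Assoc.contMDiffOn_triv (EF := EM) B (leftMulHom τ) t
    have h1 : ContMDiffOn (𝓘(ℂ, EX × EM).prod 𝓘(ℂ, EM)) 𝓘(ℂ, EX × EM) ω
        ((Assoc.triv (EF := EM) B (leftMulHom τ) t).symm ∘
          fun p : Assoc B (leftMulHom τ) × M => (Assoc.proj B (leftMulHom τ) p.1,
            Assoc.fibreCoord B (leftMulHom τ) t p.1 * p.2))
        ((Assoc.proj B (leftMulHom τ) ⁻¹' t.base) ×ˢ univ) := by
      refine (Assoc.contMDiffOn_triv_symm (EF := EM) B (leftMulHom τ) t).comp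
        (((Assoc.contMDiff_proj B (leftMulHom τ)).comp contMDiff_fst).contMDiffOn.prodMk
          (ContMDiffOn.mul ?_ contMDiffOn_snd)) fun q hq => ⟨hq.1, mem_univ _⟩
      exact (contMDiff_snd.comp_contMDiffOn h2).comp contMDiffOn_fst fun q hq => hq.1
    refine (h1.congr fun q hq => ?_).contMDiffAt
      ((ho.prod isOpen_univ).mem_nhds ⟨Assoc.mem_trivAt B _, mem_univ _⟩)
    have h3 : Assoc.proj B (leftMulHom τ) (extendAct B τ q.1 q.2) ∈ t.base := by
      rw [extend_proj_act]; exact hq.1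
    have h4 := (Assoc.triv (EF := EM) B (leftMulHom τ) t).left_inv h3
    rw [← h4]
    exact congrArg _ (Prod.ext (extend_proj_act B τ q.1 q.2) (extend_coord_act B τ t _ _ hq.1))
  exists_localTriv x := by
    obtain ⟨t, ht⟩ := B.exists_localTriv x
    refine ⟨{
      base := t.base
      sec := fun x => Assoc.mk B (leftMulHom τ) (t.sec x) 1
      coord := Assoc.fibreCoord B (leftMulHom τ) t
      isOpen_base := t.isOpen_base
      contMDiffOn_sec := ?_
      contMDiffOn_coord := contMDiff_snd.comp_contMDiffOn
        (Assoc.contMDiffOn_triv (EF := EM) B (leftMulHom τ) t)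
      proj_sec := t.proj_sec
      coord_sec := ?_
      coord_act := fun z m hz => extend_coord_act B τ t z m hz
      act_coord := ?_ }, ht⟩
    · exact (Assoc.contMDiffOn_triv_symm (EF := EM) B (leftMulHom τ) t).comp
        (contMDiffOn_id.prodMk contMDiffOn_const) fun x hx => ⟨hx, mem_univ _⟩
    · intro x hx
      rw [Assoc.fibreCoord_mk _ _ _ _ _ (by rw [t.proj_sec x hx]; exact hx), t.coord_sec x hx]
      simp
    · intro z hz
      rw [extendAct_mk, one_mul]
      exact (Assoc.triv (EF := EM) B (leftMulHom τ) t).left_inv hz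

end Extend

section Atiyah
variable {EP EX EM P X M : Type*}
  [NormedAddCommGroup EP] [NormedSpace ℂ EP] [NormedAddCommGroup EX] [NormedSpace ℂ EX]
  [NormedAddCommGroup EM] [NormedSpace ℂ EM]
  [TopologicalSpace P] [ChartedSpace EP P]
  [TopologicalSpace X] [ChartedSpace EX X] [IsManifold 𝓘(ℂ, EX) ω X]
  [TopologicalSpace M] [ChartedSpace EM M] [Group M]

variable (B : PrincipalBundle EP EX EM P X M)

/-- The vector fields along the fibre `P_x`, with values in `TP`, which are invariant under the
right action of `M`. -/
def atiyahSubmodule (x : X) :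
    Submodule ℂ ((p : {p : P // B.proj p = x}) → TangentSpace 𝓘(ℂ, EP) p.1) where
  carrier := {v | ∀ (p : {p : P // B.proj p = x}) (m : M),
    v ⟨B.act p.1 m, (B.proj_act p.1 m).trans p.2⟩ =
      mfderiv 𝓘(ℂ, EP) 𝓘(ℂ, EP) (fun q => B.act q m) p.1 (v p)}
  add_mem' := by
    intro v w hv hw p m
    rw [Pi.add_apply, Pi.add_apply, hv, hw, map_add]
  zero_mem' := by
    intro p m
    rw [Pi.zero_apply, Pi.zero_apply, map_zero]
  smul_mem' := by
    intro c v hv p m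
    rw [Pi.smul_apply, Pi.smul_apply, hv, map_smul]

/-- The fibre at `x` of the Atiyah bundle `At P = TP / M`. -/
def AtiyahFibre (x : X) : Type _ := ↥(atiyahSubmodule B x)

instance (x : X) : AddCommGroup (AtiyahFibre B x) :=
  inferInstanceAs (AddCommGroup (atiyahSubmodule B x))
instance (x : X) : Module ℂ (AtiyahFibre B x) :=
  inferInstanceAs (Module ℂ (atiyahSubmodule B x))
instance (x : X) : TopologicalSpace (AtiyahFibre B x) :=
  inferInstanceAs (TopologicalSpace (atiyahSubmodule B x))
instance (x : X) : IsTopologicalAddGroup (AtiyahFibre B x) :=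
  inferInstanceAs (IsTopologicalAddGroup (atiyahSubmodule B x))
instance (x : X) : ContinuousSMul ℂ (AtiyahFibre B x) :=
  inferInstanceAs (ContinuousSMul ℂ (atiyahSubmodule B x))

/-- The value in `T_p P` of an element of the Atiyah fibre at a point `p` of `P_x`. -/
def AtiyahFibre.eval {x : X} (v : AtiyahFibre B x) (p : P) (hp : B.proj p = x) :
    TangentSpace 𝓘(ℂ, EP) p := v.1 ⟨p, hp⟩

variable [IsManifold 𝓘(ℂ, EP) ω P]

theorem contMDiff_actRight (m : M) : ContMDiff 𝓘(ℂ, EP) 𝓘(ℂ, EP) ω fun q => B.act q m :=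
  B.contMDiff_act.comp (contMDiff_id.prodMk contMDiff_const)

theorem mdifferentiable_actRight (m : M) (q : P) :
    MDifferentiableAt 𝓘(ℂ, EP) 𝓘(ℂ, EP) (fun q => B.act q m) q :=
  (contMDiff_actRight B m).mdifferentiableAt (by simp)

/-- Translation by `m` between tangent spaces, with target identified along an equality. -/
theorem mfderiv_act_mul (q : P) (m m' : M) (u : EP) (p : P) (hp : B.act q m = p) :
    (mfderiv 𝓘(ℂ, EP) 𝓘(ℂ, EP) (fun q => B.act q (m * m')) q u : EP) =
      (mfderiv 𝓘(ℂ, EP) 𝓘(ℂ, EP) (fun q => B.act q m') p :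
        EP →L[ℂ] EP) (mfderiv 𝓘(ℂ, EP) 𝓘(ℂ, EP) (fun q => B.act q m) q u : EP) := by
  subst hp
  have h1 : (fun q => B.act q (m * m')) = (fun q => B.act q m') ∘ fun q => B.act q m := by
    funext q; exact B.act_mul q m m'
  have h2 := mfderiv_comp q (mdifferentiable_actRight B m' (B.act q m))
    (mdifferentiable_actRight B m q)
  have h3 := congrArg (fun f : P → P => (mfderiv 𝓘(ℂ, EP) 𝓘(ℂ, EP) f q : EP →L[ℂ] EP) u) h1
  exact h3.trans (DFunLike.congr_fun h2 u)

/-- The invariant vector field along `P_x` with a given value at `sec x`. -/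
def atiyahExtend (t : LocalTriv EP EX EM B.proj B.act) (x : X) (hx : x ∈ t.base) (u : EP) :
    AtiyahFibre B x :=
  ⟨fun p => (mfderiv 𝓘(ℂ, EP) 𝓘(ℂ, EP) (fun q => B.act q (t.coord p.1)) (t.sec x) :
      EP →L[ℂ] EP) u, by
    rintro ⟨p, rfl⟩ m
    have h1 := t.coord_act p m hx
    have h2 := mfderiv_act_mul B (t.sec (B.proj p)) (t.coord p) m u p (t.act_coord p hx)
    rw [← h1] at h2
    exact h2⟩

theorem continuous_atiyahExtend (t : LocalTriv EP EX EM B.proj B.act) (x : X) (hx : x ∈ t.base) :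
    Continuous (atiyahExtend B t x hx) := by
  refine Continuous.subtype_mk (continuous_pi fun p => ?_) _
  exact (mfderiv 𝓘(ℂ, EP) 𝓘(ℂ, EP) (fun q => B.act q (t.coord p.1)) (t.sec x) :
      EP →L[ℂ] EP).continuous

/-- Evaluation at the point `sec x` of a local trivialization identifies the Atiyah fibre with
the tangent space of `P` at that point. -/
def atiyahEquiv (t : LocalTriv EP EX EM B.proj B.act) (x : X) (hx : x ∈ t.base) :
    AtiyahFibre B x ≃L[ℂ] TangentSpace 𝓘(ℂ, EP) (t.sec x) where
  toFun v := v.1 ⟨t.sec x, t.proj_sec x hx⟩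
  map_add' v w := rfl
  map_smul' c v := rfl
  invFun := atiyahExtend B t x hx
  left_inv v := by
    refine Subtype.ext (funext ?_)
    rintro ⟨p, rfl⟩
    have h1 := v.2 ⟨t.sec (B.proj p), t.proj_sec _ hx⟩ (t.coord p)
    refine h1.symm.trans ?_
    have h2 : ∀ (p' : P) (hp' : B.proj p' = B.proj p), p' = p →
      (v.1 ⟨p', hp'⟩ : EP) = v.1 ⟨p, rfl⟩ := by
      rintro _ _ rfl; rfl
    exact h2 _ _ (t.act_coord p hx)
  right_inv u := by
    have h1 := t.coord_sec x hx
    have h2 : (fun q => B.act q (1 : M)) = id := funext B.act_one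
    have h3 : (mfderiv 𝓘(ℂ, EP) 𝓘(ℂ, EP) (fun q => B.act q (t.coord (t.sec x))) (t.sec x) :
      EP →L[ℂ] EP) u = u := by
      rw [h1]
      exact (congrArg (fun f : P → P => (mfderiv 𝓘(ℂ, EP) 𝓘(ℂ, EP) f (t.sec x) :
        EP →L[ℂ] EP) u) h2).trans (DFunLike.congr_fun mfderiv_id u)
    exact h3
  continuous_toFun := (continuous_apply _).comp continuous_subtype_val
  continuous_invFun := continuous_atiyahExtend B t x hx

/-- The base set of the preferred trivialization of `At P` around `x₀`. -/
def atiyahBase (x₀ : X) : Set X :=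
  (Assoc.trivAt B x₀).base ∩
    (Assoc.trivAt B x₀).sec ⁻¹' (chartAt EP ((Assoc.trivAt B x₀).sec x₀)).source

/-- In the preferred trivialization of `At P` around `x₀`, an invariant vector field along `P_x` is
represented by the coordinates of its value at `sec x` in the chart of `P` at `sec x₀`. -/
def atiyahTrivEquiv (x₀ x : X) (hx : x ∈ atiyahBase B x₀) : AtiyahFibre B x ≃L[ℂ] EP :=
  (atiyahEquiv B (Assoc.trivAt B x₀) x hx.1).trans
    ((mdifferentiable_chart (I := 𝓘(ℂ, EP)) ((Assoc.trivAt B x₀).sec x₀)).mfderiv hx.2)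

open scoped Classical in
/-- The preferred trivialization of `At P` around `x₀`. -/
def atiyahPretriv (x₀ : X) : Pretrivialization EP (π EP (AtiyahFibre B)) where
  toFun z := (z.1, if h : z.1 ∈ atiyahBase B x₀ then atiyahTrivEquiv B x₀ z.1 h z.2 else 0)
  invFun y := ⟨y.1, if h : y.1 ∈ atiyahBase B x₀ then (atiyahTrivEquiv B x₀ y.1 h).symm y.2 else 0⟩
  source := π EP (AtiyahFibre B) ⁻¹' atiyahBase B x₀
  target := atiyahBase B x₀ ×ˢ univ
  map_source' z hz := ⟨hz, mem_univ _⟩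
  map_target' y hy := hy.1
  left_inv' := by
    rintro ⟨x, v⟩ (hx : x ∈ atiyahBase B x₀)
    simp [hx]
  right_inv' := by
    rintro ⟨x, w⟩ ⟨hx, -⟩
    have hx : x ∈ atiyahBase B x₀ := hx
    simp [hx]
  open_target := by
    refine IsOpen.prod ?_ isOpen_univ
    exact (Assoc.trivAt B x₀).contMDiffOn_sec.continuousOn.isOpen_inter_preimage
      (Assoc.trivAt B x₀).isOpen_base (chartAt EP _).open_source
  baseSet := atiyahBase B x₀
  open_baseSet := (Assoc.trivAt B x₀).contMDiffOn_sec.continuousOn.isOpen_inter_preimage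
      (Assoc.trivAt B x₀).isOpen_base (chartAt EP _).open_source
  source_eq := rfl
  target_eq := rfl
  proj_toFun z hz := rfl

theorem atiyahPretriv_apply (x₀ x : X) (hx : x ∈ atiyahBase B x₀) (v : AtiyahFibre B x) :
    atiyahPretriv B x₀ ⟨x, v⟩ = (x, atiyahTrivEquiv B x₀ x hx v) := by
  exact Prod.ext rfl (dif_pos hx)

theorem atiyahPretriv_symm (x₀ x : X) (hx : x ∈ atiyahBase B x₀) (w : EP) :
    (atiyahPretriv B x₀).symm x w = (atiyahTrivEquiv B x₀ x hx).symm w := by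
  have h1 : (⟨x, (atiyahPretriv B x₀).symm x w⟩ : TotalSpace EP (AtiyahFibre B)) =
      ⟨x, (atiyahTrivEquiv B x₀ x hx).symm w⟩ := by
    rw [(atiyahPretriv B x₀).mk_symm hx]
    exact congrArg (TotalSpace.mk x) (dif_pos hx)
  exact TotalSpace.mk_inj.1 h1

/-- The coordinate change of `At P`. -/
def atiyahCoordChange (x₀ x₁ x : X) : EP →L[ℂ] EP :=
  fderiv ℂ (fun y => chartAt EP ((Assoc.trivAt B x₁).sec x₁)
    (B.act ((chartAt EP ((Assoc.trivAt B x₀).sec x₀)).symm y)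
      ((Assoc.trivAt B x₀).coord ((Assoc.trivAt B x₁).sec x))))
    (chartAt EP ((Assoc.trivAt B x₀).sec x₀) ((Assoc.trivAt B x₀).sec x))

theorem atiyahCoordChange_apply (x₀ x₁ x : X) (hx₀ : x ∈ atiyahBase B x₀)
    (hx₁ : x ∈ atiyahBase B x₁) (w : EP) :
    atiyahCoordChange B x₀ x₁ x w =
      atiyahTrivEquiv B x₁ x hx₁ ((atiyahTrivEquiv B x₀ x hx₀).symm w) := by
  set t₀ := Assoc.trivAt B x₀ with ht₀
  set t₁ := Assoc.trivAt B x₁ with ht₁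
  set c₀ := chartAt EP (t₀.sec x₀) with hc₀
  set c₁ := chartAt EP (t₁.sec x₁) with hc₁
  set m := t₀.coord (t₁.sec x) with hm
  have hl : c₀.symm (c₀ (t₀.sec x)) = t₀.sec x := c₀.left_inv hx₀.2
  have ha : B.act (t₀.sec x) m = t₁.sec x := by
    have h1 := t₀.act_coord (t₁.sec x)
    rw [t₁.proj_sec x hx₁.1] at h1
    exact h1 hx₀.1
  let A₀ : EP →L[ℂ] EP := mfderiv 𝓘(ℂ, EP) 𝓘(ℂ, EP) c₀.symm (c₀ (t₀.sec x))
  let A₁ : EP →L[ℂ] EP := mfderiv 𝓘(ℂ, EP) 𝓘(ℂ, EP) (fun q => B.act q m) (t₀.sec x)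
  let A₂ : EP →L[ℂ] EP := mfderiv 𝓘(ℂ, EP) 𝓘(ℂ, EP) c₁ (t₁.sec x)
  have h0 : HasMFDerivAt 𝓘(ℂ, EP) 𝓘(ℂ, EP) c₀.symm (c₀ (t₀.sec x)) A₀ :=
    ((mdifferentiable_chart (t₀.sec x₀)).mdifferentiableAt_symm
      (c₀.map_source hx₀.2)).hasMFDerivAt
  have h1 : HasMFDerivAt 𝓘(ℂ, EP) 𝓘(ℂ, EP) (fun q => B.act q m)
      (c₀.symm (c₀ (t₀.sec x))) A₁ := by
    rw [hl]; exact (mdifferentiable_actRight B m (t₀.sec x)).hasMFDerivAt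
  have h2 : HasMFDerivAt 𝓘(ℂ, EP) 𝓘(ℂ, EP) c₁
      (B.act (c₀.symm (c₀ (t₀.sec x))) m) A₂ := by
    rw [hl, ha]
    exact ((mdifferentiable_chart (t₁.sec x₁)).mdifferentiableAt hx₁.2).hasMFDerivAt
  have h3 : HasMFDerivAt 𝓘(ℂ, EP) 𝓘(ℂ, EP) (fun y => c₁ (B.act (c₀.symm y) m))
      (c₀ (t₀.sec x)) (A₂.comp (A₁.comp A₀)) :=
    HasMFDerivAt.comp (c₀ (t₀.sec x)) h2 (HasMFDerivAt.comp (c₀ (t₀.sec x)) h1 h0)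
  have h4 : atiyahCoordChange B x₀ x₁ x = A₂.comp (A₁.comp A₀) := by
    have h5 : HasFDerivAt (fun y => c₁ (B.act (c₀.symm y) m)) (A₂.comp (A₁.comp A₀))
      (c₀ (t₀.sec x)) := hasMFDerivAt_iff_hasFDerivAt.1 h3
    exact h5.fderiv
  rw [h4]
  rfl

theorem contMDiffOn_atiyahCoordChange (x₀ x₁ : X) :
    ContMDiffOn 𝓘(ℂ, EX) 𝓘(ℂ, EP →L[ℂ] EP) ω (atiyahCoordChange B x₀ x₁)
      (atiyahBase B x₀ ∩ atiyahBase B x₁) := by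
  rintro x ⟨hx₀, hx₁⟩
  refine ContMDiffAt.contMDiffWithinAt ?_
  set t₀ := Assoc.trivAt B x₀ with ht₀
  set t₁ := Assoc.trivAt B x₁ with ht₁
  set c₀ := chartAt EP (t₀.sec x₀) with hc₀
  set c₁ := chartAt EP (t₁.sec x₁) with hc₁
  have hl : c₀.symm (c₀ (t₀.sec x)) = t₀.sec x := c₀.left_inv hx₀.2
  have ha : B.act (t₀.sec x) (t₀.coord (t₁.sec x)) = t₁.sec x := by
    have h1 := t₀.act_coord (t₁.sec x)
    rw [t₁.proj_sec x hx₁.1] at h1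
    exact h1 hx₀.1
  have hs₀ : ContMDiffAt 𝓘(ℂ, EX) 𝓘(ℂ, EP) ω t₀.sec x :=
    t₀.contMDiffOn_sec.contMDiffAt (t₀.isOpen_base.mem_nhds hx₀.1)
  have hs₁ : ContMDiffAt 𝓘(ℂ, EX) 𝓘(ℂ, EP) ω t₁.sec x :=
    t₁.contMDiffOn_sec.contMDiffAt (t₁.isOpen_base.mem_nhds hx₁.1)
  have hg : ContMDiffAt 𝓘(ℂ, EX) 𝓘(ℂ, EP) ω (fun b => c₀ (t₀.sec b)) x :=
    (contMDiffOn_chart.contMDiffAt (c₀.open_source.mem_nhds hx₀.2)).comp x hs₀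
  have hco : ContMDiffAt 𝓘(ℂ, EX) 𝓘(ℂ, EM) ω (fun b => t₀.coord (t₁.sec b)) x := by
    refine (t₀.contMDiffOn_coord.contMDiffAt ?_).comp x hs₁
    refine (t₀.isOpen_base.preimage B.contMDiff_proj.continuous).mem_nhds ?_
    change B.proj (t₁.sec x) ∈ t₀.base
    rw [t₁.proj_sec x hx₁.1]; exact hx₀.1
  have hf : ContMDiffAt (𝓘(ℂ, EX).prod 𝓘(ℂ, EP)) 𝓘(ℂ, EP) ω (Function.uncurry
      fun (b : X) (y : EP) => c₁ (B.act (c₀.symm y) (t₀.coord (t₁.sec b))))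
      (x, c₀ (t₀.sec x)) := by
    have h1 : ContMDiffAt (𝓘(ℂ, EX).prod 𝓘(ℂ, EP)) 𝓘(ℂ, EP) ω
        (fun p : X × EP => c₀.symm p.2) (x, c₀ (t₀.sec x)) :=
      (contMDiffOn_chart_symm.contMDiffAt (c₀.open_target.mem_nhds
        (c₀.map_source hx₀.2))).comp (x, c₀ (t₀.sec x)) contMDiffAt_snd
    have h2 : ContMDiffAt (𝓘(ℂ, EX).prod 𝓘(ℂ, EP)) 𝓘(ℂ, EM) ω
        (fun p : X × EP => t₀.coord (t₁.sec p.1)) (x, c₀ (t₀.sec x)) :=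
      ContMDiffAt.comp (x, c₀ (t₀.sec x)) (g := fun b => t₀.coord (t₁.sec b)) hco contMDiffAt_fst
    have h3 : ContMDiffAt 𝓘(ℂ, EP) 𝓘(ℂ, EP) ω c₁
        (B.act (c₀.symm (c₀ (t₀.sec x))) (t₀.coord (t₁.sec x))) := by
      rw [hl, ha]
      exact contMDiffOn_chart.contMDiffAt (c₁.open_source.mem_nhds hx₁.2)
    exact ContMDiffAt.comp (x, c₀ (t₀.sec x)) (g := c₁)
      (f := fun p : X × EP => B.act (c₀.symm p.2) (t₀.coord (t₁.sec p.1))) h3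
      (B.contMDiff_act.contMDiffAt.comp (x, c₀ (t₀.sec x)) (h1.prodMk h2))
  have h5 := ContMDiffAt.mfderiv (m := ω)
    (fun (b : X) (y : EP) => c₁ (B.act (c₀.symm y) (t₀.coord (t₁.sec b))))
    (fun b => c₀ (t₀.sec b)) hf hg le_rfl
  have h6 := inTangentCoordinates_model_space (𝕜 := ℂ) (H := EP) (I := 𝓘(ℂ, EP)) (H' := EP)
    (I' := 𝓘(ℂ, EP)) (fun b => c₀ (t₀.sec b))
    (fun b => c₁ (B.act (c₀.symm (c₀ (t₀.sec b))) (t₀.coord (t₁.sec b))))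
    (fun b => (mfderiv 𝓘(ℂ, EP) 𝓘(ℂ, EP) (fun y => c₁ (B.act (c₀.symm y) (t₀.coord (t₁.sec b))))
      (c₀ (t₀.sec b)) : EP →L[ℂ] EP)) x
  have h7 := h5.congr_of_eventuallyEq (Filter.EventuallyEq.of_eq h6.symm)
  simp only [mfderiv_eq_fderiv] at h7
  exact h7

/-- The structure of holomorphic vector bundle on `At P`. -/
def atiyahPrebundle : VectorPrebundle ℂ EP (AtiyahFibre B) where
  pretrivializationAtlas := range (atiyahPretriv B)
  pretrivialization_linear' := by
    rintro _ ⟨x₀, rfl⟩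
    refine ⟨fun x hx => ?_⟩
    have h1 : (fun v : AtiyahFibre B x => (atiyahPretriv B x₀ ⟨x, v⟩).2) =
        atiyahTrivEquiv B x₀ x hx := by
      funext v; rw [atiyahPretriv_apply B x₀ x hx]
    rw [h1]
    exact (atiyahTrivEquiv B x₀ x hx).toLinearEquiv.toLinearMap.isLinear
  pretrivializationAt := atiyahPretriv B
  mem_base_pretrivializationAt x := ⟨Assoc.mem_trivAt B x, mem_chart_source _ _⟩
  pretrivialization_mem_atlas x := mem_range_self x
  exists_coordChange := by
    rintro _ ⟨x₀, rfl⟩ _ ⟨x₁, rfl⟩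
    refine ⟨atiyahCoordChange B x₀ x₁, (contMDiffOn_atiyahCoordChange B x₀ x₁).continuousOn, ?_⟩
    rintro x ⟨hx₀, hx₁⟩ w
    rw [atiyahCoordChange_apply B x₀ x₁ x hx₀ hx₁, atiyahPretriv_apply B x₁ x hx₁,
      atiyahPretriv_symm B x₀ x hx₀]
  totalSpaceMk_isInducing x := by
    have hx : x ∈ atiyahBase B x := ⟨Assoc.mem_trivAt B x, mem_chart_source _ _⟩
    have h1 : atiyahPretriv B x ∘ TotalSpace.mk x =
        Prod.mk x ∘ atiyahTrivEquiv B x x hx := by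
      funext v; exact atiyahPretriv_apply B x x hx v
    rw [h1]
    exact (isInducing_prodMkRight x).comp
      (atiyahTrivEquiv B x x hx).toHomeomorph.isInducing

instance : (atiyahPrebundle B).IsContMDiff 𝓘(ℂ, EX) ω where
  exists_contMDiffCoordChange := by
    rintro _ ⟨x₀, rfl⟩ _ ⟨x₁, rfl⟩
    refine ⟨atiyahCoordChange B x₀ x₁, contMDiffOn_atiyahCoordChange B x₀ x₁, ?_⟩
    rintro x ⟨hx₀, hx₁⟩ w
    rw [atiyahCoordChange_apply B x₀ x₁ x hx₀ hx₁, atiyahPretriv_apply B x₁ x hx₁,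
      atiyahPretriv_symm B x₀ x hx₀]

instance : TopologicalSpace (TotalSpace EP (AtiyahFibre B)) :=
  (atiyahPrebundle B).totalSpaceTopology
instance : FiberBundle EP (AtiyahFibre B) := (atiyahPrebundle B).toFiberBundle
instance : VectorBundle ℂ EP (AtiyahFibre B) := (atiyahPrebundle B).toVectorBundle
instance : ContMDiffVectorBundle ω EP (AtiyahFibre B) 𝓘(ℂ, EX) :=
  (atiyahPrebundle B).contMDiffVectorBundle 𝓘(ℂ, EX)

end Atiyah

section Clambda
variable {EP EX EM P X M : Type*}
  [NormedAddCommGroup EP] [NormedSpace ℂ EP] [NormedAddCommGroup EX] [NormedSpace ℂ EX]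
  [NormedAddCommGroup EM] [NormedSpace ℂ EM]
  [TopologicalSpace P] [ChartedSpace EP P] [IsManifold 𝓘(ℂ, EP) ω P]
  [TopologicalSpace X] [ChartedSpace EX X] [IsManifold 𝓘(ℂ, EX) ω X]
  [TopologicalSpace M] [ChartedSpace EM M] [Group M]

/-- The total space of the holomorphic vector bundle `Hom(TX, At P) = At P ⊗ Ω_X`. -/
abbrev AtOmega (B : PrincipalBundle EP EX EM P X M) : Type _ :=
  TotalSpace (EX →L[ℂ] EP) fun x : X => TangentSpace 𝓘(ℂ, EX) x →L[ℂ] AtiyahFibre B x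

/-- The base `C_c(P)` of the universal pullback `c`-connection on `P`: the homomorphisms
`ν : T_x X → At P_x` whose composition with the anchor `At P → TX` (the map induced by `dπ`, where
`π : P → X` is the projection) is `c • Id`. -/
def Clambda (B : PrincipalBundle EP EX EM P X M) (c : ℂ) : Set (AtOmega B) :=
  {z | ∀ (w : TangentSpace 𝓘(ℂ, EX) z.proj) (p : P) (hp : B.proj p = z.proj),
    (mfderiv 𝓘(ℂ, EP) 𝓘(ℂ, EX) B.proj p (AtiyahFibre.eval B (z.snd w) p hp) : EX) = c • (w : EX)}

end Clambda

section AdjointRep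
variable (E : Type*) {G : Type*} [NormedAddCommGroup E] [NormedSpace ℂ E]
  [TopologicalSpace G] [ChartedSpace E G] [Group G] [LieGroup 𝓘(ℂ, E) ω G]

/-- The adjoint action of `g` on the Lie algebra `T_1 G`. -/
def Ad (g : G) : E →L[ℂ] E := mfderiv 𝓘(ℂ, E) 𝓘(ℂ, E) (fun x : G => g * x * g⁻¹) 1

theorem contMDiff_conj (g : G) : ContMDiff 𝓘(ℂ, E) 𝓘(ℂ, E) ω (fun x : G => g * x * g⁻¹) :=
  (contMDiff_const.mul contMDiff_id).mul contMDiff_const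

theorem hasMFDerivAt_conj (g : G) :
    HasMFDerivAt 𝓘(ℂ, E) 𝓘(ℂ, E) (fun x : G => g * x * g⁻¹) 1 (Ad E g) :=
  ((contMDiff_conj E g).mdifferentiableAt (by simp)).hasMFDerivAt

theorem Ad_one : Ad E (1 : G) = ContinuousLinearMap.id ℂ E := by
  have h1 := hasMFDerivAt_conj E (1 : G)
  have h2 : (fun x : G => (1 : G) * x * (1 : G)⁻¹) = id := by funext x; simp
  rw [h2] at h1
  exact hasMFDerivAt_unique h1 (hasMFDerivAt_id _)

theorem Ad_mul (g g' : G) : Ad E (g * g') = (Ad E g).comp (Ad E g') := by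
  have h1 := hasMFDerivAt_conj E (g * g')
  have h2 : HasMFDerivAt 𝓘(ℂ, E) 𝓘(ℂ, E) (fun x : G => g * x * g⁻¹) (g' * 1 * g'⁻¹) (Ad E g) := by
    rw [show g' * 1 * g'⁻¹ = 1 by simp]; exact hasMFDerivAt_conj E g
  have h3 := HasMFDerivAt.comp (1 : G) h2 (hasMFDerivAt_conj E g')
  have h4 : (fun x : G => g * x * g⁻¹) ∘ (fun x : G => g' * x * g'⁻¹) =
      fun x : G => (g * g') * x * (g * g')⁻¹ := by
    funext x; simp [mul_assoc]
  rw [h4] at h3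
  exact hasMFDerivAt_unique h1 h3

theorem contMDiff_Ad : ContMDiff 𝓘(ℂ, E) 𝓘(ℂ, E →L[ℂ] E) ω (Ad E : G → E →L[ℂ] E) := by
  intro g₀
  have hf : ContMDiffAt (𝓘(ℂ, E).prod 𝓘(ℂ, E)) 𝓘(ℂ, E) ω
      (Function.uncurry fun (g x : G) => g * x * g⁻¹) (g₀, 1) :=
    ((contMDiff_fst.mul contMDiff_snd).mul contMDiff_fst.inv).contMDiffAt
  have h5 := ContMDiffAt.mfderiv (m := ω) (fun (g x : G) => g * x * g⁻¹) (fun _ : G => (1 : G)) hf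
    contMDiffAt_const le_rfl
  refine h5.congr_of_eventuallyEq (Filter.Eventually.of_forall fun g => ?_)
  have h1 : ∀ g : G, g * 1 * g⁻¹ = 1 := fun g => by simp
  have h6 := inTangentCoordinates_eq (𝕜 := ℂ) (H := E) (I := 𝓘(ℂ, E)) (H' := E)
    (I' := 𝓘(ℂ, E)) (fun _ : G => (1 : G)) (fun g : G => g * 1 * g⁻¹) (fun g => Ad E g)
    (x₀ := g₀) (x := g) (mem_chart_source _ _) (by simp only [h1]; exact mem_chart_source _ _)
  refine Eq.trans ?_ h6.symm
  ext v
  simp only [h1, ContinuousLinearMap.comp_apply]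
  rw [(tangentBundleCore 𝓘(ℂ, E) G).coordChange_self _ _ (mem_achart_source _ _),
    (tangentBundleCore 𝓘(ℂ, E) G).coordChange_self _ _ (mem_achart_source _ _)]

variable {E} {E' G' : Type*} [NormedAddCommGroup E'] [NormedSpace ℂ E']
  [TopologicalSpace G'] [ChartedSpace E' G'] [Group G'] [LieGroup 𝓘(ℂ, E') ω G']

/-- The differential of a homomorphism is equivariant for the adjoint actions. -/
theorem mfderiv_Ad (f : G →* G') (hf : ContMDiff 𝓘(ℂ, E) 𝓘(ℂ, E') ω f) (g : G) (v : E) :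
    (mfderiv 𝓘(ℂ, E) 𝓘(ℂ, E') f 1 : E →L[ℂ] E') (Ad E g v) =
      Ad E' (f g) ((mfderiv 𝓘(ℂ, E) 𝓘(ℂ, E') f 1 : E →L[ℂ] E') v) := by
  have h0 : HasMFDerivAt 𝓘(ℂ, E) 𝓘(ℂ, E') f 1 (mfderiv 𝓘(ℂ, E) 𝓘(ℂ, E') f 1) :=
    (hf.mdifferentiableAt (by simp)).hasMFDerivAt
  have h1 : HasMFDerivAt 𝓘(ℂ, E) 𝓘(ℂ, E') f (g * 1 * g⁻¹)
      (mfderiv 𝓘(ℂ, E) 𝓘(ℂ, E') f 1 : E →L[ℂ] E') := by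
    rw [show g * 1 * g⁻¹ = 1 by simp]; exact h0
  have h2 : HasMFDerivAt 𝓘(ℂ, E') 𝓘(ℂ, E') (fun x : G' => f g * x * (f g)⁻¹) (f 1)
      (Ad E' (f g)) := by
    rw [map_one]; exact hasMFDerivAt_conj E' (f g)
  have h3 := HasMFDerivAt.comp (1 : G) h1 (hasMFDerivAt_conj E g)
  have h4 := HasMFDerivAt.comp (1 : G) h2 h0
  have h5 : (f : G → G') ∘ (fun x : G => g * x * g⁻¹) =
      (fun x : G' => f g * x * (f g)⁻¹) ∘ f := by
    funext x; simp
  rw [h5] at h3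
  exact DFunLike.congr_fun (hasMFDerivAt_unique h3 h4) v

end AdjointRep

section QuotMap
variable {E : Type*} [NormedAddCommGroup E] [NormedSpace ℂ E]

/-- The endomorphism of `E ⧸ W` induced by an endomorphism of `E` preserving `W`. -/
def quotMap (W : Submodule ℂ E) (T : E →L[ℂ] E) (hT : ∀ w ∈ W, T w ∈ W) :
    (E ⧸ W) →L[ℂ] (E ⧸ W) :=
  W.liftQL (W.mkQL.comp T) fun w hw => (Submodule.Quotient.mk_eq_zero W).2 (hT w hw)

@[simp] theorem quotMap_mk (W : Submodule ℂ E) (T : E →L[ℂ] E) (hT : ∀ w ∈ W, T w ∈ W) (e : E) :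
    quotMap W T hT (Submodule.Quotient.mk e) = Submodule.Quotient.mk (T e) := rfl

theorem contMDiff_quotMap [FiniteDimensional ℂ E] {EH H : Type*} [NormedAddCommGroup EH]
    [NormedSpace ℂ EH] [TopologicalSpace H] [ChartedSpace EH H] (W : Submodule ℂ E)
    [IsClosed (W : Set E)] (T : H → E →L[ℂ] E) (hT : ∀ h, ∀ w ∈ W, T h w ∈ W)
    (hd : ContMDiff 𝓘(ℂ, EH) 𝓘(ℂ, E →L[ℂ] E) ω T) :
    ContMDiff 𝓘(ℂ, EH) 𝓘(ℂ, (E ⧸ W) →L[ℂ] (E ⧸ W)) ω fun h => quotMap W (T h) (hT h) := by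
  obtain ⟨s, hs⟩ := LinearMap.exists_rightInverse_of_surjective W.mkQ W.range_mkQ
  let s' : (E ⧸ W) →L[ℂ] E := LinearMap.toContinuousLinearMap s
  have h1 : (fun h => quotMap W (T h) (hT h)) = fun h => W.mkQL.comp ((T h).comp s') := by
    funext h
    ext x
    have h2 : Submodule.Quotient.mk (s x) = x := DFunLike.congr_fun hs x
    conv_lhs => rw [← h2]
    rfl
  rw [h1]
  exact contMDiff_const.clm_comp (hd.clm_comp contMDiff_const)

end QuotMap

section Rep
variable {G M : Type*} (EG EH : Type*) {EM : Type*}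
  [NormedAddCommGroup EG] [NormedSpace ℂ EG] [FiniteDimensional ℂ EG]
  [NormedAddCommGroup EH] [NormedSpace ℂ EH] [FiniteDimensional ℂ EH]
  [NormedAddCommGroup EM] [NormedSpace ℂ EM] [FiniteDimensional ℂ EM]
  [TopologicalSpace G] [ChartedSpace EG G] [Group G] [LieGroup 𝓘(ℂ, EG) ω G]
  [TopologicalSpace M] [ChartedSpace EM M] [Group M] [LieGroup 𝓘(ℂ, EM) ω M]
  (H : Subgroup G) [ChartedSpace EH H] [LieGroup 𝓘(ℂ, EH) ω H] [IsClosedLieSubgroup EG EH H]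

instance isClosed_lieSub : IsClosed (lieSub EG EH H : Set EG) :=
  (lieSub EG EH H).closed_of_finiteDimensional

variable {H} (τ : ContMDiffMonoidMorphism 𝓘(ℂ, EH) 𝓘(ℂ, EM) ω H M)

/-- The inclusion `𝔥 → 𝔤 ⊕ 𝔪`, `ξ ↦ (ξ, -dτ ξ)`. -/
def twistedIncl : EH →L[ℂ] EG × EM :=
  (dIncl EG EH H).prod (-(mfderiv 𝓘(ℂ, EH) 𝓘(ℂ, EM) τ.toMonoidHom 1 : EH →L[ℂ] EM))

/-- The image of `𝔥` in `𝔤 ⊕ 𝔪` under `ξ ↦ (ξ, -dτ ξ)`. -/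
def twistedSub : Submodule ℂ (EG × EM) :=
  LinearMap.range (twistedIncl EG EH τ : EH →ₗ[ℂ] EG × EM)

instance isClosed_twistedSub : IsClosed (twistedSub EG EH τ : Set (EG × EM)) :=
  (twistedSub EG EH τ).closed_of_finiteDimensional

/-- The `H`-representation `Hom(𝔤/𝔥, (𝔤 ⊕ 𝔪)/𝔥)`. -/
abbrev HomRep : Type _ := (EG ⧸ lieSub EG EH H) →L[ℂ] ((EG × EM) ⧸ twistedSub EG EH τ)

/-- The action of `h` on `𝔤 ⊕ 𝔪`, through `Ad` and `τ`. -/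
def twistedAd (h : H) : (EG × EM) →L[ℂ] (EG × EM) :=
  (Ad EG (h : G)).prodMap (Ad EM (τ.toMonoidHom h))

theorem Ad_mem_lieSub (h : H) : ∀ w ∈ lieSub EG EH H, Ad EG (h : G) w ∈ lieSub EG EH H := by
  rintro _ ⟨v, rfl⟩
  exact ⟨Ad EH h v, mfderiv_Ad H.subtype
    (IsClosedLieSubgroup.contMDiff_val (EG := EG) (EH := EH) (H := H)) h v⟩

theorem twistedAd_mem (h : H) : ∀ w ∈ twistedSub EG EH τ,
    twistedAd EG EH τ h w ∈ twistedSub EG EH τ := by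
  rintro _ ⟨v, rfl⟩
  have h1 := mfderiv_Ad H.subtype
    (IsClosedLieSubgroup.contMDiff_val (EG := EG) (EH := EH) (H := H)) h v
  have h2 := mfderiv_Ad τ.toMonoidHom τ.contMDiff_toFun h v
  refine ⟨Ad EH h v, Prod.ext h1 ?_⟩
  exact (congrArg Neg.neg h2).trans (map_neg (Ad EM (τ.toMonoidHom h)) _).symm

/-- The adjoint action of `h` on `𝔤/𝔥`. -/
def baseAd (h : H) : (EG ⧸ lieSub EG EH H) →L[ℂ] (EG ⧸ lieSub EG EH H) :=
  quotMap _ (Ad EG (h : G)) (Ad_mem_lieSub EG EH h)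

/-- The action of `h` on `(𝔤 ⊕ 𝔪)/𝔥`. -/
def totalAd (h : H) :
    ((EG × EM) ⧸ twistedSub EG EH τ) →L[ℂ] ((EG × EM) ⧸ twistedSub EG EH τ) :=
  quotMap _ (twistedAd EG EH τ h) (twistedAd_mem EG EH τ h)

theorem baseAd_one : baseAd EG EH (1 : H) = ContinuousLinearMap.id ℂ _ := by
  ext x
  induction x using Submodule.Quotient.induction_on with
  | _ e => exact congrArg Submodule.Quotient.mk (DFunLike.congr_fun (Ad_one EG (G := G)) e)

theorem baseAd_mul (h h' : H) :
    baseAd EG EH (h * h') = (baseAd EG EH h).comp (baseAd EG EH h') := by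
  ext x
  induction x using Submodule.Quotient.induction_on with
  | _ e => exact congrArg Submodule.Quotient.mk (DFunLike.congr_fun (Ad_mul EG (h : G) h') e)

theorem totalAd_one : totalAd EG EH τ (1 : H) = ContinuousLinearMap.id ℂ _ := by
  ext x
  induction x using Submodule.Quotient.induction_on with
  | _ e =>
    refine congrArg Submodule.Quotient.mk (Prod.ext (DFunLike.congr_fun (Ad_one EG (G := G)) e.1) ?_)
    change Ad EM (τ.toMonoidHom 1) e.2 = e.2
    rw [map_one, Ad_one]; rfl

theorem totalAd_mul (h h' : H) :
    totalAd EG EH τ (h * h') = (totalAd EG EH τ h).comp (totalAd EG EH τ h') := by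
  ext x
  induction x using Submodule.Quotient.induction_on with
  | _ e =>
    refine congrArg Submodule.Quotient.mk
      (Prod.ext (DFunLike.congr_fun (Ad_mul EG (h : G) h') e.1) ?_)
    change Ad EM (τ.toMonoidHom (h * h')) e.2 = _
    rw [map_mul, Ad_mul]; rfl

/-- The linear action `(h, ν) ↦ h ∘ ν ∘ h⁻¹` of `H` on `Hom(𝔤/𝔥, (𝔤 ⊕ 𝔪)/𝔥)`. -/
def homAction : H →* Equiv.Perm (HomRep EG EH τ) where
  toFun h :=
    { toFun := fun ν => (totalAd EG EH τ h).comp (ν.comp (baseAd EG EH h⁻¹))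
      invFun := fun ν => (totalAd EG EH τ h⁻¹).comp (ν.comp (baseAd EG EH h))
      left_inv := fun ν => by
        have h1 := totalAd_mul EG EH τ h⁻¹ h
        have h2 := baseAd_mul EG EH h⁻¹ h
        rw [inv_mul_cancel, totalAd_one] at h1
        rw [inv_mul_cancel, baseAd_one] at h2
        ext x
        exact (DFunLike.congr_fun h1 _).symm.trans
          (congrArg ν (DFunLike.congr_fun h2 x).symm)
      right_inv := fun ν => by
        have h1 := totalAd_mul EG EH τ h h⁻¹
        have h2 := baseAd_mul EG EH h h⁻¹
        rw [mul_inv_cancel, totalAd_one] at h1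
        rw [mul_inv_cancel, baseAd_one] at h2
        ext x
        exact (DFunLike.congr_fun h1 _).symm.trans
          (congrArg ν (DFunLike.congr_fun h2 x).symm) }
  map_one' := by
    ext ν x
    change totalAd EG EH τ 1 (ν (baseAd EG EH 1⁻¹ x)) = ν x
    rw [inv_one, totalAd_one, baseAd_one]; rfl
  map_mul' h h' := by
    ext ν x
    change totalAd EG EH τ (h * h') (ν (baseAd EG EH (h * h')⁻¹ x)) = _
    rw [mul_inv_rev, totalAd_mul, baseAd_mul]; rfl

instance homAction_hol : HolAction EH (HomRep EG EH τ) (homAction EG EH τ) where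
  contMDiff := by
    have hv : ContMDiff 𝓘(ℂ, EH) 𝓘(ℂ, EG) ω (Subtype.val : H → G) :=
      IsClosedLieSubgroup.contMDiff_val
    have hA : ContMDiff 𝓘(ℂ, EH) 𝓘(ℂ, EG →L[ℂ] EG) ω fun h : H => Ad EG (h : G) :=
      (contMDiff_Ad EG).comp hv
    have hB : ContMDiff 𝓘(ℂ, EH) 𝓘(ℂ, EM →L[ℂ] EM) ω fun h : H => Ad EM (τ.toMonoidHom h) :=
      (contMDiff_Ad EM).comp τ.contMDiff_toFun
    have h1 : ContMDiff 𝓘(ℂ, EH) 𝓘(ℂ, _) ω fun h : H => baseAd EG EH h :=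
      contMDiff_quotMap _ _ (Ad_mem_lieSub EG EH) hA
    have h2 : ContMDiff 𝓘(ℂ, EH) 𝓘(ℂ, _) ω fun h : H => totalAd EG EH τ h :=
      contMDiff_quotMap _ _ (twistedAd_mem EG EH τ) (hA.clm_prodMap hB)
    exact (h2.comp contMDiff_fst).clm_comp
      (contMDiff_snd.clm_comp ((h1.comp (contMDiff_inv 𝓘(ℂ, EH) ω)).comp contMDiff_fst))

/-- The projection `σ : (𝔤 ⊕ 𝔪)/𝔥 → 𝔤/𝔥`. -/
def sigmaProj : ((EG × EM) ⧸ twistedSub EG EH τ) →ₗ[ℂ] (EG ⧸ lieSub EG EH H) :=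
  (twistedSub EG EH τ).mapQ (lieSub EG EH H) (LinearMap.fst ℂ EG EM) (by
    rintro _ ⟨v, rfl⟩
    exact ⟨v, rfl⟩)

/-- The inclusion `𝔪 → (𝔤 ⊕ 𝔪)/𝔥`. -/
def mIncl : EM →L[ℂ] ((EG × EM) ⧸ twistedSub EG EH τ) :=
  (twistedSub EG EH τ).mkQL.comp (ContinuousLinearMap.inr ℂ EG EM)

/-- The affine space `𝔞_c` of linear maps `ν : 𝔤/𝔥 → (𝔤 ⊕ 𝔪)/𝔥` with `σ ∘ ν = c • Id`. -/
def aLambda (c : ℂ) : Set (HomRep EG EH τ) :=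
  {ν | ∀ x, sigmaProj EG EH τ (ν x) = c • x}

theorem sigmaProj_totalAd (h : H) (y : (EG × EM) ⧸ twistedSub EG EH τ) :
    sigmaProj EG EH τ (totalAd EG EH τ h y) = baseAd EG EH h (sigmaProj EG EH τ y) := by
  induction y using Submodule.Quotient.induction_on with
  | _ e => rfl

theorem homAction_mem (c : ℂ) (h : H) (ν : HomRep EG EH τ) (hν : ν ∈ aLambda EG EH τ c) :
    homAction EG EH τ h ν ∈ aLambda EG EH τ c := by
  intro x
  change sigmaProj EG EH τ (totalAd EG EH τ h (ν (baseAd EG EH h⁻¹ x))) = c • x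
  have h2 := baseAd_mul EG EH h h⁻¹
  rw [mul_inv_cancel, baseAd_one] at h2
  rw [sigmaProj_totalAd, hν, map_smul]
  exact congrArg (c • ·) (DFunLike.congr_fun h2 x).symm

/-- The action of `H` on the affine space `𝔞_c`. -/
def affAction (c : ℂ) : H →* Equiv.Perm (aLambda EG EH τ c) where
  toFun h :=
    { toFun := fun ν => ⟨homAction EG EH τ h ν.1, homAction_mem EG EH τ c h ν.1 ν.2⟩
      invFun := fun ν => ⟨homAction EG EH τ h⁻¹ ν.1, homAction_mem EG EH τ c h⁻¹ ν.1 ν.2⟩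
      left_inv := fun ν => Subtype.ext (by simp)
      right_inv := fun ν => Subtype.ext (by simp) }
  map_one' := by ext1 ν; exact Subtype.ext (by simp)
  map_mul' h h' := by ext1 ν; exact Subtype.ext (by simp)

/-- The principal `M`-bundle `G_H(M) = G ×^τ M` over `G ⧸ H` obtained from the principal `H`-bundle
`G → G ⧸ H` by extension of the structure group along `τ`. -/
abbrev homogExtension : PrincipalBundle (sliceModel EG EH H × EM) (sliceModel EG EH H) EM
    (Assoc (homogBundle EG EH H) (leftMulHom τ)) (G ⧸ H) M :=
  (homogBundle EG EH H).extend τ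

/-- The class `[a, b]` in `G ×^τ M`. -/
def extMk (a : G) (b : M) : Assoc (homogBundle EG EH H) (leftMulHom τ) :=
  Assoc.mk (homogBundle EG EH H) (leftMulHom τ) a b

end Rep
end LambdaConn

end

open LambdaConn

/-!
Write `X = G ⧸ H` and `P = G ×^τ M`, and let `x = g H`. Differentiating `a ↦ g a H` at `1` and
`(a, m) ↦ [g a, m]` at `(1, 1)` gives maps `𝔤 → T_x X` (`baseMap`) and `𝔤 ⊕ 𝔪 → T_{[g, 1]} P`
(`totMap`). Both are surjective, because `G → X` and `G × M → P` have local holomorphic sections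
through every point. The first one kills `𝔥`, and the second one kills the twisted copy of `𝔥`,
because `[g h, 1] = [g, τ h]`; by a count of dimensions these are the kernels. Evaluation at `[g, 1]`
identifies `(At P)_x` with `T_{[g, 1]} P`, so that `g` gives identifications `𝔤/𝔥 ≅ T_x X`
(`tangentEquiv`), `(𝔤 ⊕ 𝔪)/𝔥 ≅ (At P)_x` (`atEquiv`) and hence
`Hom(𝔤/𝔥, (𝔤 ⊕ 𝔪)/𝔥) ≅ Hom(T_x X, (At P)_x)` (`fibreIso`).

Replacing `g` by `g h` changes the identifications by the adjoint actions of `h` (`baseEquiv_mul`,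
`atEquiv_mul`), so `[g, ν] ↦ ν` is a well-defined fibrewise linear bijection (`assocEquiv`). It is
biholomorphic: over a local section `s` of `G → X` and in local trivializations of `TX` and `At P` it
reads `(x, ν) ↦ (x, β(x) ∘ ν ∘ α(x)⁻¹)`, where `α(x)` and `β(x)` are differentials at a fixed point
of maps which depend holomorphically on `x`, and are invertible (`exists_local_frame`).

Under these identifications the anchor `At P → TX` is the projection `σ`, so the bijection carries
`𝔞_c` to the fibres of `C_c(P)` (`mem_Clambda_fibreIso`). The affine structure of `𝔞_c` comes from the
exact sequence `0 → 𝔪 → (𝔤 ⊕ 𝔪)/𝔥 → 𝔤/𝔥 → 0` and a linear section of `𝔤 → 𝔤/𝔥`.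
-/

noncomputable section

namespace LambdaConn

/-! ### Linear algebra -/

section LinearAlgebra
variable {E F : Type*} [NormedAddCommGroup E] [NormedSpace ℂ E] [FiniteDimensional ℂ E]
  [NormedAddCommGroup F] [NormedSpace ℂ F] [FiniteDimensional ℂ F]

theorem ker_eq_of_finrank (W : Submodule ℂ E) (L : E →L[ℂ] F) (hL : Function.Surjective L)
    (hW : ∀ w ∈ W, L w = 0)
    (hd : Module.finrank ℂ W + Module.finrank ℂ F = Module.finrank ℂ E) :
    W = LinearMap.ker (L : E →ₗ[ℂ] F) := by
  refine Submodule.eq_of_le_of_finrank_eq (fun w hw => hW w hw) ?_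
  have h1 := LinearMap.finrank_range_add_finrank_ker (L : E →ₗ[ℂ] F)
  rw [LinearMap.range_eq_top.2 hL, finrank_top] at h1
  omega

/-- A surjection `E → F` which kills a subspace `W` of the right dimension identifies `E ⧸ W`
with `F`. -/
def quotEquiv (W : Submodule ℂ E) [IsClosed (W : Set E)] (L : E →L[ℂ] F)
    (hL : Function.Surjective L) (hW : ∀ w ∈ W, L w = 0)
    (hd : Module.finrank ℂ W + Module.finrank ℂ F = Module.finrank ℂ E) : (E ⧸ W) ≃L[ℂ] F :=
  (LinearEquiv.ofBijective (W.liftQ (L : E →ₗ[ℂ] F) hW)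
    ⟨by
      rw [← LinearMap.ker_eq_bot]
      exact W.ker_liftQ_eq_bot _ _ (ker_eq_of_finrank W L hL hW hd).ge,
    fun y => by
      obtain ⟨e, he⟩ := hL y
      exact ⟨Submodule.Quotient.mk e, he⟩⟩).toContinuousLinearEquiv

/-- A family of linear maps on `E ⧸ W` is holomorphic if its composition with `E → E ⧸ W` is. -/
theorem contMDiffAt_of_comp_mkQL {EX X : Type*} [NormedAddCommGroup EX] [NormedSpace ℂ EX]
    [TopologicalSpace X] [ChartedSpace EX X] (W : Submodule ℂ E) [IsClosed (W : Set E)]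
    (T : X → (E ⧸ W) →L[ℂ] F) {x : X}
    (h : ContMDiffAt 𝓘(ℂ, EX) 𝓘(ℂ, E →L[ℂ] F) ω (fun y => (T y).comp W.mkQL) x) :
    ContMDiffAt 𝓘(ℂ, EX) 𝓘(ℂ, (E ⧸ W) →L[ℂ] F) ω T x := by
  obtain ⟨s, hs⟩ := LinearMap.exists_rightInverse_of_surjective W.mkQ W.range_mkQ
  let s' : (E ⧸ W) →L[ℂ] E := LinearMap.toContinuousLinearMap s
  have h1 : T = fun y => ((T y).comp W.mkQL).comp s' := by
    funext y
    ext z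
    exact congrArg (T y) (DFunLike.congr_fun hs z).symm
  rw [h1]
  exact h.clm_comp contMDiffAt_const

/-- Pointwise inversion of a holomorphic family of linear maps is holomorphic at a parameter where
the map is invertible. -/
theorem contMDiffAt_clm_inverse {EX X : Type*} [NormedAddCommGroup EX] [NormedSpace ℂ EX]
    [TopologicalSpace X] [ChartedSpace EX X] {T : X → E →L[ℂ] F} {x : X}
    (h : ContMDiffAt 𝓘(ℂ, EX) 𝓘(ℂ, E →L[ℂ] F) ω T x) (hx : (T x).IsInvertible) :
    ContMDiffAt 𝓘(ℂ, EX) 𝓘(ℂ, F →L[ℂ] E) ω (fun y => (T y).inverse) x := by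
  have : CompleteSpace E := FiniteDimensional.complete ℂ E
  exact (hx.contDiffAt_map_inverse (n := ω)).contMDiffAt.comp x h

end LinearAlgebra

/-! ### Local sections and submersions -/

/-- A map with a local holomorphic section through `x` is a submersion at `x`. -/
theorem surjective_mfderiv_of_section {E F M N : Type*}
    [NormedAddCommGroup E] [NormedSpace ℂ E] [NormedAddCommGroup F] [NormedSpace ℂ F]
    {HM HN : Type*} [TopologicalSpace HM] [TopologicalSpace HN]
    {I : ModelWithCorners ℂ E HM} {J : ModelWithCorners ℂ F HN}
    [TopologicalSpace M] [ChartedSpace HM M] [TopologicalSpace N] [ChartedSpace HN N]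
    {f : M → N} {s : N → M} {x : M} (hf : MDifferentiableAt I J f x)
    (hs : MDifferentiableAt J I s (f x)) (hsx : s (f x) = x) (h : ∀ᶠ y in 𝓝 (f x), f (s y) = y) :
    Function.Surjective (mfderiv I J f x) := by
  have h1 : HasMFDerivAt I J f (s (f x)) (mfderiv I J f x : E →L[ℂ] F) := by
    rw [hsx]; exact hf.hasMFDerivAt
  have h2 := h1.comp (f x) hs.hasMFDerivAt
  have h3 : HasMFDerivAt J J (f ∘ s) (f x) (ContinuousLinearMap.id ℂ F) :=
    (hasMFDerivAt_id (I := J) (f x)).congr_of_eventuallyEq h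
  have h4 := hasMFDerivAt_unique h2 h3
  exact fun v => ⟨_, DFunLike.congr_fun h4 v⟩

section Translate
variable {EQ EX EH Q X H : Type*}
  [NormedAddCommGroup EQ] [NormedSpace ℂ EQ] [NormedAddCommGroup EX] [NormedSpace ℂ EX]
  [NormedAddCommGroup EH] [NormedSpace ℂ EH]
  [TopologicalSpace Q] [ChartedSpace EQ Q] [TopologicalSpace X] [ChartedSpace EX X]
  [TopologicalSpace H] [ChartedSpace EH H] [Group H] [LieGroup 𝓘(ℂ, EH) ω H]
  (B : PrincipalBundle EQ EX EH Q X H)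

/-- The local trivialization whose section is translated by `h`. -/
def LocalTriv.translate (t : LocalTriv EQ EX EH B.proj B.act) (h : H) :
    LocalTriv EQ EX EH B.proj B.act where
  base := t.base
  sec x := B.act (t.sec x) h
  coord q := h⁻¹ * t.coord q
  isOpen_base := t.isOpen_base
  contMDiffOn_sec := B.contMDiff_act.comp_contMDiffOn (f := fun x => (t.sec x, h))
    (t.contMDiffOn_sec.prodMk contMDiffOn_const)
  contMDiffOn_coord := contMDiffOn_const.mul t.contMDiffOn_coord
  proj_sec x hx := by rw [B.proj_act, t.proj_sec x hx]
  coord_sec x hx := by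
    rw [t.coord_act _ _ (by rw [t.proj_sec x hx]; exact hx), t.coord_sec x hx]; simp
  coord_act q m hq := by rw [t.coord_act q m hq, mul_assoc]
  act_coord q hq := by rw [← B.act_mul, mul_inv_cancel_left, t.act_coord q hq]

/-- Every point `q` of a principal bundle lies on a local holomorphic section. -/
theorem exists_localTriv_sec (q : Q) :
    ∃ t : LocalTriv EQ EX EH B.proj B.act, B.proj q ∈ t.base ∧ t.sec (B.proj q) = q := by
  obtain ⟨t, ht⟩ := B.exists_localTriv (B.proj q)
  exact ⟨t.translate B (t.coord q), ht, t.act_coord q ht⟩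

theorem surjective_mfderiv_proj (q : Q) :
    Function.Surjective (mfderiv 𝓘(ℂ, EQ) 𝓘(ℂ, EX) B.proj q) := by
  obtain ⟨t, ht, hq⟩ := exists_localTriv_sec B q
  have ho := t.isOpen_base.mem_nhds ht
  refine surjective_mfderiv_of_section (B.contMDiff_proj.mdifferentiableAt (by simp))
    ((t.contMDiffOn_sec.contMDiffAt ho).mdifferentiableAt (by simp)) hq ?_
  filter_upwards [ho] with x hx using t.proj_sec x hx

variable {EF F : Type*} [NormedAddCommGroup EF] [NormedSpace ℂ EF]
  [TopologicalSpace F] [ChartedSpace EF F] [IsManifold 𝓘(ℂ, EX) ω X] [IsManifold 𝓘(ℂ, EF) ω F]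
  (ρ : H →* Equiv.Perm F) [HolAction EH EF ρ]

/-- The quotient map `Q × F → Q ×^H F` is a submersion: if `t` is a local trivialization whose section
passes through `q`, then `z ↦ (sec (π z), fibre coordinate of z)` is a section through `(q, f)`. -/
theorem surjective_mfderiv_assocMk (q : Q) (f : F) :
    Function.Surjective (mfderiv (𝓘(ℂ, EQ).prod 𝓘(ℂ, EF)) 𝓘(ℂ, EX × EF)
      (fun p : Q × F => Assoc.mk B ρ p.1 p.2) (q, f)) := by
  obtain ⟨t, ht, hq⟩ := exists_localTriv_sec B q
  have ho : Assoc.proj B ρ ⁻¹' t.base ∈ 𝓝 (Assoc.mk B ρ q f) :=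
    (Assoc.triv (EF := EF) B ρ t).open_source.mem_nhds ht
  have hc : t.coord q = 1 := by rw [← hq]; exact t.coord_sec _ ht
  refine surjective_mfderiv_of_section
    (s := fun z => (t.sec (Assoc.proj B ρ z), Assoc.fibreCoord B ρ t z))
    ((Assoc.contMDiff_mk (EF := EF) B ρ).mdifferentiableAt (by simp)) ?_ ?_ ?_
  · refine ContMDiffAt.mdifferentiableAt (n := ω) (ContMDiffAt.prodMk ?_ ?_) (by simp)
    · exact (t.contMDiffOn_sec.comp (Assoc.contMDiff_proj (EF := EF) B ρ).contMDiffOn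
        fun z hz => hz).contMDiffAt ho
    · exact (contMDiff_snd.comp_contMDiffOn (Assoc.contMDiffOn_triv (EF := EF) B ρ t)).contMDiffAt
        ho
  · refine Prod.ext hq ?_
    rw [Assoc.fibreCoord_mk B ρ t q f ht, hc]; simp
  · filter_upwards [ho] with z hz using (Assoc.triv (EF := EF) B ρ t).left_inv hz

end Translate

/-! ### Evaluation of elements of the Atiyah fibre -/

section AtiyahEval
variable {EP EX EM P X M : Type*}
  [NormedAddCommGroup EP] [NormedSpace ℂ EP] [NormedAddCommGroup EX] [NormedSpace ℂ EX]
  [NormedAddCommGroup EM] [NormedSpace ℂ EM]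
  [TopologicalSpace P] [ChartedSpace EP P]
  [TopologicalSpace X] [ChartedSpace EX X] [IsManifold 𝓘(ℂ, EX) ω X]
  [TopologicalSpace M] [ChartedSpace EM M] [Group M]
  (B : PrincipalBundle EP EX EM P X M)

/-- Invariance of an element of the Atiyah fibre, with the translated point given up to equality. -/
theorem AtiyahFibre.eval_act {x : X} (v : AtiyahFibre B x) (p : P) (hp : B.proj p = x) (m : M)
    (p' : P) (h : B.act p m = p') (hp' : B.proj p' = x) :
    (v.eval B p' hp' : EP) =
      (mfderiv 𝓘(ℂ, EP) 𝓘(ℂ, EP) (fun q => B.act q m) p : EP →L[ℂ] EP) (v.eval B p hp : EP) := by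
  subst h
  exact v.2 ⟨p, hp⟩ m

variable [IsManifold 𝓘(ℂ, EP) ω P] [LieGroup 𝓘(ℂ, EM) ω M]

theorem exists_evalEquiv {x : X} (p : P) (hp : B.proj p = x) :
    ∃ e : AtiyahFibre B x ≃L[ℂ] EP, ∀ v, e v = (v.eval B p hp : EP) := by
  subst hp
  -- `atiyahEquiv` evaluates at the point of a local section, so take one through `p`
  obtain ⟨t, ht, hq⟩ := exists_localTriv_sec B p
  refine ⟨atiyahEquiv B t (B.proj p) ht, fun v => ?_⟩
  have h2 : ∀ (p' : P) (hp' : B.proj p' = B.proj p), p' = p →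
      (v.eval B p' hp' : EP) = (v.eval B p rfl : EP) := by
    rintro _ _ rfl; rfl
  exact h2 _ (t.proj_sec _ ht) hq

/-- Evaluation at a point `p` of `P_x` identifies the Atiyah fibre at `x` with `T_p P`. -/
def evalEquiv {x : X} (p : P) (hp : B.proj p = x) : AtiyahFibre B x ≃L[ℂ] EP :=
  (exists_evalEquiv B p hp).choose

theorem evalEquiv_apply {x : X} (p : P) (hp : B.proj p = x) (v : AtiyahFibre B x) :
    evalEquiv B p hp v = (v.eval B p hp : EP) :=
  (exists_evalEquiv B p hp).choose_spec v

/-- The anchor `dπ` of an element of the Atiyah fibre does not depend on the point at which the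
element is evaluated. -/
theorem mfderiv_proj_eval {x : X} (v : AtiyahFibre B x) (p : P) (hp : B.proj p = x) (m : M)
    (p' : P) (h : B.act p m = p') (hp' : B.proj p' = x) :
    (mfderiv 𝓘(ℂ, EP) 𝓘(ℂ, EX) B.proj p' : EP →L[ℂ] EX) (v.eval B p' hp' : EP) =
      (mfderiv 𝓘(ℂ, EP) 𝓘(ℂ, EX) B.proj p : EP →L[ℂ] EX) (v.eval B p hp : EP) := by
  rw [v.eval_act B p hp m p' h hp']
  subst h
  have h1 : HasMFDerivAt 𝓘(ℂ, EP) 𝓘(ℂ, EX) B.proj (B.act p m)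
      (mfderiv 𝓘(ℂ, EP) 𝓘(ℂ, EX) B.proj (B.act p m)) :=
    (B.contMDiff_proj.mdifferentiableAt (by simp)).hasMFDerivAt
  have h2 := HasMFDerivAt.comp p h1 (mdifferentiable_actRight B m p).hasMFDerivAt
  have h3 : (B.proj ∘ fun q => B.act q m) = B.proj := funext fun q => B.proj_act q m
  rw [h3] at h2
  have h4 : HasMFDerivAt 𝓘(ℂ, EP) 𝓘(ℂ, EX) B.proj p (mfderiv 𝓘(ℂ, EP) 𝓘(ℂ, EX) B.proj p) :=
    (B.contMDiff_proj.mdifferentiableAt (by simp)).hasMFDerivAt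
  exact DFunLike.congr_fun (hasMFDerivAt_unique h2 h4) (v.eval B p hp)

end AtiyahEval

/-! ### The Lie algebra models of `T_x X` and `(At P)_x` -/

section TangentModels
variable {G M : Type*} (EG EH : Type*) {EM : Type*}
  [NormedAddCommGroup EG] [NormedSpace ℂ EG] [FiniteDimensional ℂ EG]
  [NormedAddCommGroup EH] [NormedSpace ℂ EH] [FiniteDimensional ℂ EH]
  [NormedAddCommGroup EM] [NormedSpace ℂ EM] [FiniteDimensional ℂ EM]
  [TopologicalSpace G] [ChartedSpace EG G] [Group G] [LieGroup 𝓘(ℂ, EG) ω G]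
  [TopologicalSpace M] [ChartedSpace EM M] [Group M] [LieGroup 𝓘(ℂ, EM) ω M]
  (H : Subgroup G) [ChartedSpace EH H] [LieGroup 𝓘(ℂ, EH) ω H] [IsClosedLieSubgroup EG EH H]

theorem finrank_lieSub : Module.finrank ℂ (lieSub EG EH H) = Module.finrank ℂ EH :=
  LinearMap.finrank_range_of_inj (IsClosedLieSubgroup.injective_mfderiv (EG := EG) (1 : H))

theorem finrank_lieSub_add_sliceModel :
    Module.finrank ℂ (lieSub EG EH H) + Module.finrank ℂ (sliceModel EG EH H) =
      Module.finrank ℂ EG :=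
  Submodule.finrank_add_eq_of_isCompl
    (Classical.choose_spec (lieSub EG EH H).exists_isCompl)

theorem hasMFDerivAt_val : HasMFDerivAt 𝓘(ℂ, EH) 𝓘(ℂ, EG) (Subtype.val : H → G) 1
    (dIncl EG EH H) :=
  ((IsClosedLieSubgroup.contMDiff_val (EG := EG) (EH := EH) (H := H)).mdifferentiableAt
    (by simp)).hasMFDerivAt

/-- The differential at `1` of `a ↦ g a H`, a map `𝔤 → T_{gH} (G ⧸ H)`. -/
def baseMap (g : G) : EG →L[ℂ] sliceModel EG EH H :=
  mfderiv 𝓘(ℂ, EG) 𝓘(ℂ, sliceModel EG EH H) (fun a : G => ((g * a : G) : G ⧸ H)) 1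

theorem contMDiff_mulLeft (g : G) : ContMDiff 𝓘(ℂ, EG) 𝓘(ℂ, EG) ω fun a : G => g * a :=
  contMDiff_const.mul contMDiff_id

theorem hasMFDerivAt_baseMap (g : G) : HasMFDerivAt 𝓘(ℂ, EG) 𝓘(ℂ, sliceModel EG EH H)
    (fun a : G => ((g * a : G) : G ⧸ H)) 1 (baseMap EG EH H g) :=
  (((contMDiff_cosetMk EG EH H).comp (contMDiff_mulLeft EG g)).mdifferentiableAt
    (by simp)).hasMFDerivAt

theorem baseMap_apply (g : G) (ξ : EG) :
    baseMap EG EH H g ξ = (mfderiv 𝓘(ℂ, EG) 𝓘(ℂ, sliceModel EG EH H)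
      (QuotientGroup.mk : G → G ⧸ H) g : EG →L[ℂ] sliceModel EG EH H)
        (mfderiv 𝓘(ℂ, EG) 𝓘(ℂ, EG) (fun a : G => g * a) 1 ξ : EG) := by
  have h1 : HasMFDerivAt 𝓘(ℂ, EG) 𝓘(ℂ, sliceModel EG EH H) (QuotientGroup.mk : G → G ⧸ H) (g * 1)
      (mfderiv 𝓘(ℂ, EG) 𝓘(ℂ, sliceModel EG EH H)
      (QuotientGroup.mk : G → G ⧸ H) g : EG →L[ℂ] sliceModel EG EH H) := by
    rw [mul_one]
    exact ((contMDiff_cosetMk EG EH H).mdifferentiableAt (by simp)).hasMFDerivAt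
  have h2 := HasMFDerivAt.comp (1 : G) h1
    ((contMDiff_mulLeft EG g).mdifferentiableAt (by simp)).hasMFDerivAt
  exact DFunLike.congr_fun (hasMFDerivAt_unique (hasMFDerivAt_baseMap EG EH H g) h2) ξ

/-- Equivariance of `𝔤 → T_{gH} (G ⧸ H)`, from `g h a H = g (h a h⁻¹) H`. -/
theorem baseMap_mul (g : G) (h : H) :
    baseMap EG EH H (g * h) = (baseMap EG EH H g).comp (Ad EG (h : G)) := by
  have h1 : HasMFDerivAt 𝓘(ℂ, EG) 𝓘(ℂ, sliceModel EG EH H)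
      (fun a : G => ((g * a : G) : G ⧸ H)) ((h : G) * 1 * (h : G)⁻¹) (baseMap EG EH H g) := by
    rw [show (h : G) * 1 * (h : G)⁻¹ = 1 by simp]; exact hasMFDerivAt_baseMap EG EH H g
  have h2 := HasMFDerivAt.comp (1 : G) h1 (hasMFDerivAt_conj EG (h : G))
  have h3 : (fun a : G => ((g * a : G) : G ⧸ H)) ∘ (fun a : G => (h : G) * a * (h : G)⁻¹) =
      fun a : G => ((g * h * a : G) : G ⧸ H) := by
    funext a
    refine QuotientGroup.eq.2 ?_
    rw [show (g * ((h : G) * a * (h : G)⁻¹))⁻¹ * (g * h * a) = (h : G) by group]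
    exact h.2
  rw [h3] at h2
  exact hasMFDerivAt_unique (hasMFDerivAt_baseMap EG EH H (g * h)) h2

theorem baseMap_lieSub (g : G) : ∀ w ∈ lieSub EG EH H, baseMap EG EH H g w = 0 := by
  rintro _ ⟨v, rfl⟩
  have h1 := HasMFDerivAt.comp (1 : H) (hasMFDerivAt_baseMap EG EH H g) (hasMFDerivAt_val EG EH H)
  have h3 : (fun a : G => ((g * a : G) : G ⧸ H)) ∘ (Subtype.val : H → G) =
      fun _ => (g : G ⧸ H) := by
    funext a
    exact QuotientGroup.eq.2 (by simp)
  rw [h3] at h1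
  exact DFunLike.congr_fun (hasMFDerivAt_unique h1 (hasMFDerivAt_const _ _)) v

theorem surjective_mfderiv_mulLeft (g : G) :
    Function.Surjective (mfderiv 𝓘(ℂ, EG) 𝓘(ℂ, EG) (fun a : G => g * a) 1) :=
  surjective_mfderiv_of_section (s := fun a => g⁻¹ * a)
    ((contMDiff_mulLeft EG g).mdifferentiableAt (by simp))
    ((contMDiff_mulLeft EG g⁻¹).mdifferentiableAt (by simp)) (by simp)
    (Filter.Eventually.of_forall fun a => by simp)

theorem surjective_baseMap (g : G) : Function.Surjective (baseMap EG EH H g) := by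
  intro v
  obtain ⟨w, hw⟩ := surjective_mfderiv_proj (homogBundle EG EH H) g v
  obtain ⟨ξ, hξ⟩ := surjective_mfderiv_mulLeft EG g (w : EG)
  refine ⟨ξ, (baseMap_apply EG EH H g ξ).trans ?_⟩
  refine Eq.trans (congrArg _ hξ) hw

/-- The identification `𝔤/𝔥 ≅ T_{gH} (G ⧸ H)`. -/
def baseEquiv (g : G) : (EG ⧸ lieSub EG EH H) ≃L[ℂ] sliceModel EG EH H :=
  quotEquiv _ (baseMap EG EH H g) (surjective_baseMap EG EH H g) (baseMap_lieSub EG EH H g)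
    (finrank_lieSub_add_sliceModel EG EH H)

theorem baseEquiv_mul (g : G) (h : H) (x : EG ⧸ lieSub EG EH H) :
    baseEquiv EG EH H (g * h) x = baseEquiv EG EH H g (baseAd EG EH h x) := by
  induction x using Submodule.Quotient.induction_on with
  | _ e => exact DFunLike.congr_fun (baseMap_mul EG EH H g h) e

variable {H} (τ : ContMDiffMonoidMorphism 𝓘(ℂ, EH) 𝓘(ℂ, EM) ω H M)

theorem extMk_mul (g : G) (h : H) (m : M) :
    extMk EG EH τ (g * h) m = extMk EG EH τ g (τ.toMonoidHom h * m) :=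
  Assoc.mk_act (homogBundle EG EH H) (leftMulHom τ) g h m

theorem act_extMk (g : G) (m m' : M) :
    (homogExtension EG EH τ).act (extMk EG EH τ g m) m' = extMk EG EH τ g (m * m') := rfl

theorem proj_extMk (g : G) (m : M) :
    (homogExtension EG EH τ).proj (extMk EG EH τ g m) = (g : G ⧸ H) := rfl

theorem contMDiff_extMk : ContMDiff (𝓘(ℂ, EG).prod 𝓘(ℂ, EM)) 𝓘(ℂ, sliceModel EG EH H × EM) ω
    (fun p : G × M => extMk EG EH τ p.1 p.2) :=
  Assoc.contMDiff_mk (EF := EM) (homogBundle EG EH H) (leftMulHom τ)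

theorem finrank_twistedSub : Module.finrank ℂ (twistedSub EG EH τ) = Module.finrank ℂ EH := by
  refine LinearMap.finrank_range_of_inj fun v w hvw => ?_
  exact IsClosedLieSubgroup.injective_mfderiv (EG := EG) (1 : H) (congrArg Prod.fst hvw)

theorem finrank_twistedSub_add :
    Module.finrank ℂ (twistedSub EG EH τ) + Module.finrank ℂ (sliceModel EG EH H × EM) =
      Module.finrank ℂ (EG × EM) := by
  rw [finrank_twistedSub, Module.finrank_prod, Module.finrank_prod,
    ← finrank_lieSub_add_sliceModel EG EH H, finrank_lieSub, add_assoc]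

/-- The differential at `(1, 1)` of `(a, m) ↦ [g a, m]`, a map `𝔤 ⊕ 𝔪 → T_{[g, 1]} P`. -/
def totMap (g : G) : EG × EM →L[ℂ] sliceModel EG EH H × EM :=
  mfderiv (𝓘(ℂ, EG).prod 𝓘(ℂ, EM)) 𝓘(ℂ, sliceModel EG EH H × EM)
    (fun p : G × M => extMk EG EH τ (g * p.1) p.2) (1, 1)

theorem contMDiff_extMk_mul (g : G) :
    ContMDiff (𝓘(ℂ, EG).prod 𝓘(ℂ, EM)) 𝓘(ℂ, sliceModel EG EH H × EM) ω
      (fun p : G × M => extMk EG EH τ (g * p.1) p.2) :=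
  (contMDiff_extMk EG EH τ).comp
    (((contMDiff_mulLeft EG g).comp contMDiff_fst).prodMk contMDiff_snd)

theorem hasMFDerivAt_totMap (g : G) :
    HasMFDerivAt (𝓘(ℂ, EG).prod 𝓘(ℂ, EM)) 𝓘(ℂ, sliceModel EG EH H × EM)
      (fun p : G × M => extMk EG EH τ (g * p.1) p.2) (1, 1) (totMap EG EH τ g) :=
  ((contMDiff_extMk_mul EG EH τ g).mdifferentiableAt (by simp)).hasMFDerivAt

theorem totMap_apply (g : G) (ξ : EG) (η : EM) :
    totMap EG EH τ g (ξ, η) =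
      (mfderiv (𝓘(ℂ, EG).prod 𝓘(ℂ, EM)) 𝓘(ℂ, sliceModel EG EH H × EM)
        (fun p : G × M => extMk EG EH τ p.1 p.2) (g, 1) :
          EG × EM →L[ℂ] sliceModel EG EH H × EM)
        ((mfderiv 𝓘(ℂ, EG) 𝓘(ℂ, EG) (fun a : G => g * a) 1 ξ : EG), η) := by
  have h1 : HasMFDerivAt (𝓘(ℂ, EG).prod 𝓘(ℂ, EM)) 𝓘(ℂ, sliceModel EG EH H × EM)
      (fun p : G × M => extMk EG EH τ p.1 p.2) (g * 1, 1)
      (mfderiv (𝓘(ℂ, EG).prod 𝓘(ℂ, EM)) 𝓘(ℂ, sliceModel EG EH H × EM)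
        (fun p : G × M => extMk EG EH τ p.1 p.2) (g, 1) :
          EG × EM →L[ℂ] sliceModel EG EH H × EM) := by
    rw [mul_one]
    exact ((contMDiff_extMk EG EH τ).mdifferentiableAt (by simp)).hasMFDerivAt
  have h2 : HasMFDerivAt 𝓘(ℂ, EG) 𝓘(ℂ, EG) (fun a : G => g * a) 1
      (mfderiv 𝓘(ℂ, EG) 𝓘(ℂ, EG) (fun a : G => g * a) 1) :=
    ((contMDiff_mulLeft EG g).mdifferentiableAt (by simp)).hasMFDerivAt
  have h3 : HasMFDerivAt (𝓘(ℂ, EG).prod 𝓘(ℂ, EM)) (𝓘(ℂ, EG).prod 𝓘(ℂ, EM))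
      (fun p : G × M => (g * p.1, p.2)) (1, 1) _ :=
    (h2.comp ((1 : G), (1 : M)) (hasMFDerivAt_fst ((1 : G), (1 : M)))).prodMk
      (hasMFDerivAt_snd ((1 : G), (1 : M)))
  have h4 := HasMFDerivAt.comp ((1 : G), (1 : M)) h1 h3
  exact DFunLike.congr_fun (hasMFDerivAt_unique (hasMFDerivAt_totMap EG EH τ g) h4) (ξ, η)

theorem surjective_totMap (g : G) : Function.Surjective (totMap EG EH τ g) := by
  intro v
  obtain ⟨w, hw⟩ := surjective_mfderiv_assocMk (EF := EM) (homogBundle EG EH H) (leftMulHom τ) g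
    (1 : M) v
  obtain ⟨ξ, hξ⟩ := surjective_mfderiv_mulLeft EG g ((show EG × EM from w).1)
  refine ⟨(ξ, (show EG × EM from w).2), (totMap_apply EG EH τ g _ _).trans ?_⟩
  refine Eq.trans (congrArg _ (Prod.ext hξ rfl)) hw

/-- The kernel of `𝔤 ⊕ 𝔪 → T_{[g, 1]} P` contains the twisted copy of `𝔥`: differentiate
`[g h, 1] = [g, τ h]` at `h = 1`. -/
theorem totMap_twistedSub (g : G) : ∀ w ∈ twistedSub EG EH τ, totMap EG EH τ g w = 0 := by
  rintro _ ⟨v, rfl⟩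
  have h0 : HasMFDerivAt 𝓘(ℂ, EH) 𝓘(ℂ, EM) τ.toMonoidHom 1
      (mfderiv 𝓘(ℂ, EH) 𝓘(ℂ, EM) τ.toMonoidHom 1 : EH →L[ℂ] EM) :=
    (τ.contMDiff_toFun.mdifferentiableAt (by simp)).hasMFDerivAt
  have hG : HasMFDerivAt 𝓘(ℂ, EH) (𝓘(ℂ, EG).prod 𝓘(ℂ, EM))
      (fun h : H => ((h : G), (1 : M))) 1 ((dIncl EG EH H).prod (0 : EH →L[ℂ] EM)) :=
    (hasMFDerivAt_val EG EH H).prodMk (hasMFDerivAt_const (1 : M) (1 : H))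
  have hM : HasMFDerivAt 𝓘(ℂ, EH) (𝓘(ℂ, EG).prod 𝓘(ℂ, EM))
      (fun h : H => ((1 : G), τ.toMonoidHom h)) 1
      ((0 : EH →L[ℂ] EG).prod (mfderiv 𝓘(ℂ, EH) 𝓘(ℂ, EM) τ.toMonoidHom 1 : EH →L[ℂ] EM)) :=
    (hasMFDerivAt_const (1 : G) (1 : H)).prodMk h0
  have h1 := HasMFDerivAt.comp (1 : H) (hasMFDerivAt_totMap EG EH τ g) hG
  have h2' : HasMFDerivAt (𝓘(ℂ, EG).prod 𝓘(ℂ, EM)) 𝓘(ℂ, sliceModel EG EH H × EM)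
      (fun p : G × M => extMk EG EH τ (g * p.1) p.2) ((1 : G), τ.toMonoidHom (1 : H))
      (totMap EG EH τ g) := by
    rw [map_one]; exact hasMFDerivAt_totMap EG EH τ g
  have h2 := HasMFDerivAt.comp (1 : H) h2' hM
  -- both compositions are the map `h ↦ [g h, 1] = [g, τ h]`
  have h3 : (fun p : G × M => extMk EG EH τ (g * p.1) p.2) ∘ (fun h : H => ((h : G), (1 : M))) =
      (fun p : G × M => extMk EG EH τ (g * p.1) p.2) ∘
        fun h : H => ((1 : G), τ.toMonoidHom h) := by
    funext h
    change extMk EG EH τ (g * h) 1 = extMk EG EH τ (g * 1) (τ.toMonoidHom h)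
    rw [extMk_mul, mul_one, mul_one]
  rw [h3] at h1
  have h4 : totMap EG EH τ g (dIncl EG EH H v, 0) = totMap EG EH τ g
      (0, (mfderiv 𝓘(ℂ, EH) 𝓘(ℂ, EM) τ.toMonoidHom 1 : EH →L[ℂ] EM) v) :=
    DFunLike.congr_fun (hasMFDerivAt_unique h1 h2) v
  rw [← sub_eq_zero, ← map_sub] at h4
  exact (congrArg (totMap EG EH τ g) (Prod.ext (sub_zero _).symm (zero_sub _).symm)).trans h4

/-- Equivariance of `𝔤 ⊕ 𝔪 → T_{[g, 1]} P`, from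
`[g h a, m] = [g (h a h⁻¹), τ(h) m τ(h)⁻¹] τ(h)`. The right translation by `τ h` disappears in `At P`. -/
theorem totMap_mul (g : G) (h : H) (w : EG × EM) :
    totMap EG EH τ (g * h) w =
      (mfderiv 𝓘(ℂ, sliceModel EG EH H × EM) 𝓘(ℂ, sliceModel EG EH H × EM)
        (fun q => (homogExtension EG EH τ).act q (τ.toMonoidHom h)) (extMk EG EH τ g 1) :
          sliceModel EG EH H × EM →L[ℂ] sliceModel EG EH H × EM)
        (totMap EG EH τ g (twistedAd EG EH τ h w)) := by
  have h1 : HasMFDerivAt (𝓘(ℂ, EG).prod 𝓘(ℂ, EM)) (𝓘(ℂ, EG).prod 𝓘(ℂ, EM))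
      (fun p : G × M => ((h : G) * p.1 * (h : G)⁻¹,
        τ.toMonoidHom h * p.2 * (τ.toMonoidHom h)⁻¹)) (1, 1)
      (twistedAd EG EH τ h) :=
    ((hasMFDerivAt_conj EG (h : G)).comp ((1 : G), (1 : M))
      (hasMFDerivAt_fst ((1 : G), (1 : M)))).prodMk
      ((hasMFDerivAt_conj EM (τ.toMonoidHom h)).comp ((1 : G), (1 : M))
        (hasMFDerivAt_snd ((1 : G), (1 : M))))
  have e1 : ((h : G) * 1 * (h : G)⁻¹, τ.toMonoidHom h * 1 * (τ.toMonoidHom h)⁻¹) =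
    ((1 : G), (1 : M)) := by simp
  have h2 : HasMFDerivAt (𝓘(ℂ, EG).prod 𝓘(ℂ, EM)) 𝓘(ℂ, sliceModel EG EH H × EM)
      (fun p : G × M => extMk EG EH τ (g * p.1) p.2)
      ((h : G) * 1 * (h : G)⁻¹, τ.toMonoidHom h * 1 * (τ.toMonoidHom h)⁻¹)
      (totMap EG EH τ g) := by
    rw [e1]; exact hasMFDerivAt_totMap EG EH τ g
  have h3 := HasMFDerivAt.comp ((1 : G), (1 : M)) h2 h1
  have h4 : HasMFDerivAt 𝓘(ℂ, sliceModel EG EH H × EM) 𝓘(ℂ, sliceModel EG EH H × EM)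
        (fun q => (homogExtension EG EH τ).act q (τ.toMonoidHom h))
        (extMk EG EH τ (g * ((h : G) * 1 * (h : G)⁻¹))
          (τ.toMonoidHom h * 1 * (τ.toMonoidHom h)⁻¹))
        (mfderiv 𝓘(ℂ, sliceModel EG EH H × EM) 𝓘(ℂ, sliceModel EG EH H × EM)
        (fun q => (homogExtension EG EH τ).act q (τ.toMonoidHom h)) (extMk EG EH τ g 1) :
          sliceModel EG EH H × EM →L[ℂ] sliceModel EG EH H × EM) := by
    rw [show g * ((h : G) * 1 * (h : G)⁻¹) = g by simp,
      show τ.toMonoidHom h * 1 * (τ.toMonoidHom h)⁻¹ = 1 by simp]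
    exact (mdifferentiable_actRight _ _ _).hasMFDerivAt
  have h5 := HasMFDerivAt.comp ((1 : G), (1 : M)) h4 h3
  have h6 : ((fun q => (homogExtension EG EH τ).act q (τ.toMonoidHom h)) ∘
      (fun p : G × M => extMk EG EH τ (g * p.1) p.2) ∘
      (fun p : G × M => ((h : G) * p.1 * (h : G)⁻¹,
        τ.toMonoidHom h * p.2 * (τ.toMonoidHom h)⁻¹))) =
      fun p : G × M => extMk EG EH τ (g * h * p.1) p.2 := by
    funext p
    change (homogExtension EG EH τ).act (extMk EG EH τ (g * ((h : G) * p.1 * (h : G)⁻¹))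
      (τ.toMonoidHom h * p.2 * (τ.toMonoidHom h)⁻¹)) (τ.toMonoidHom h) = _
    rw [act_extMk, inv_mul_cancel_right, ← extMk_mul]
    congr 1
    group
  rw [h6] at h5
  exact DFunLike.congr_fun (hasMFDerivAt_unique (hasMFDerivAt_totMap EG EH τ (g * h)) h5) w

/-- The anchor of `P` corresponds to the projection `𝔤 ⊕ 𝔪 → 𝔤`. -/
theorem mfderiv_proj_totMap (g : G) (w : EG × EM) :
    (mfderiv 𝓘(ℂ, sliceModel EG EH H × EM) 𝓘(ℂ, sliceModel EG EH H) (homogExtension EG EH τ).proj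
      (extMk EG EH τ g 1) : sliceModel EG EH H × EM →L[ℂ] sliceModel EG EH H)
        (totMap EG EH τ g w) = baseMap EG EH H g w.1 := by
  have h1 : HasMFDerivAt 𝓘(ℂ, sliceModel EG EH H × EM) 𝓘(ℂ, sliceModel EG EH H)
      (homogExtension EG EH τ).proj (extMk EG EH τ (g * 1) 1)
      (mfderiv 𝓘(ℂ, sliceModel EG EH H × EM) 𝓘(ℂ, sliceModel EG EH H)
        (homogExtension EG EH τ).proj
      (extMk EG EH τ g 1) : sliceModel EG EH H × EM →L[ℂ] sliceModel EG EH H) := by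
    rw [mul_one]
    exact ((homogExtension EG EH τ).contMDiff_proj.mdifferentiableAt (by simp)).hasMFDerivAt
  have h2 := HasMFDerivAt.comp ((1 : G), (1 : M)) h1 (hasMFDerivAt_totMap EG EH τ g)
  have h3 := HasMFDerivAt.comp ((1 : G), (1 : M)) (hasMFDerivAt_baseMap EG EH H g)
    (hasMFDerivAt_fst (I := 𝓘(ℂ, EG)) (I' := 𝓘(ℂ, EM)) ((1 : G), (1 : M)))
  exact DFunLike.congr_fun (hasMFDerivAt_unique h2 h3) w

/-- The identification `(𝔤 ⊕ 𝔪)/𝔥 ≅ T_{[g, 1]} P`. -/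
def totEquiv (g : G) : ((EG × EM) ⧸ twistedSub EG EH τ) ≃L[ℂ] (sliceModel EG EH H × EM) :=
  quotEquiv _ (totMap EG EH τ g) (surjective_totMap EG EH τ g) (totMap_twistedSub EG EH τ g)
    (finrank_twistedSub_add EG EH τ)

/-- The identification `(𝔤 ⊕ 𝔪)/𝔥 ≅ T_{[g, 1]} P ≅ (At P)_x` at `x = g H`. -/
def atEquiv {x : G ⧸ H} (g : G) (hg : (g : G ⧸ H) = x) :
    ((EG × EM) ⧸ twistedSub EG EH τ) ≃L[ℂ] AtiyahFibre (homogExtension EG EH τ) x :=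
  (totEquiv EG EH τ g).trans (evalEquiv (homogExtension EG EH τ) (extMk EG EH τ g 1)
    ((proj_extMk EG EH τ g 1).trans hg)).symm

theorem eval_atEquiv {x : G ⧸ H} (g : G) (hg : (g : G ⧸ H) = x)
    (hp : (homogExtension EG EH τ).proj (extMk EG EH τ g 1) = x)
    (y : (EG × EM) ⧸ twistedSub EG EH τ) :
    ((atEquiv EG EH τ g hg y).eval _ (extMk EG EH τ g 1) hp : sliceModel EG EH H × EM) =
      totEquiv EG EH τ g y := by
  refine (evalEquiv_apply (homogExtension EG EH τ) (extMk EG EH τ g 1) hp _).symm.trans ?_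
  exact (evalEquiv (homogExtension EG EH τ) (extMk EG EH τ g 1) hp).apply_symm_apply
    (totEquiv EG EH τ g y)

/-- The identifications of `(At P)_x` with `(𝔤 ⊕ 𝔪)/𝔥` given by `g` and `g h` differ by the action
of `h`. -/
theorem atEquiv_mul {x : G ⧸ H} (g : G) (hg : (g : G ⧸ H) = x) (h : H)
    (hgh : ((g * h : G) : G ⧸ H) = x) (y : (EG × EM) ⧸ twistedSub EG EH τ) :
    atEquiv EG EH τ (g * h) hgh y = atEquiv EG EH τ g hg (totalAd EG EH τ h y) := by
  induction y using Submodule.Quotient.induction_on with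
  | _ w =>
    refine (evalEquiv (homogExtension EG EH τ) (extMk EG EH τ (g * h) 1)
      ((proj_extMk EG EH τ (g * h) 1).trans hgh)).injective ?_
    rw [evalEquiv_apply, evalEquiv_apply, eval_atEquiv]
    have hp := (proj_extMk EG EH τ g 1).trans hg
    have h1 := AtiyahFibre.eval_act (homogExtension EG EH τ)
      (atEquiv EG EH τ g hg (totalAd EG EH τ h (Submodule.Quotient.mk w))) (extMk EG EH τ g 1)
      hp (τ.toMonoidHom h) (extMk EG EH τ (g * h) 1)
      (by rw [act_extMk, extMk_mul, one_mul, mul_one]) ((proj_extMk EG EH τ (g * h) 1).trans hgh)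
    refine Eq.trans (totMap_mul EG EH τ g h w) (Eq.trans ?_ h1.symm)
    exact congrArg _ (eval_atEquiv EG EH τ g hg hp
      (totalAd EG EH τ h (Submodule.Quotient.mk w))).symm

end TangentModels

/-! ### Derivatives depending on a parameter -/

/-- The differential at a fixed point of a holomorphic family of maps into a normed space depends
holomorphically on the parameter. -/
theorem contMDiffAt_mfderiv_param {EX EN HN F X N : Type*}
    [NormedAddCommGroup EX] [NormedSpace ℂ EX] [NormedAddCommGroup EN] [NormedSpace ℂ EN]
    [NormedAddCommGroup F] [NormedSpace ℂ F] [TopologicalSpace HN]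
    [TopologicalSpace X] [ChartedSpace EX X] {I : ModelWithCorners ℂ EN HN}
    [TopologicalSpace N] [ChartedSpace HN N] [IsManifold 𝓘(ℂ, EX) ω X] [IsManifold I ω N]
    (f : X → N → F) (n : N) {x₀ : X} (T : X → EN →L[ℂ] F)
    (hf : ContMDiffAt (𝓘(ℂ, EX).prod I) 𝓘(ℂ, F) ω (Function.uncurry f) (x₀, n))
    (hT : ∀ᶠ x in 𝓝 x₀, HasMFDerivAt I 𝓘(ℂ, F) (f x) n (T x)) :
    ContMDiffAt 𝓘(ℂ, EX) 𝓘(ℂ, EN →L[ℂ] F) ω T x₀ := by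
  have : IsManifold I 1 N := IsManifold.of_le (n := ω) (by simp)
  have h5 := ContMDiffAt.mfderiv (m := ω) f (fun _ : X => n) hf contMDiffAt_const le_rfl
  refine h5.congr_of_eventuallyEq ?_
  filter_upwards [hT] with x hx
  have h6 := inTangentCoordinates_eq (𝕜 := ℂ) (I := I) (I' := 𝓘(ℂ, F)) (fun _ : X => n)
    (fun x => f x n) (fun x => (mfderiv I 𝓘(ℂ, F) (f x) n : EN →L[ℂ] F))
    (x₀ := x₀) (x := x) (mem_chart_source _ _) (mem_univ _)
  refine Eq.trans ?_ h6.symm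
  ext v
  have h7 : (tangentBundleCore I N).coordChange (achart HN n) (achart HN n) n v = v :=
    (tangentBundleCore I N).coordChange_self _ _ (mem_achart_source _ _) v
  have h8 := tangentBundleCore_coordChange_model_space (I := 𝓘(ℂ, F)) (f x n) (f x₀ n) (f x n)
  have h9 : (mfderiv I 𝓘(ℂ, F) (f x) n : EN →L[ℂ] F)
      ((tangentBundleCore I N).coordChange (achart HN n) (achart HN n) n v) = T x v :=
    (congrArg (mfderiv I 𝓘(ℂ, F) (f x) n : EN →L[ℂ] F) h7).trans (DFunLike.congr_fun hx.mfderiv v)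
  exact ((DFunLike.congr_fun h8 _).trans h9).symm

/-! ### Coordinates on the Atiyah bundle -/

section AtiyahTriv
variable {EP EX EM P X M : Type*}
  [NormedAddCommGroup EP] [NormedSpace ℂ EP] [NormedAddCommGroup EX] [NormedSpace ℂ EX]
  [NormedAddCommGroup EM] [NormedSpace ℂ EM]
  [TopologicalSpace P] [ChartedSpace EP P]
  [TopologicalSpace X] [ChartedSpace EX X] [IsManifold 𝓘(ℂ, EX) ω X]
  [TopologicalSpace M] [ChartedSpace EM M] [Group M]
  (B : PrincipalBundle EP EX EM P X M) [IsManifold 𝓘(ℂ, EP) ω P] [LieGroup 𝓘(ℂ, EM) ω M]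

theorem continuousLinearMapAt_atiyah (x₀ x : X) (hx : x ∈ atiyahBase B x₀) (v : AtiyahFibre B x) :
    (trivializationAt EP (AtiyahFibre B) x₀).continuousLinearMapAt ℂ x v =
      atiyahTrivEquiv B x₀ x hx v := by
  rw [Trivialization.continuousLinearMapAt_apply,
    Trivialization.coe_linearMapAt_of_mem _ (show x ∈ _ from hx)]
  exact congrArg Prod.snd (atiyahPretriv_apply B x₀ x hx v)

/-- The coordinates of an element of the Atiyah fibre are read off from its value at any point `p`
of the fibre of `P`, translated to the point `sec x`. -/
theorem atiyahTrivEquiv_eq (x₀ x : X) (hx : x ∈ atiyahBase B x₀) (v : AtiyahFibre B x)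
    (p : P) (hp : B.proj p = x) (m : M) (hm : B.act p m = (Assoc.trivAt B x₀).sec x) :
    atiyahTrivEquiv B x₀ x hx v =
      (mfderiv 𝓘(ℂ, EP) 𝓘(ℂ, EP) (fun q => chartAt EP ((Assoc.trivAt B x₀).sec x₀) (B.act q m)) p :
        EP →L[ℂ] EP) (v.eval B p hp : EP) := by
  have h1 : HasMFDerivAt 𝓘(ℂ, EP) 𝓘(ℂ, EP) (chartAt EP ((Assoc.trivAt B x₀).sec x₀)) (B.act p m)
      (mfderiv 𝓘(ℂ, EP) 𝓘(ℂ, EP) (chartAt EP ((Assoc.trivAt B x₀).sec x₀))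
        ((Assoc.trivAt B x₀).sec x) : EP →L[ℂ] EP) := by
    rw [hm]
    exact ((mdifferentiable_chart (I := 𝓘(ℂ, EP)) _).mdifferentiableAt hx.2).hasMFDerivAt
  have h2 := HasMFDerivAt.comp p h1 (mdifferentiable_actRight B m p).hasMFDerivAt
  have h3 := AtiyahFibre.eval_act B v p hp m _ hm ((Assoc.trivAt B x₀).proj_sec x hx.1)
  have h4 := DFunLike.congr_fun h2.mfderiv (v.eval B p hp)
  refine Eq.trans ?_ h4.symm
  exact congrArg (mfderiv 𝓘(ℂ, EP) 𝓘(ℂ, EP) (chartAt EP ((Assoc.trivAt B x₀).sec x₀))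
        ((Assoc.trivAt B x₀).sec x) : EP →L[ℂ] EP) h3

end AtiyahTriv

/-! ### Holomorphic dependence of the models on the base point -/

section Coordinates
variable {G M : Type*} (EG EH : Type*) {EM : Type*}
  [NormedAddCommGroup EG] [NormedSpace ℂ EG] [FiniteDimensional ℂ EG]
  [NormedAddCommGroup EH] [NormedSpace ℂ EH] [FiniteDimensional ℂ EH]
  [NormedAddCommGroup EM] [NormedSpace ℂ EM] [FiniteDimensional ℂ EM]
  [TopologicalSpace G] [ChartedSpace EG G] [Group G] [LieGroup 𝓘(ℂ, EG) ω G]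
  [TopologicalSpace M] [ChartedSpace EM M] [Group M] [LieGroup 𝓘(ℂ, EM) ω M]
  (H : Subgroup G) [ChartedSpace EH H] [LieGroup 𝓘(ℂ, EH) ω H] [IsClosedLieSubgroup EG EH H]

/-- The identification `𝔤/𝔥 ≅ T_x (G ⧸ H)` at `x = g H`. -/
def tangentEquiv (x : G ⧸ H) (g : G) :
    (EG ⧸ lieSub EG EH H) ≃L[ℂ] TangentSpace 𝓘(ℂ, sliceModel EG EH H) x :=
  baseEquiv EG EH H g

/-- The identification `𝔤/𝔥 ≅ T_x (G ⧸ H)` given by `g`, in the trivialization of the tangent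
bundle around `x₀`. -/
def tangentCoord (x₀ x : G ⧸ H) (g : G) : (EG ⧸ lieSub EG EH H) →L[ℂ] sliceModel EG EH H :=
  ((trivializationAt (sliceModel EG EH H)
    (TangentSpace 𝓘(ℂ, sliceModel EG EH H) : G ⧸ H → Type _) x₀).continuousLinearMapAt ℂ x).comp
      (tangentEquiv EG EH H x g : (EG ⧸ lieSub EG EH H) →L[ℂ] _)

/-- In coordinates, the identification given by `s x` is the differential at `1` of
`a ↦ s(x) a H`, hence holomorphic in `x`. -/
theorem contMDiffAt_tangentCoord (s : G ⧸ H → G) (x₀ : G ⧸ H)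
    (hs : ContMDiffAt 𝓘(ℂ, sliceModel EG EH H) 𝓘(ℂ, EG) ω s x₀)
    (hsx : ∀ᶠ x in 𝓝 x₀, (s x : G ⧸ H) = x) :
    ContMDiffAt 𝓘(ℂ, sliceModel EG EH H) 𝓘(ℂ, (EG ⧸ lieSub EG EH H) →L[ℂ] sliceModel EG EH H) ω
      (fun x => tangentCoord EG EH H x₀ x (s x)) x₀ := by
  refine contMDiffAt_of_comp_mkQL _ _ ?_
  set c := extChartAt 𝓘(ℂ, sliceModel EG EH H) x₀ with hc
  have hf : ContMDiffAt (𝓘(ℂ, sliceModel EG EH H).prod 𝓘(ℂ, EG)) 𝓘(ℂ, sliceModel EG EH H) ω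
      (Function.uncurry fun (x : G ⧸ H) (a : G) => c ((s x * a : G) : G ⧸ H)) (x₀, 1) := by
    have h1 : ContMDiffAt (𝓘(ℂ, sliceModel EG EH H).prod 𝓘(ℂ, EG)) 𝓘(ℂ, sliceModel EG EH H) ω
        (fun p : (G ⧸ H) × G => ((s p.1 * p.2 : G) : G ⧸ H)) (x₀, 1) :=
      (contMDiff_cosetMk EG EH H).contMDiffAt.comp (x₀, (1 : G))
        ((ContMDiffAt.comp (x₀, (1 : G)) (g := s) hs contMDiffAt_fst).mul contMDiffAt_snd)
    refine ContMDiffAt.comp (x₀, (1 : G)) (g := c) ?_ h1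
    rw [show ((s (x₀, (1 : G)).1 * (x₀, (1 : G)).2 : G) : G ⧸ H) = x₀ by
      rw [mul_one]; exact hsx.self_of_nhds]
    exact contMDiffAt_extChartAt
  refine contMDiffAt_mfderiv_param (fun (x : G ⧸ H) (a : G) => c ((s x * a : G) : G ⧸ H)) 1
    _ hf ?_
  filter_upwards [hsx, (chartAt (sliceModel EG EH H) x₀).open_source.mem_nhds
    (mem_chart_source _ x₀)] with x hx hxc
  have h1 : HasMFDerivAt 𝓘(ℂ, sliceModel EG EH H) 𝓘(ℂ, sliceModel EG EH H) c
      ((s x * 1 : G) : G ⧸ H)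
      (mfderiv 𝓘(ℂ, sliceModel EG EH H) 𝓘(ℂ, sliceModel EG EH H) c x :
        sliceModel EG EH H →L[ℂ] sliceModel EG EH H) := by
    rw [mul_one, hx]
    exact (mdifferentiableAt_extChartAt hxc).hasMFDerivAt
  have h2 := HasMFDerivAt.comp (1 : G) h1 (hasMFDerivAt_baseMap EG EH H (s x))
  have h3 := TangentBundle.continuousLinearMapAt_trivializationAt (I := 𝓘(ℂ, sliceModel EG EH H))
    hxc
  have h4 : (tangentCoord EG EH H x₀ x (s x)).comp (lieSub EG EH H).mkQL =
      (mfderiv 𝓘(ℂ, sliceModel EG EH H) 𝓘(ℂ, sliceModel EG EH H) c x :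
        sliceModel EG EH H →L[ℂ] sliceModel EG EH H).comp (baseMap EG EH H (s x)) :=
    congrArg (fun T : sliceModel EG EH H →L[ℂ] sliceModel EG EH H =>
      T.comp (baseMap EG EH H (s x))) h3
  rw [h4]
  exact h2

variable {H} (τ : ContMDiffMonoidMorphism 𝓘(ℂ, EH) 𝓘(ℂ, EM) ω H M)

/-- The identification `(𝔤 ⊕ 𝔪)/𝔥 ≅ (At P)_x` given by `g`, in the trivialization of the Atiyah
bundle around `x₀`. -/
def atCoord (x₀ x : G ⧸ H) (g : G) (hg : (g : G ⧸ H) = x) :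
    ((EG × EM) ⧸ twistedSub EG EH τ) →L[ℂ] sliceModel EG EH H × EM :=
  ((trivializationAt (sliceModel EG EH H × EM)
    (AtiyahFibre (homogExtension EG EH τ)) x₀).continuousLinearMapAt ℂ x).comp
      (atEquiv EG EH τ g hg : ((EG × EM) ⧸ twistedSub EG EH τ) →L[ℂ] _)

/-- In coordinates, the identification given by `s x` is the differential at `(1, 1)` of
`(a, m) ↦ [s(x) a, m] b(x)`, where `[s(x), 1] b(x)` is the section of `P` which defines the
trivialization of `At P`. The family is given as a function `T` on all of `X`, since `atCoord` takes
a proof that `s x` represents `x`. -/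
theorem contMDiffAt_atCoord (s : G ⧸ H → G) (x₀ : G ⧸ H)
    (hs : ContMDiffAt 𝓘(ℂ, sliceModel EG EH H) 𝓘(ℂ, EG) ω s x₀)
    (hsx : ∀ᶠ x in 𝓝 x₀, (s x : G ⧸ H) = x)
    (T : G ⧸ H → ((EG × EM) ⧸ twistedSub EG EH τ) →L[ℂ] sliceModel EG EH H × EM)
    (hT : ∀ᶠ x in 𝓝 x₀, ∀ hx : (s x : G ⧸ H) = x, T x = atCoord EG EH τ x₀ x (s x) hx) :
    ContMDiffAt 𝓘(ℂ, sliceModel EG EH H)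
      𝓘(ℂ, ((EG × EM) ⧸ twistedSub EG EH τ) →L[ℂ] sliceModel EG EH H × EM) ω T x₀ := by
  refine contMDiffAt_of_comp_mkQL _ _ ?_
  set B := homogExtension EG EH τ with hB
  set t := Assoc.trivAt B x₀ with ht
  set c := chartAt (sliceModel EG EH H × EM) (t.sec x₀) with hc
  set b : G ⧸ H → M := fun x => (t.coord (extMk EG EH τ (s x) 1))⁻¹ with hb
  have hx₀ : (s x₀ : G ⧸ H) = x₀ := hsx.self_of_nhds
  -- `b x` moves `[s x, 1]` to the section of `P` at which the trivialization of `At P` evaluates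
  have hact : ∀ x ∈ t.base, (s x : G ⧸ H) = x → B.act (extMk EG EH τ (s x) 1) (b x) = t.sec x := by
    intro x hx hsx'
    have hp : B.proj (extMk EG EH τ (s x) 1) = x := hsx'
    have h1 := t.act_coord (extMk EG EH τ (s x) 1) (by rw [hp]; exact hx)
    rw [hp] at h1
    have h2 : t.coord (extMk EG EH τ (s x) 1) * b x = 1 := mul_inv_cancel _
    calc B.act (extMk EG EH τ (s x) 1) (b x)
        = B.act (B.act (t.sec x) (t.coord (extMk EG EH τ (s x) 1))) (b x) := by rw [h1]
      _ = t.sec x := by rw [← B.act_mul, h2, B.act_one]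
  have hbs : ContMDiffAt 𝓘(ℂ, sliceModel EG EH H) 𝓘(ℂ, EM) ω b x₀ := by
    refine ContMDiffAt.inv ?_
    refine ContMDiffAt.comp x₀ (g := t.coord) (f := fun x => extMk EG EH τ (s x) 1) ?_
      ((contMDiff_extMk EG EH τ).contMDiffAt.comp x₀ (hs.prodMk contMDiffAt_const))
    refine t.contMDiffOn_coord.contMDiffAt
      ((t.isOpen_base.preimage B.contMDiff_proj.continuous).mem_nhds ?_)
    change (s x₀ : G ⧸ H) ∈ t.base
    rw [hx₀]; exact Assoc.mem_trivAt B x₀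
  have hf : ContMDiffAt (𝓘(ℂ, sliceModel EG EH H).prod (𝓘(ℂ, EG).prod 𝓘(ℂ, EM)))
      𝓘(ℂ, sliceModel EG EH H × EM) ω (Function.uncurry fun (x : G ⧸ H) (p : G × M) =>
        c (B.act (extMk EG EH τ (s x * p.1) p.2) (b x))) (x₀, (1, 1)) := by
    have h1 : ContMDiffAt (𝓘(ℂ, sliceModel EG EH H).prod (𝓘(ℂ, EG).prod 𝓘(ℂ, EM)))
        𝓘(ℂ, sliceModel EG EH H × EM) ω (fun q : (G ⧸ H) × (G × M) =>
          B.act (extMk EG EH τ (s q.1 * q.2.1) q.2.2) (b q.1)) (x₀, (1, 1)) := by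
      refine B.contMDiff_act.contMDiffAt.comp (x₀, ((1 : G), (1 : M))) (ContMDiffAt.prodMk ?_
        (ContMDiffAt.comp (x₀, ((1 : G), (1 : M))) (g := b) hbs contMDiffAt_fst))
      refine (contMDiff_extMk EG EH τ).contMDiffAt.comp (x₀, ((1 : G), (1 : M)))
        (ContMDiffAt.prodMk ?_ (contMDiffAt_snd.comp _ contMDiffAt_snd))
      exact (ContMDiffAt.comp (x₀, ((1 : G), (1 : M))) (g := s) hs contMDiffAt_fst).mul
        (contMDiffAt_fst.comp _ contMDiffAt_snd)
    refine ContMDiffAt.comp (x₀, ((1 : G), (1 : M))) (g := c) ?_ h1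
    rw [show B.act (extMk EG EH τ (s (x₀, ((1 : G), (1 : M))).1 * (x₀, ((1 : G), (1 : M))).2.1)
      (x₀, ((1 : G), (1 : M))).2.2) (b (x₀, ((1 : G), (1 : M))).1) = t.sec x₀ by
        rw [mul_one]; exact hact x₀ (Assoc.mem_trivAt B x₀) hx₀]
    exact contMDiffOn_chart.contMDiffAt (c.open_source.mem_nhds (mem_chart_source _ _))
  refine contMDiffAt_mfderiv_param (I := 𝓘(ℂ, EG).prod 𝓘(ℂ, EM))
    (fun (x : G ⧸ H) (p : G × M) =>
        c (B.act (extMk EG EH τ (s x * p.1) p.2) (b x))) (1, 1) _ hf ?_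
  have hbase : atiyahBase B x₀ ∈ 𝓝 x₀ :=
    (trivializationAt (sliceModel EG EH H × EM) (AtiyahFibre B) x₀).open_baseSet.mem_nhds
      (mem_baseSet_trivializationAt _ _ x₀)
  filter_upwards [hsx, hT, hbase] with x hx hTx hxb
  have hp : B.proj (extMk EG EH τ (s x) 1) = x := hx
  have hd : MDifferentiableAt 𝓘(ℂ, sliceModel EG EH H × EM) 𝓘(ℂ, sliceModel EG EH H × EM)
      (fun q => c (B.act q (b x))) (extMk EG EH τ (s x) 1) := by
    refine MDifferentiableAt.comp (extMk EG EH τ (s x) 1) (g := c) ?_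
      (mdifferentiable_actRight B (b x) _)
    rw [hact x hxb.1 hx]
    exact (mdifferentiable_chart (I := 𝓘(ℂ, sliceModel EG EH H × EM)) _).mdifferentiableAt hxb.2
  have h2 : HasMFDerivAt 𝓘(ℂ, sliceModel EG EH H × EM) 𝓘(ℂ, sliceModel EG EH H × EM)
      (fun q => c (B.act q (b x))) (extMk EG EH τ (s x * 1) 1)
      (mfderiv 𝓘(ℂ, sliceModel EG EH H × EM) 𝓘(ℂ, sliceModel EG EH H × EM)
        (fun q => c (B.act q (b x))) (extMk EG EH τ (s x) 1) :
          sliceModel EG EH H × EM →L[ℂ] sliceModel EG EH H × EM) := by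
    rw [mul_one]; exact hd.hasMFDerivAt
  have h3 := HasMFDerivAt.comp ((1 : G), (1 : M)) h2 (hasMFDerivAt_totMap EG EH τ (s x))
  refine (congrArg (HasMFDerivAt _ _ _ _) ?_).mp h3
  rw [hTx hx]
  ext w : 1
  have h1 := (continuousLinearMapAt_atiyah B x₀ x hxb
    (atEquiv EG EH τ (s x) hx (Submodule.Quotient.mk w))).trans
    (atiyahTrivEquiv_eq B x₀ x hxb _ (extMk EG EH τ (s x) 1) hp (b x) (hact x hxb.1 hx))
  refine Eq.trans ?_ h1.symm
  exact congrArg (mfderiv 𝓘(ℂ, sliceModel EG EH H × EM) 𝓘(ℂ, sliceModel EG EH H × EM)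
        (fun q => c (B.act q (b x))) (extMk EG EH τ (s x) 1) :
          sliceModel EG EH H × EM →L[ℂ] sliceModel EG EH H × EM)
    (eval_atEquiv EG EH τ (s x) hx hp (Submodule.Quotient.mk w)).symm

end Coordinates

/-! ### The bijection `G ×^H Hom(𝔤/𝔥, (𝔤 ⊕ 𝔪)/𝔥) ≅ Tot(At P ⊗ Ω_X)` -/

section Iso
variable {G M : Type*} (EG EH : Type*) {EM : Type*}
  [NormedAddCommGroup EG] [NormedSpace ℂ EG] [FiniteDimensional ℂ EG]
  [NormedAddCommGroup EH] [NormedSpace ℂ EH] [FiniteDimensional ℂ EH]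
  [NormedAddCommGroup EM] [NormedSpace ℂ EM] [FiniteDimensional ℂ EM]
  [TopologicalSpace G] [ChartedSpace EG G] [Group G] [LieGroup 𝓘(ℂ, EG) ω G]
  [TopologicalSpace M] [ChartedSpace EM M] [Group M] [LieGroup 𝓘(ℂ, EM) ω M]
  {H : Subgroup G} [ChartedSpace EH H] [LieGroup 𝓘(ℂ, EH) ω H] [IsClosedLieSubgroup EG EH H]
  (τ : ContMDiffMonoidMorphism 𝓘(ℂ, EH) 𝓘(ℂ, EM) ω H M)

/-- The identification `Hom(𝔤/𝔥, (𝔤 ⊕ 𝔪)/𝔥) ≅ Hom(T_x X, (At P)_x)` at `x = g H`. -/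
def fibreIso {x : G ⧸ H} (g : G) (hg : (g : G ⧸ H) = x) : HomRep EG EH τ ≃ₗ[ℂ]
    (TangentSpace 𝓘(ℂ, sliceModel EG EH H) x →L[ℂ] AtiyahFibre (homogExtension EG EH τ) x) where
  toFun ν := (atEquiv EG EH τ g hg : _ →L[ℂ] AtiyahFibre (homogExtension EG EH τ) x).comp
    (ν.comp ((tangentEquiv EG EH H x g).symm : _ →L[ℂ] (EG ⧸ lieSub EG EH H)))
  map_add' ν ν' := by
    ext v
    exact map_add (atEquiv EG EH τ g hg) _ _
  map_smul' c ν := by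
    ext v
    exact map_smul (atEquiv EG EH τ g hg) c _
  invFun u := ((atEquiv EG EH τ g hg).symm : _ →L[ℂ] (EG × EM) ⧸ twistedSub EG EH τ).comp
    (u.comp (tangentEquiv EG EH H x g : _ →L[ℂ] TangentSpace 𝓘(ℂ, sliceModel EG EH H) x))
  left_inv ν := by
    ext y
    exact ((atEquiv EG EH τ g hg).symm_apply_apply _).trans
      (congrArg ν ((tangentEquiv EG EH H x g).symm_apply_apply y))
  right_inv u := by
    ext v
    exact ((atEquiv EG EH τ g hg).apply_symm_apply _).trans
      (congrArg u ((tangentEquiv EG EH H x g).apply_symm_apply v))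

theorem fibreIso_apply {x : G ⧸ H} (g : G) (hg : (g : G ⧸ H) = x) (ν : HomRep EG EH τ)
    (y : EG ⧸ lieSub EG EH H) :
    fibreIso EG EH τ g hg ν (tangentEquiv EG EH H x g y) = atEquiv EG EH τ g hg (ν y) :=
  congrArg (fun z => atEquiv EG EH τ g hg (ν z)) ((tangentEquiv EG EH H x g).symm_apply_apply y)

/-- The identifications of the fibre of `Hom(TX, At P)` given by `g` and `g h` differ by the action of
`h`, which makes `[g, ν] ↦ ν` well defined. -/
theorem fibreIso_mul {x : G ⧸ H} (g : G) (hg : (g : G ⧸ H) = x) (h : H)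
    (hgh : ((g * h : G) : G ⧸ H) = x) (ν : HomRep EG EH τ) :
    fibreIso EG EH τ (g * h) hgh ν = fibreIso EG EH τ g hg (homAction EG EH τ h ν) := by
  ext v
  obtain ⟨y, rfl⟩ := (tangentEquiv EG EH H x (g * h)).surjective v
  have h1 : tangentEquiv EG EH H x (g * h) y = tangentEquiv EG EH H x g (baseAd EG EH h y) :=
    baseEquiv_mul EG EH H g h y
  have h2 : baseAd EG EH h⁻¹ (baseAd EG EH h y) = y := by
    have h3 := baseAd_mul EG EH h⁻¹ h
    rw [inv_mul_cancel, baseAd_one] at h3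
    exact (DFunLike.congr_fun h3 y).symm
  rw [fibreIso_apply, atEquiv_mul EG EH τ g hg h hgh, h1, fibreIso_apply]
  exact congrArg (fun z => atEquiv EG EH τ g hg (totalAd EG EH τ h (ν z))) h2.symm

theorem fibreIso_eq_of_mk_eq {x : G ⧸ H} (g g' : G) (hg : (g : G ⧸ H) = x)
    (hg' : (g' : G ⧸ H) = x) (ν ν' : HomRep EG EH τ)
    (h : Assoc.mk (homogBundle EG EH H) (homAction EG EH τ) g ν =
      Assoc.mk (homogBundle EG EH H) (homAction EG EH τ) g' ν') :
    fibreIso EG EH τ g hg ν = fibreIso EG EH τ g' hg' ν' := by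
  obtain ⟨k, rfl, rfl⟩ := (Assoc.mk_eq_mk _ _ _ _ _ _).1 h
  refine Eq.trans ?_ (fibreIso_mul EG EH τ g hg k hg' _).symm
  simp

theorem mk_fibreIso_symm {x : G ⧸ H} (g g' : G) (hg : (g : G ⧸ H) = x)
    (hg' : (g' : G ⧸ H) = x)
    (u : TangentSpace 𝓘(ℂ, sliceModel EG EH H) x →L[ℂ] AtiyahFibre (homogExtension EG EH τ) x) :
    Assoc.mk (homogBundle EG EH H) (homAction EG EH τ) g ((fibreIso EG EH τ g hg).symm u) =
      Assoc.mk (homogBundle EG EH H) (homAction EG EH τ) g' ((fibreIso EG EH τ g' hg').symm u) := by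
  have h1 : g⁻¹ * g' ∈ H := QuotientGroup.eq.1 (hg.trans hg'.symm)
  obtain ⟨k, rfl⟩ : ∃ k : H, g' = g * k := ⟨⟨_, h1⟩, by simp⟩
  refine (Assoc.mk_eq_mk _ _ _ _ _ _).2 ⟨k, rfl, ?_⟩
  refine (fibreIso EG EH τ (g * k) hg').injective ?_
  rw [LinearEquiv.apply_symm_apply, fibreIso_mul EG EH τ g hg k hg']
  simp

theorem proj_eq_out (z : Assoc (homogBundle EG EH H) (homAction EG EH τ)) :
    ((Quotient.out z).1 : G ⧸ H) = Assoc.proj _ _ z :=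
  congrArg (Assoc.proj (homogBundle EG EH H) (homAction EG EH τ)) (Quotient.out_eq z)

/-- The bijection `[g, ν] ↦ ν` from `G ×^H Hom(𝔤/𝔥, (𝔤 ⊕ 𝔪)/𝔥)` to the total space of
`Hom(TX, At P)`. -/
def assocEquiv : Assoc (homogBundle EG EH H) (homAction EG EH τ) ≃
    AtOmega (homogExtension EG EH τ) where
  toFun z := ⟨Assoc.proj _ _ z,
    fibreIso EG EH τ (Quotient.out z).1 (proj_eq_out EG EH τ z) (Quotient.out z).2⟩
  invFun w := Assoc.mk _ _ (Quotient.out w.1)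
    ((fibreIso EG EH τ (Quotient.out w.1) (QuotientGroup.out_eq' w.1)).symm w.2)
  left_inv z := by
    refine (mk_fibreIso_symm EG EH τ _ _ _ (proj_eq_out EG EH τ z) _).trans ?_
    rw [LinearEquiv.symm_apply_apply]
    exact Quotient.out_eq z
  right_inv w := by
    set z := Assoc.mk (homogBundle EG EH H) (homAction EG EH τ) (Quotient.out w.1)
      ((fibreIso EG EH τ (Quotient.out w.1) (QuotientGroup.out_eq' w.1)).symm w.2) with hz
    have h1 : Assoc.proj _ _ z = w.1 := QuotientGroup.out_eq' w.1
    have h2 : ∀ (x : G ⧸ H) (hx : ((Quotient.out z).1 : G ⧸ H) = x), x = w.1 →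
        (⟨x, fibreIso EG EH τ (Quotient.out z).1 hx (Quotient.out z).2⟩ :
          AtOmega (homogExtension EG EH τ)) = w := by
      rintro _ hx rfl
      refine congrArg (TotalSpace.mk w.1) ?_
      exact (fibreIso_eq_of_mk_eq EG EH τ _ (Quotient.out w.1) hx (QuotientGroup.out_eq' w.1) _
        ((fibreIso EG EH τ (Quotient.out w.1) (QuotientGroup.out_eq' w.1)).symm w.2)
        (Quotient.out_eq z)).trans (LinearEquiv.apply_symm_apply _ _)
    exact h2 _ (proj_eq_out EG EH τ z) h1

theorem assocEquiv_mk {x : G ⧸ H} (g : G) (hg : (g : G ⧸ H) = x) (ν : HomRep EG EH τ) :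
    assocEquiv EG EH τ (Assoc.mk (homogBundle EG EH H) (homAction EG EH τ) g ν) =
      ⟨x, fibreIso EG EH τ g hg ν⟩ := by
  subst hg
  exact congrArg (TotalSpace.mk (g : G ⧸ H)) (fibreIso_eq_of_mk_eq EG EH τ _ _ _ _ _ _
    (Quotient.out_eq (Assoc.mk (homogBundle EG EH H) (homAction EG EH τ) g ν)))

theorem assocEquiv_symm_mk {x : G ⧸ H} (g : G) (hg : (g : G ⧸ H) = x)
    (u : TangentSpace 𝓘(ℂ, sliceModel EG EH H) x →L[ℂ] AtiyahFibre (homogExtension EG EH τ) x) :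
    (assocEquiv EG EH τ).symm ⟨x, u⟩ = Assoc.mk (homogBundle EG EH H) (homAction EG EH τ) g
      ((fibreIso EG EH τ g hg).symm u) :=
  mk_fibreIso_symm EG EH τ _ _ _ _ _

/-- The coordinates of a homomorphism `T_x X → (At P)_x` in the preferred trivializations around
`x₀`. -/
def homCoord (x₀ x : G ⧸ H)
    (u : TangentSpace 𝓘(ℂ, sliceModel EG EH H) x →L[ℂ] AtiyahFibre (homogExtension EG EH τ) x) :
    sliceModel EG EH H →L[ℂ] (sliceModel EG EH H × EM) :=
  ContinuousLinearMap.inCoordinates (sliceModel EG EH H)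
    (TangentSpace 𝓘(ℂ, sliceModel EG EH H) : G ⧸ H → Type _) (sliceModel EG EH H × EM)
    (AtiyahFibre (homogExtension EG EH τ)) x₀ x x₀ x u

theorem tangentCoord_isInvertible (x₀ x : G ⧸ H) (g : G)
    (hx : x ∈ (trivializationAt (sliceModel EG EH H)
      (TangentSpace 𝓘(ℂ, sliceModel EG EH H) : G ⧸ H → Type _) x₀).baseSet) :
    (tangentCoord EG EH H x₀ x g).IsInvertible := by
  refine ⟨(tangentEquiv EG EH H x g).trans (Trivialization.continuousLinearEquivAt ℂ _ x hx), ?_⟩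
  rw [tangentCoord, ← Trivialization.coe_continuousLinearEquivAt_eq' _ hx]
  rfl

theorem atCoord_isInvertible (x₀ x : G ⧸ H) (g : G) (hg : (g : G ⧸ H) = x)
    (hx : x ∈ (trivializationAt (sliceModel EG EH H × EM)
      (AtiyahFibre (homogExtension EG EH τ)) x₀).baseSet) :
    (atCoord EG EH τ x₀ x g hg).IsInvertible := by
  refine ⟨(atEquiv EG EH τ g hg).trans (Trivialization.continuousLinearEquivAt ℂ _ x hx), ?_⟩
  rw [atCoord, ← Trivialization.coe_continuousLinearEquivAt_eq' _ hx]
  rfl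

/-- In coordinates, `fibreIso` is `ν ↦ β ∘ ν ∘ α⁻¹` with `α = tangentCoord` and `β = atCoord`. -/
theorem homCoord_comp_tangentCoord (x₀ x : G ⧸ H) (g : G) (hg : (g : G ⧸ H) = x)
    (hx : x ∈ (trivializationAt (sliceModel EG EH H)
      (TangentSpace 𝓘(ℂ, sliceModel EG EH H) : G ⧸ H → Type _) x₀).baseSet)
    (ν : HomRep EG EH τ) :
    (homCoord EG EH τ x₀ x (fibreIso EG EH τ g hg ν)).comp (tangentCoord EG EH H x₀ x g) =
      (atCoord EG EH τ x₀ x g hg).comp ν := by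
  refine ContinuousLinearMap.ext fun y => ?_
  have h1 := Trivialization.symmL_continuousLinearMapAt (R := ℂ)
    (trivializationAt (sliceModel EG EH H)
      (TangentSpace 𝓘(ℂ, sliceModel EG EH H) : G ⧸ H → Type _) x₀) hx
      (tangentEquiv EG EH H x g y)
  have h2 := (congrArg (fibreIso EG EH τ g hg ν) h1).trans (fibreIso_apply EG EH τ g hg ν y)
  exact congrArg ((trivializationAt (sliceModel EG EH H × EM)
    (AtiyahFibre (homogExtension EG EH τ)) x₀).continuousLinearMapAt ℂ x) h2

end Iso

/-! ### Holomorphy of the bijection, and its anchor -/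

section Smooth
variable {G M : Type*} (EG EH : Type*) {EM : Type*}
  [NormedAddCommGroup EG] [NormedSpace ℂ EG] [FiniteDimensional ℂ EG]
  [NormedAddCommGroup EH] [NormedSpace ℂ EH] [FiniteDimensional ℂ EH]
  [NormedAddCommGroup EM] [NormedSpace ℂ EM] [FiniteDimensional ℂ EM]
  [TopologicalSpace G] [ChartedSpace EG G] [Group G] [LieGroup 𝓘(ℂ, EG) ω G]
  [TopologicalSpace M] [ChartedSpace EM M] [Group M] [LieGroup 𝓘(ℂ, EM) ω M]
  {H : Subgroup G} [ChartedSpace EH H] [LieGroup 𝓘(ℂ, EH) ω H] [IsClosedLieSubgroup EG EH H]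
  (τ : ContMDiffMonoidMorphism 𝓘(ℂ, EH) 𝓘(ℂ, EM) ω H M)

/-- Around each point of `X` there are a local section `s` of `G → X` and holomorphic families `α`,
`β` of invertible maps which express, in local trivializations of `TX` and `At P`, the
identifications of the fibres given by `s`. In these trivializations `[s(x), ν] ↦ ν` becomes
`ν ↦ β(x) ∘ ν ∘ α(x)⁻¹`. -/
theorem exists_local_frame (x₀ : G ⧸ H) :
    ∃ (t : LocalTriv EG (sliceModel EG EH H) EH (homogBundle EG EH H).proj (homogBundle EG EH H).act)
      (O : Set (G ⧸ H))
      (α : G ⧸ H → (EG ⧸ lieSub EG EH H) →L[ℂ] sliceModel EG EH H)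
      (β : G ⧸ H → ((EG × EM) ⧸ twistedSub EG EH τ) →L[ℂ] sliceModel EG EH H × EM),
      x₀ ∈ t.base ∧ O ∈ 𝓝 x₀ ∧ O ⊆ t.base ∧
      ContMDiffAt 𝓘(ℂ, sliceModel EG EH H)
        𝓘(ℂ, (EG ⧸ lieSub EG EH H) →L[ℂ] sliceModel EG EH H) ω α x₀ ∧
      ContMDiffAt 𝓘(ℂ, sliceModel EG EH H)
        𝓘(ℂ, ((EG × EM) ⧸ twistedSub EG EH τ) →L[ℂ] sliceModel EG EH H × EM) ω β x₀ ∧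
      (∀ x ∈ O, (α x).IsInvertible ∧ (β x).IsInvertible) ∧
      ∀ x ∈ O, ∀ (hx : (t.sec x : G ⧸ H) = x) (ν : HomRep EG EH τ),
        (homCoord EG EH τ x₀ x (fibreIso EG EH τ (t.sec x) hx ν)).comp (α x) = (β x).comp ν := by
  classical
  set t := Assoc.trivAt (homogBundle EG EH H) x₀ with ht
  have hx₀ : x₀ ∈ t.base := Assoc.mem_trivAt _ x₀
  have hb : t.base ∈ 𝓝 x₀ := t.isOpen_base.mem_nhds hx₀
  have hsec : ∀ x ∈ t.base, (t.sec x : G ⧸ H) = x := t.proj_sec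
  have hs : ContMDiffAt 𝓘(ℂ, sliceModel EG EH H) 𝓘(ℂ, EG) ω t.sec x₀ :=
    t.contMDiffOn_sec.contMDiffAt hb
  have hsx : ∀ᶠ x in 𝓝 x₀, (t.sec x : G ⧸ H) = x := by
    filter_upwards [hb] with x hx using hsec x hx
  let eT := trivializationAt (sliceModel EG EH H)
      (TangentSpace 𝓘(ℂ, sliceModel EG EH H) : G ⧸ H → Type _) x₀
  let eA := trivializationAt (sliceModel EG EH H × EM) (AtiyahFibre (homogExtension EG EH τ)) x₀
  -- `atCoord` needs a proof that `s x` represents `x`; the value `0` is only taken off `t.base`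
  let β : G ⧸ H → ((EG × EM) ⧸ twistedSub EG EH τ) →L[ℂ] sliceModel EG EH H × EM :=
    fun x => if hx : (t.sec x : G ⧸ H) = x then atCoord EG EH τ x₀ x (t.sec x) hx else 0
  have hβ : ∀ x (hx : (t.sec x : G ⧸ H) = x), β x = atCoord EG EH τ x₀ x (t.sec x) hx :=
    fun x hx => dif_pos hx
  refine ⟨t, t.base ∩ (eT.baseSet ∩ eA.baseSet),
    fun x => tangentCoord EG EH H x₀ x (t.sec x), β, hx₀, ?_, inter_subset_left,
    contMDiffAt_tangentCoord EG EH H t.sec x₀ hs hsx,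
    contMDiffAt_atCoord EG EH τ t.sec x₀ hs hsx β (Filter.Eventually.of_forall hβ), ?_, ?_⟩
  · exact Filter.inter_mem hb (Filter.inter_mem
      (eT.open_baseSet.mem_nhds (mem_baseSet_trivializationAt _ _ x₀))
      (eA.open_baseSet.mem_nhds (mem_baseSet_trivializationAt _ _ x₀)))
  · rintro x ⟨hx, hxT, hxA⟩
    refine ⟨tangentCoord_isInvertible EG EH x₀ x _ hxT, ?_⟩
    rw [hβ x (hsec x hx)]
    exact atCoord_isInvertible EG EH τ x₀ x _ _ hxA
  · rintro x ⟨hx, hxT, hxA⟩ hx' ν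
    rw [hβ x hx']
    exact homCoord_comp_tangentCoord EG EH τ x₀ x _ hx' hxT ν

theorem contMDiff_assocEquiv : ContMDiff 𝓘(ℂ, sliceModel EG EH H × HomRep EG EH τ)
    (𝓘(ℂ, sliceModel EG EH H).prod 𝓘(ℂ, sliceModel EG EH H →L[ℂ] (sliceModel EG EH H × EM))) ω
    (assocEquiv EG EH τ) := by
  intro z₀
  set x₀ := Assoc.proj (homogBundle EG EH H) (homAction EG EH τ) z₀ with hx₀
  obtain ⟨t, O, α, β, hxt, hO, hOt, hα, hβ, hinv, hc⟩ := exists_local_frame EG EH τ x₀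
  have hproj : ContMDiff 𝓘(ℂ, sliceModel EG EH H × HomRep EG EH τ) 𝓘(ℂ, sliceModel EG EH H) ω
      (Assoc.proj (homogBundle EG EH H) (homAction EG EH τ)) := Assoc.contMDiff_proj _ _
  have hfc : ContMDiffAt 𝓘(ℂ, sliceModel EG EH H × HomRep EG EH τ) 𝓘(ℂ, HomRep EG EH τ) ω
      (Assoc.fibreCoord (homogBundle EG EH H) (homAction EG EH τ) t) z₀ :=
    (contMDiff_snd.comp_contMDiffOn (Assoc.contMDiffOn_triv (EF := HomRep EG EH τ)
      (homogBundle EG EH H) (homAction EG EH τ) t)).contMDiffAt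
      ((Assoc.triv (EF := HomRep EG EH τ) _ _ t).open_source.mem_nhds hxt)
  refine (contMDiffAt_hom_bundle _).2 ⟨hproj z₀, ?_⟩
  have h1 := (hβ.comp z₀ (hproj z₀)).clm_comp (hfc.clm_comp
    ((contMDiffAt_clm_inverse hα (hinv x₀ (mem_of_mem_nhds hO)).1).comp z₀ (hproj z₀)))
  refine h1.congr_of_eventuallyEq ?_
  filter_upwards [(hproj.continuous.continuousAt (x := z₀)).preimage_mem_nhds hO] with z hz
  set x := Assoc.proj (homogBundle EG EH H) (homAction EG EH τ) z with hx
  have hsx : (t.sec x : G ⧸ H) = x := t.proj_sec x (hOt hz)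
  set ν := Assoc.fibreCoord (homogBundle EG EH H) (homAction EG EH τ) t z with hν
  have hz' : Assoc.mk (homogBundle EG EH H) (homAction EG EH τ) (t.sec x) ν = z :=
    (Assoc.triv (EF := HomRep EG EH τ) (homogBundle EG EH H) (homAction EG EH τ) t).left_inv
      (hOt hz)
  have h2 : assocEquiv EG EH τ z = ⟨x, fibreIso EG EH τ (t.sec x) hsx ν⟩ := by
    rw [← assocEquiv_mk, hz']
  obtain ⟨e, he⟩ := (hinv x hz).1
  have h3 := hc x hz hsx ν
  have h4 : homCoord EG EH τ x₀ x (fibreIso EG EH τ (t.sec x) hsx ν) =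
      (β x).comp (ν.comp (α x).inverse) := by
    rw [← ContinuousLinearMap.comp_assoc, ← h3, ← he, ContinuousLinearMap.inverse_equiv]
    ext v : 1
    simp
  refine Eq.trans ?_ h4
  change homCoord EG EH τ x₀ (assocEquiv EG EH τ z).1 (assocEquiv EG EH τ z).2 = _
  rw [h2]

theorem contMDiff_assocEquiv_symm :
    ContMDiff (𝓘(ℂ, sliceModel EG EH H).prod
      𝓘(ℂ, sliceModel EG EH H →L[ℂ] (sliceModel EG EH H × EM)))
      𝓘(ℂ, sliceModel EG EH H × HomRep EG EH τ) ω (assocEquiv EG EH τ).symm := by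
  intro w₀
  set x₀ := w₀.1 with hx₀
  obtain ⟨t, O, α, β, hxt, hO, hOt, hα, hβ, hinv, hc⟩ := exists_local_frame EG EH τ x₀
  obtain ⟨hp, hw⟩ := (contMDiffAt_hom_bundle (n := ω)
    (id : AtOmega (homogExtension EG EH τ) → AtOmega (homogExtension EG EH τ))
    (IM := 𝓘(ℂ, sliceModel EG EH H).prod
      𝓘(ℂ, sliceModel EG EH H →L[ℂ] (sliceModel EG EH H × EM)))
    (IB := 𝓘(ℂ, sliceModel EG EH H)) (x₀ := w₀)).1
    contMDiffAt_id
  have h1 := ((contMDiffAt_clm_inverse hβ (hinv x₀ (mem_of_mem_nhds hO)).2).comp w₀ hp).clm_comp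
    (ContMDiffAt.clm_comp hw (hα.comp w₀ hp))
  have h2 := ((Assoc.contMDiffOn_triv_symm (EF := HomRep EG EH τ) (homogBundle EG EH H)
    (homAction EG EH τ) t).contMDiffAt ((t.isOpen_base.prod isOpen_univ).mem_nhds
      ⟨hxt, mem_univ _⟩)).comp w₀ (hp.prodMk h1)
  refine h2.congr_of_eventuallyEq ?_
  filter_upwards [hp.continuousAt.preimage_mem_nhds hO] with w hwO
  obtain ⟨x, u⟩ := w
  have hsx : (t.sec x : G ⧸ H) = x := t.proj_sec x (hOt hwO)
  rw [assocEquiv_symm_mk EG EH τ (t.sec x) hsx]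
  refine congrArg (Assoc.mk (homogBundle EG EH H) (homAction EG EH τ) (t.sec x)) ?_
  obtain ⟨e, he⟩ := (hinv x hwO).2
  have h3 := hc x hwO hsx ((fibreIso EG EH τ (t.sec x) hsx).symm u)
  rw [LinearEquiv.apply_symm_apply] at h3
  change _ = (β x).inverse.comp ((homCoord EG EH τ x₀ x u).comp (α x))
  rw [h3, ← he, ContinuousLinearMap.inverse_equiv]
  ext v : 1
  simp

/-- The biholomorphism `G ×^H Hom(𝔤/𝔥, (𝔤 ⊕ 𝔪)/𝔥) ≅ Tot(At P ⊗ Ω_X)`. -/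
def assocDiffeomorph : Diffeomorph 𝓘(ℂ, sliceModel EG EH H × HomRep EG EH τ)
    (𝓘(ℂ, sliceModel EG EH H).prod 𝓘(ℂ, sliceModel EG EH H →L[ℂ] (sliceModel EG EH H × EM)))
    (Assoc (homogBundle EG EH H) (homAction EG EH τ)) (AtOmega (homogExtension EG EH τ)) ω where
  toEquiv := assocEquiv EG EH τ
  contMDiff_toFun := contMDiff_assocEquiv EG EH τ
  contMDiff_invFun := contMDiff_assocEquiv_symm EG EH τ

/-- An element of the Atiyah fibre at `g H` has anchor the image of its projection under
`σ : (𝔤 ⊕ 𝔪)/𝔥 → 𝔤/𝔥`. -/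
theorem mfderiv_proj_eval_atEquiv {x : G ⧸ H} (g : G) (hg : (g : G ⧸ H) = x)
    (y : (EG × EM) ⧸ twistedSub EG EH τ) (p : Assoc (homogBundle EG EH H) (leftMulHom τ))
    (hp : (homogExtension EG EH τ).proj p = x) :
    (mfderiv 𝓘(ℂ, sliceModel EG EH H × EM) 𝓘(ℂ, sliceModel EG EH H) (homogExtension EG EH τ).proj p
      : sliceModel EG EH H × EM →L[ℂ] sliceModel EG EH H)
      ((atEquiv EG EH τ g hg y).eval _ p hp : sliceModel EG EH H × EM) =
      baseEquiv EG EH H g (sigmaProj EG EH τ y) := by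
  obtain ⟨m, hm⟩ : ∃ m : M, (homogExtension EG EH τ).act (extMk EG EH τ g 1) m = p := by
    obtain ⟨a, b, rfl⟩ := Assoc.mk_surjective _ _ p
    have h1 : g⁻¹ * a ∈ H := QuotientGroup.eq.1 (hg.trans hp.symm)
    refine ⟨τ.toMonoidHom ⟨_, h1⟩ * b, ?_⟩
    rw [act_extMk, one_mul, ← extMk_mul]
    simp [extMk]
  have hp' : (homogExtension EG EH τ).proj (extMk EG EH τ g 1) = x := hg
  refine (mfderiv_proj_eval (homogExtension EG EH τ) (atEquiv EG EH τ g hg y) (extMk EG EH τ g 1)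
    hp' m p hm hp).trans ?_
  refine (congrArg _ (eval_atEquiv EG EH τ g hg hp' y)).trans ?_
  induction y using Submodule.Quotient.induction_on with
  | _ w => exact mfderiv_proj_totMap EG EH τ g w

/-- Under the identifications given by `g`, the anchor is `σ`, so the condition `dπ ∘ ν = c • Id` which
defines `C_c(P)` becomes the condition `σ ∘ ν = c • Id` which defines `𝔞_c`. -/
theorem mem_Clambda_fibreIso (c : ℂ) {x : G ⧸ H} (g : G) (hg : (g : G ⧸ H) = x)
    (ν : HomRep EG EH τ) :
    (⟨x, fibreIso EG EH τ g hg ν⟩ : AtOmega (homogExtension EG EH τ)) ∈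
      Clambda (homogExtension EG EH τ) c ↔ ν ∈ aLambda EG EH τ c := by
  have key : ∀ (y : EG ⧸ lieSub EG EH H) (p : Assoc (homogBundle EG EH H) (leftMulHom τ))
      (hp : (homogExtension EG EH τ).proj p = x),
      (mfderiv 𝓘(ℂ, sliceModel EG EH H × EM) 𝓘(ℂ, sliceModel EG EH H)
        (homogExtension EG EH τ).proj p : sliceModel EG EH H × EM →L[ℂ] sliceModel EG EH H)
        ((fibreIso EG EH τ g hg ν (tangentEquiv EG EH H x g y)).eval _ p hp :
          sliceModel EG EH H × EM) = baseEquiv EG EH H g (sigmaProj EG EH τ (ν y)) := by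
    intro y p hp
    rw [fibreIso_apply]
    exact mfderiv_proj_eval_atEquiv EG EH τ g hg (ν y) p hp
  constructor
  · intro h y
    refine (baseEquiv EG EH H g).injective ?_
    have hp : (homogExtension EG EH τ).proj (extMk EG EH τ g 1) = x := hg
    have h1 := h (tangentEquiv EG EH H x g y) (extMk EG EH τ g 1) hp
    rw [map_smul]
    exact (key y (extMk EG EH τ g 1) hp).symm.trans h1
  · intro h w p hp
    obtain ⟨y, rfl⟩ := (tangentEquiv EG EH H x g).surjective w
    have h1 : baseEquiv EG EH H g (sigmaProj EG EH τ (ν y)) = c • baseEquiv EG EH H g y :=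
      (congrArg (baseEquiv EG EH H g) (h y)).trans ((baseEquiv EG EH H g).map_smul c y)
    exact (key y p hp).trans h1

end Smooth

/-! ### The spaces `C_c(P)` and `𝔞_c` -/

section Affine
variable {G M : Type*} (EG EH : Type*) {EM : Type*}
  [NormedAddCommGroup EG] [NormedSpace ℂ EG] [FiniteDimensional ℂ EG]
  [NormedAddCommGroup EH] [NormedSpace ℂ EH] [FiniteDimensional ℂ EH]
  [NormedAddCommGroup EM] [NormedSpace ℂ EM] [FiniteDimensional ℂ EM]
  [TopologicalSpace G] [ChartedSpace EG G] [Group G] [LieGroup 𝓘(ℂ, EG) ω G]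
  [TopologicalSpace M] [ChartedSpace EM M] [Group M] [LieGroup 𝓘(ℂ, EM) ω M]
  {H : Subgroup G} [ChartedSpace EH H] [LieGroup 𝓘(ℂ, EH) ω H] [IsClosedLieSubgroup EG EH H]
  (τ : ContMDiffMonoidMorphism 𝓘(ℂ, EH) 𝓘(ℂ, EM) ω H M)

/-- The associated bundle `G ×^H 𝔞_c` is carried onto `C_c(P)`; both topologies are obtained from
that of `G × Hom(𝔤/𝔥, (𝔤 ⊕ 𝔪)/𝔥)`, because an open quotient map restricts to an open quotient map
over any subset of its target. -/
theorem exists_homeomorph_Clambda (c : ℂ) :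
    ∃ Ψ : Assoc (homogBundle EG EH H) (affAction EG EH τ c) ≃ₜ
      Clambda (homogExtension EG EH τ) c, ∀ (g : G) (ν : aLambda EG EH τ c),
        (Ψ (Assoc.mk (homogBundle EG EH H) (affAction EG EH τ c) g ν) :
          AtOmega (homogExtension EG EH τ)) =
            assocEquiv EG EH τ (Assoc.mk (homogBundle EG EH H) (homAction EG EH τ) g ν) := by
  have hmem : ∀ (g : G) (ν : HomRep EG EH τ),
      assocEquiv EG EH τ (Assoc.mk (homogBundle EG EH H) (homAction EG EH τ) g ν) ∈
        Clambda (homogExtension EG EH τ) c ↔ ν ∈ aLambda EG EH τ c := fun g ν => by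
    rw [assocEquiv_mk EG EH τ g rfl ν]
    exact mem_Clambda_fibreIso EG EH τ c g rfl ν
  let q : G × HomRep EG EH τ → AtOmega (homogExtension EG EH τ) := fun p =>
    assocEquiv EG EH τ (Assoc.mk (homogBundle EG EH H) (homAction EG EH τ) p.1 p.2)
  have hq : IsOpenQuotientMap q :=
    (assocDiffeomorph EG EH τ).toHomeomorph.isOpenQuotientMap.comp
      (Assoc.isOpenQuotientMap_mk (EF := HomRep EG EH τ) (homogBundle EG EH H)
        (homAction EG EH τ))
  let i : G × aLambda EG EH τ c → G × HomRep EG EH τ := Prod.map id Subtype.val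
  have hi : Topology.IsInducing i := Topology.IsInducing.id.prodMap Topology.IsInducing.subtypeVal
  let j₀ : G × aLambda EG EH τ c → Clambda (homogExtension EG EH τ) c :=
    fun p => ⟨q (i p), (hmem p.1 p.2).2 p.2.2⟩
  have hj₀ : Continuous j₀ := (hq.continuous.comp hi.continuous).subtype_mk _
  have hcompat : ∀ p p' : G × aLambda EG EH τ c,
      (assocSetoid (homogBundle EG EH H) (affAction EG EH τ c)).r p p' → j₀ p = j₀ p' := by
    rintro p _ ⟨h, rfl⟩
    refine Subtype.ext (congrArg (assocEquiv EG EH τ) ?_)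
    exact (Assoc.mk_eq_mk _ _ _ _ _ _).2 ⟨h, rfl, rfl⟩
  let j : Assoc (homogBundle EG EH H) (affAction EG EH τ c) →
    Clambda (homogExtension EG EH τ) c := Quotient.lift j₀ hcompat
  have hj : Continuous j := hj₀.quotient_lift hcompat
  have hinj : Function.Injective j := by
    intro z z' hzz
    obtain ⟨g, ν, rfl⟩ := Assoc.mk_surjective _ _ z
    obtain ⟨g', ν', rfl⟩ := Assoc.mk_surjective _ _ z'
    have h1 := (assocEquiv EG EH τ).injective (congrArg Subtype.val hzz)
    obtain ⟨h, hg, hν⟩ := (Assoc.mk_eq_mk _ _ _ _ _ _).1 h1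
    exact (Assoc.mk_eq_mk _ _ _ _ _ _).2 ⟨h, hg, Subtype.ext hν⟩
  have hsurj : Function.Surjective j := by
    rintro ⟨w, hw⟩
    obtain ⟨⟨g, ν⟩, rfl⟩ := hq.surjective w
    exact ⟨Assoc.mk _ _ g ⟨ν, (hmem g ν).1 hw⟩, rfl⟩
  have hopen : IsOpenMap j := by
    intro U hU
    obtain ⟨O, hO, hOU⟩ := hi.isOpen_iff.1 (hU.preimage (continuous_quotient_mk'
      (s := assocSetoid (homogBundle EG EH H) (affAction EG EH τ c))))
    refine isOpen_induced_iff.2 ⟨q '' O, hq.isOpenMap O hO, ?_⟩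
    ext ⟨w, hw⟩
    constructor
    · rintro ⟨⟨g, ν⟩, hgν, rfl⟩
      have h1 : (g, (⟨ν, (hmem g ν).1 hw⟩ : aLambda EG EH τ c)) ∈ i ⁻¹' O := hgν
      rw [hOU] at h1
      exact ⟨_, h1, rfl⟩
    · rintro ⟨z, hz, hzw⟩
      obtain ⟨g, ν, rfl⟩ := Assoc.mk_surjective _ _ z
      have h1 : (g, ν) ∈ i ⁻¹' O := by rw [hOU]; exact hz
      exact ⟨i (g, ν), h1, congrArg Subtype.val hzw⟩
  exact ⟨(Equiv.ofBijective j ⟨hinj, hsurj⟩).toHomeomorphOfContinuousOpen hj hopen,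
    fun g ν => rfl⟩

theorem aLambda_nonempty (c : ℂ) : (aLambda EG EH τ c).Nonempty := by
  obtain ⟨s, hs⟩ := LinearMap.exists_rightInverse_of_surjective (lieSub EG EH H).mkQ
    (lieSub EG EH H).range_mkQ
  refine ⟨c • LinearMap.toContinuousLinearMap
    ((twistedSub EG EH τ).mkQ.comp ((LinearMap.inl ℂ EG EM).comp s)), fun x => ?_⟩
  refine ((sigmaProj EG EH τ).map_smul c (Submodule.Quotient.mk (s x, 0))).trans ?_
  exact congrArg (c • ·) (DFunLike.congr_fun hs x)

theorem sigmaProj_mIncl (η : EM) : sigmaProj EG EH τ (mIncl EG EH τ η) = 0 :=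
  (Submodule.Quotient.mk_eq_zero _).2 (zero_mem (lieSub EG EH H))

theorem mIncl_injective : Function.Injective (mIncl EG EH τ) := by
  refine (injective_iff_map_eq_zero _).2 fun η hη => ?_
  obtain ⟨v, hv⟩ := (Submodule.Quotient.mk_eq_zero _).1 hη
  have h1 : dIncl EG EH H v = 0 := congrArg Prod.fst hv
  have h2 : v = 0 := (injective_iff_map_eq_zero (dIncl EG EH H)).1
    (IsClosedLieSubgroup.injective_mfderiv (EG := EG) (1 : H)) v h1
  rw [h2, map_zero] at hv
  exact (congrArg Prod.snd hv).symm

/-- Exactness of `0 → 𝔪 → (𝔤 ⊕ 𝔪)/𝔥 → 𝔤/𝔥` in the middle. -/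
theorem exists_mIncl_eq (y : (EG × EM) ⧸ twistedSub EG EH τ) (hy : sigmaProj EG EH τ y = 0) :
    ∃ η, mIncl EG EH τ η = y := by
  induction y using Submodule.Quotient.induction_on with
  | _ w =>
    obtain ⟨v, hv⟩ := (Submodule.Quotient.mk_eq_zero _).1 hy
    refine ⟨(w - twistedIncl EG EH τ v).2, (Submodule.Quotient.eq _).2 ⟨-v, ?_⟩⟩
    refine Prod.ext ?_ ?_
    · change dIncl EG EH H (-v) = 0 - w.1
      rw [map_neg, zero_sub]
      exact congrArg Neg.neg hv
    · change (twistedIncl EG EH τ (-v)).2 = (w.2 - (twistedIncl EG EH τ v).2) - w.2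
      rw [map_neg, Prod.snd_neg]
      abel

theorem existsUnique_eq_add_mIncl (c : ℂ) (ν ν' : HomRep EG EH τ) (hν : ν ∈ aLambda EG EH τ c)
    (hν' : ν' ∈ aLambda EG EH τ c) :
    ∃! μ : (EG ⧸ lieSub EG EH H) →L[ℂ] EM, ν' = ν + (mIncl EG EH τ).comp μ := by
  have h1 : ∀ x, ∃ η, mIncl EG EH τ η = ν' x - ν x := fun x =>
    exists_mIncl_eq EG EH τ _ (by rw [map_sub, hν x, hν' x, sub_self])
  choose f hf using h1
  let μ : (EG ⧸ lieSub EG EH H) →ₗ[ℂ] EM :=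
    { toFun := f
      map_add' := fun x y => mIncl_injective EG EH τ (by
        rw [hf, map_add, map_add, map_add, hf, hf]; abel)
      map_smul' := fun a x => mIncl_injective EG EH τ (by
        rw [hf, map_smul, map_smul, RingHom.id_apply, map_smul, hf, smul_sub]) }
  refine ⟨LinearMap.toContinuousLinearMap μ, ?_, fun μ' hμ' => ?_⟩
  · ext x
    exact (add_eq_of_eq_sub' (hf x)).symm
  · ext x
    refine mIncl_injective EG EH τ ?_
    refine Eq.trans ?_ (hf x).symm
    rw [hμ']
    exact (add_sub_cancel_left _ _).symm

theorem homAction_add_mIncl (h : H) (ν : HomRep EG EH τ) (μ : (EG ⧸ lieSub EG EH H) →L[ℂ] EM) :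
    homAction EG EH τ h (ν + (mIncl EG EH τ).comp μ) = homAction EG EH τ h ν +
      (mIncl EG EH τ).comp ((Ad EM (τ.toMonoidHom h)).comp (μ.comp (baseAd EG EH h⁻¹))) := by
  refine ContinuousLinearMap.ext fun x => ?_
  refine (map_add (totalAd EG EH τ h) _ _).trans (congrArg (totalAd EG EH τ h _ + ·) ?_)
  refine congrArg Submodule.Quotient.mk (Prod.ext ?_ rfl)
  exact map_zero (Ad EG (h : G))

end Affine

end LambdaConn

end

theorem proposition4p2
    {EG EH EM G M : Type*}
    [NormedAddCommGroup EG] [NormedSpace ℂ EG] [FiniteDimensional ℂ EG]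
    [NormedAddCommGroup EH] [NormedSpace ℂ EH] [FiniteDimensional ℂ EH]
    [NormedAddCommGroup EM] [NormedSpace ℂ EM] [FiniteDimensional ℂ EM]
    [TopologicalSpace G] [ChartedSpace EG G] [Group G] [LieGroup 𝓘(ℂ, EG) ω G]
    [TopologicalSpace M] [ChartedSpace EM M] [Group M] [LieGroup 𝓘(ℂ, EM) ω M]
    (H : Subgroup G) [ChartedSpace EH H] [LieGroup 𝓘(ℂ, EH) ω H] [IsClosedLieSubgroup EG EH H]
    (τ : ContMDiffMonoidMorphism 𝓘(ℂ, EH) 𝓘(ℂ, EM) ω H M) :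
    -- `𝔞_c` is a nonempty affine space modelled on `Hom(𝔤/𝔥, 𝔪)`, compatibly with `H`
    (∀ c : ℂ, (aLambda EG EH τ c).Nonempty ∧
      (∀ ν ∈ aLambda EG EH τ c, ∀ μ : (EG ⧸ lieSub EG EH H) →L[ℂ] EM,
        ν + (mIncl EG EH τ).comp μ ∈ aLambda EG EH τ c) ∧
      (∀ ν ∈ aLambda EG EH τ c, ∀ ν' ∈ aLambda EG EH τ c,
        ∃! μ : (EG ⧸ lieSub EG EH H) →L[ℂ] EM, ν' = ν + (mIncl EG EH τ).comp μ) ∧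
      (∀ h : H, ∀ ν ∈ aLambda EG EH τ c, homAction EG EH τ h ν ∈ aLambda EG EH τ c) ∧
      (∀ h : H, ∀ ν ∈ aLambda EG EH τ c, ∀ μ : (EG ⧸ lieSub EG EH H) →L[ℂ] EM,
        homAction EG EH τ h (ν + (mIncl EG EH τ).comp μ) = homAction EG EH τ h ν +
          (mIncl EG EH τ).comp ((Ad EM (τ.toMonoidHom h)).comp (μ.comp (baseAd EG EH h⁻¹))))) ∧
    -- a biholomorphism `G ×^H Hom(𝔤/𝔥, (𝔤 ⊕ 𝔪)/𝔥) ≅ Tot(At P ⊗ Ω_X)` over `X = G ⧸ H`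
    ∃ Φ : Diffeomorph 𝓘(ℂ, sliceModel EG EH H × HomRep EG EH τ)
        (𝓘(ℂ, sliceModel EG EH H).prod
          𝓘(ℂ, sliceModel EG EH H →L[ℂ] (sliceModel EG EH H × EM)))
        (Assoc (homogBundle EG EH H) (homAction EG EH τ)) (AtOmega (homogExtension EG EH τ)) ω,
      (∀ g : G, ∃ L : HomRep EG EH τ ≃ₗ[ℂ]
          (TangentSpace 𝓘(ℂ, sliceModel EG EH H) (QuotientGroup.mk g : G ⧸ H) →L[ℂ]
            AtiyahFibre (homogExtension EG EH τ) (QuotientGroup.mk g : G ⧸ H)),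
        (∀ ν : HomRep EG EH τ, Φ (Assoc.mk (homogBundle EG EH H) (homAction EG EH τ) g ν) =
          ⟨(QuotientGroup.mk g : G ⧸ H), L ν⟩) ∧
        -- under `T_x X = 𝔤/𝔥` and `At P_x = (𝔤 ⊕ 𝔪)/𝔥` at `x = g H`, the map `L ν` is `ν`
        ∀ (ν : HomRep EG EH τ) (ξ ξ' : EG) (η' : EM),
          ν (Submodule.Quotient.mk ξ) = Submodule.Quotient.mk (ξ', η') →
          AtiyahFibre.eval (homogExtension EG EH τ)
              (L ν (mfderiv 𝓘(ℂ, EG) 𝓘(ℂ, sliceModel EG EH H) (QuotientGroup.mk : G → G ⧸ H) g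
                (mfderiv 𝓘(ℂ, EG) 𝓘(ℂ, EG) (fun a : G => g * a) 1 ξ : EG)))
              (extMk EG EH τ g 1) rfl =
            mfderiv (𝓘(ℂ, EG).prod 𝓘(ℂ, EM)) 𝓘(ℂ, sliceModel EG EH H × EM)
              (fun p : G × M => extMk EG EH τ p.1 p.2) (g, 1)
              ((mfderiv 𝓘(ℂ, EG) 𝓘(ℂ, EG) (fun a : G => g * a) 1 ξ' : EG), η')) ∧
      -- it restricts to an isomorphism of `G ×^H 𝔞_c` with `C_c(P)`
      ∀ c : ℂ, ∃ Ψ : Assoc (homogBundle EG EH H) (affAction EG EH τ c) ≃ₜ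
          Clambda (homogExtension EG EH τ) c,
        ∀ (g : G) (ν : aLambda EG EH τ c),
          (Ψ (Assoc.mk (homogBundle EG EH H) (affAction EG EH τ c) g ν) :
              AtOmega (homogExtension EG EH τ)) =
            Φ (Assoc.mk (homogBundle EG EH H) (homAction EG EH τ) g ν) := by
  refine ⟨fun c => ⟨aLambda_nonempty EG EH τ c, fun ν hν μ x => ?_,
    fun ν hν ν' hν' => existsUnique_eq_add_mIncl EG EH τ c ν ν' hν hν',
    fun h ν hν => homAction_mem EG EH τ c h ν hν,
    fun h ν _ μ => homAction_add_mIncl EG EH τ h ν μ⟩,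
    assocDiffeomorph EG EH τ, fun g => ⟨fibreIso EG EH τ g rfl, fun ν => ?_, ?_⟩,
    exists_homeomorph_Clambda EG EH τ⟩
  · refine ((sigmaProj EG EH τ).map_add (ν x) _).trans ?_
    rw [hν x]
    exact (congrArg (c • x + ·) (sigmaProj_mIncl EG EH τ (μ x))).trans (add_zero _)
  · exact assocEquiv_mk EG EH τ g rfl ν
  · intro ν ξ ξ' η' hν
    have h1 := fibreIso_apply EG EH τ g rfl ν (Submodule.Quotient.mk ξ)
    have h2 : tangentEquiv EG EH H (g : G ⧸ H) g (Submodule.Quotient.mk ξ) =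
        mfderiv 𝓘(ℂ, EG) 𝓘(ℂ, sliceModel EG EH H) (QuotientGroup.mk : G → G ⧸ H) g
          (mfderiv 𝓘(ℂ, EG) 𝓘(ℂ, EG) (fun a : G => g * a) 1 ξ : EG) :=
      baseMap_apply EG EH H g ξ
    rw [hν] at h1
    rw [← h2, h1]
    exact (eval_atEquiv EG EH τ g rfl rfl _).trans (totMap_apply EG EH τ g ξ' η')
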